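/- Let $\mathcal X$ be a Polish space with a compatible metric and open balls $B_\delta(x)$, and let $\mathcal P(\mathcal X)$ be the space of Borel probability measures on $\mathcal X$ with the narrow topology. Let $\bar\mu\in\mathcal P(\mathcal X)$ and let $\tau:\mathcal X\to[0,+\infty]$ be measurable. Define $$\xi(x)=\sup_{\delta>0}\ \sup\Big\{c\ge 0:\int_{B_\delta(x)}e^{c\tau}\,d\bar\mu<+\infty\Big\},\qquad \xi^\infty=\sup_{K\subset\mathcal X\text{ compact}}\ \sup\Big\{c\ge 0:\int_{K^c}e^{c\tau}\,d\bar\mu<+\infty\Big\},$$ and assume (A1) $\bar\mu(\tau=0)=\bar\mu(\tau=+\infty)=0$; (A2) $\bar\mu(\xi<+\infty)=0$; (A3) $\xi^\infty=+\infty$. (No moment condition is imposed on $\tau$.) Let $x_1,x_2,\dots$ be i.i.d. with law $\bar\mu$, and put $S_0=0$, $S_n=\sum_{i=1}^n\tau(x_i)$, $\mathcal N_t=\inf\{n\in\{0,1,2,\dots\}:S_{n+1}\ge t\}$, $X_t=x_{\mathcal N_t+1}$. For $t>0$ let $\pi_t=\frac1t\int_{[0,t)}\delta_{X_s}\,ds\in\mathcal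 P(\mathcal X)$, and let $\mathbb P_t$ be the law of $\pi_t$, a Borel probability measure on $\mathcal P(\mathcal X)$. For $\nu\in\mathcal P(\mathcal X)$ let $\nu=\nu_a+\nu_s$ be its Lebesgue decomposition with respect to $\bar\mu$ ($\nu_a\ll\bar\mu$, $\nu_s\perp\bar\mu$), write $\nu_a(1/\tau)=\int\frac1\tau\,d\nu_a$ and $\nu_s(\xi)=\int\xi\,d\nu_s$, and, when $\nu_a(1/\tau)\in(0,+\infty)$, let $\bar\nu_a(dx)=\frac{1}{\nu_a(1/\tau)}\frac1{\tau(x)}\nu_a(dx)\in\mathcal P(\mathcal X)$. Let $H(\cdot|\bar\mu)$ denote the relative entropy with respect to $\bar\mu$, and define $I:\mathcal P(\mathcal X)\to[0,+\infty]$ by $$I(\nu)=\begin{cases}\nu_a(1/\tau)\,H(\bar\nu_a|\bar\mu)+\nu_s(\xi)&\text{if }\nu_a(1/\tau)<+\infty,\\+\infty&\text{otherwise,}\end{cases}$$ where the first summand is understood to be $0$ if $\nu_a(1/\tau)=0$. Then $(\mathbb P_t)_{t>0}$ satisfies a good large deviations principle on $\mathcal P(\mathcal X)$ with speed $t$ and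 rate $I$. That is, $I\not\equiv+\infty$, the set $\{I\le M\}$ is compact for every $M\in(0,+\infty)$, and $$\limsup_{t\to+\infty}\frac1t\log\mathbb P_t(C)\le-\inf_{\nu\in C}I(\nu)\quad\text{for every closed } C\subset\mathcal P(\mathcal X),$$ $$\liminf_{t\to+\infty}\frac1t\log\mathbb P_t(O)\ge-\inf_{\nu\in O}I(\nu)\quad\text{for every open } O\subset\mathcal P(\mathcal X).$$ -/

import Mathlib

open MeasureTheory Set Filter Topology
open scoped ENNReal NNReal

noncomputable section

namespace RenewalLDP

/-! ### Large deviations principles -/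

/-- `I` is a good rate function: `I` is not identically `+∞` and its sublevel sets at
positive (finite) heights are compact. -/
def IsGoodRate {Y : Type*} [TopologicalSpace Y] (I : Y → ℝ≥0∞) : Prop :=
  (∀ M : ℝ≥0, 0 < M → IsCompact {y | I y ≤ (M : ℝ≥0∞)}) ∧ ∃ y, I y ≠ ⊤

/-- A family `(Q t)_{t > 0}` of Borel probability measures on `Y` satisfies a good large
deviations principle with speed `t` and rate `I`. Logarithms take values in `[-∞, +∞]`, with
`log 0 = -∞`, and the infimum of `I` over the empty set is `+∞`. -/
structure GoodLDP {Y : Type*} [TopologicalSpace Y]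
    (Q : Ioi (0 : ℝ) → @Measure Y (borel Y)) (I : Y → ℝ≥0∞) : Prop where
  isProbabilityMeasure : ∀ t, IsProbabilityMeasure (Q t)
  isGoodRate : IsGoodRate I
  upper_bound : ∀ C : Set Y, IsClosed C →
    limsup (fun t : Ioi (0 : ℝ) ↦ ((1 / (t : ℝ) : ℝ) : EReal) * ENNReal.log (Q t C)) atTop
      ≤ -((⨅ u ∈ C, I u : ℝ≥0∞) : EReal)
  lower_bound : ∀ O : Set Y, IsOpen O →
    -((⨅ u ∈ O, I u : ℝ≥0∞) : EReal)
      ≤ liminf (fun t : Ioi (0 : ℝ) ↦ ((1 / (t : ℝ) : ℝ) : EReal) * ENNReal.log (Q t O)) atTop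

/-! ### The renewal-time process and its empirical measure

A sequence `(x₁, x₂, …)` is represented by `x : ℕ → X`, with `x i` in the role of `x_{i+1}`. -/

/-- The arrival times `S_n = τ(x₁) + ⋯ + τ(x_n)`, with `S_0 = 0`. -/
def arrivalTime {X : Type*} (τ : X → ℝ≥0∞) (x : ℕ → X) (n : ℕ) : ℝ≥0∞ :=
  ∑ i ∈ Finset.range n, τ (x i)

/-- The counting process `N_t = inf {n ∈ ℕ : S_{n+1} ≥ t}`. (The infimum is taken to be `0`
when no such `n` exists; that happens with probability zero when `τ > 0` almost surely.) -/
def renewalCount {X : Type*} (τ : X → ℝ≥0∞) (x : ℕ → X) (t : ℝ) : ℕ :=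
  sInf {n : ℕ | ENNReal.ofReal t ≤ arrivalTime τ x (n + 1)}

/-- The process `X_t = x_{N_t + 1}`. -/
def renewalProcess {X : Type*} (τ : X → ℝ≥0∞) (x : ℕ → X) (t : ℝ) : X :=
  x (renewalCount τ x t)

theorem measurable_renewalCount {X : Type*} (τ : X → ℝ≥0∞) (x : ℕ → X) :
    Measurable (renewalCount τ x) := by
  have hm : ∀ n, Measurable fun s : ℝ ↦ ENNReal.ofReal s ≤ arrivalTime τ x (n + 1) := fun n ↦
    measurableSet_setOfPred.1 (measurableSet_le ENNReal.measurable_ofReal measurable_const)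
  refine measurable_to_countable' fun k ↦ ?_
  have : renewalCount τ x ⁻¹' {k} =
      {s | (ENNReal.ofReal s ≤ arrivalTime τ x (k + 1) ∧
          ∀ j < k, ¬ ENNReal.ofReal s ≤ arrivalTime τ x (j + 1)) ∨
        (k = 0 ∧ ∀ j, ¬ ENNReal.ofReal s ≤ arrivalTime τ x (j + 1))} := by
    ext s
    simp only [mem_preimage, mem_singleton_iff, renewalCount, mem_ofPred_eq]
    constructor
    · intro h
      rcases eq_empty_or_nonempty {n : ℕ | ENNReal.ofReal s ≤ arrivalTime τ x (n + 1)} with he | hne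
      · right
        refine ⟨by rw [← h, he, Nat.sInf_empty], fun j hj ↦ ?_⟩
        have : j ∈ {n : ℕ | ENNReal.ofReal s ≤ arrivalTime τ x (n + 1)} := hj
        rw [he] at this
        exact this
      · left
        subst h
        exact ⟨Nat.sInf_mem hne, fun j hj hj' ↦ Nat.notMem_of_lt_sInf hj hj'⟩
    · rintro (⟨h1, h2⟩ | ⟨h1, h2⟩)
      · refine le_antisymm (Nat.sInf_le h1) ?_
        by_contra! hlt
        exact h2 _ hlt
          (Nat.sInf_mem (s := {n : ℕ | ENNReal.ofReal s ≤ arrivalTime τ x (n + 1)}) ⟨k, h1⟩)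
      · subst h1
        have : {n : ℕ | ENNReal.ofReal s ≤ arrivalTime τ x (n + 1)} = ∅ := by
          ext j
          simpa using h2 j
        rw [this, Nat.sInf_empty]
  rw [this]
  exact measurableSet_setOfPred.2 <|
    ((hm k).and (Measurable.forall fun j ↦ measurable_const.imp (hm j).not)).or
      (measurable_const.and (Measurable.forall fun j ↦ (hm j).not))

theorem measurable_renewalProcess {X : Type*} [MeasurableSpace X] (τ : X → ℝ≥0∞) (x : ℕ → X) :
    Measurable (renewalProcess τ x) :=
  measurable_from_nat.comp (measurable_renewalCount τ x)

/-- The empirical measure `π_t = (1/t) ∫_{[0,t)} δ_{X_s} ds`, that is, `1/t` times the image of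
Lebesgue measure on `[0,t)` under `s ↦ X_s`. -/
def empiricalMeasure {X : Type*} [MeasurableSpace X] (τ : X → ℝ≥0∞) (t : Ioi (0 : ℝ))
    (x : ℕ → X) : ProbabilityMeasure X :=
  ⟨(ENNReal.ofReal (t : ℝ))⁻¹ •
      ((volume : Measure ℝ).restrict (Ico 0 (t : ℝ))).map (renewalProcess τ x), by
    constructor
    rw [Measure.smul_apply, Measure.map_apply (measurable_renewalProcess τ x) MeasurableSet.univ]
    have ht : (0 : ℝ) < t := t.2
    simp only [preimage_univ, Measure.restrict_apply MeasurableSet.univ, univ_inter,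
      Real.volume_Ico, sub_zero, smul_eq_mul]
    exact ENNReal.inv_mul_cancel (by simpa using ht) ENNReal.ofReal_ne_top⟩

/-- The law `P_t` of `π_t` when `(x_i)` is i.i.d. with marginal law `μ`: a Borel measure on the
space of probability measures on `X` with the narrow topology. -/
def empiricalLaw {X : Type*} [TopologicalSpace X] [MeasurableSpace X] [OpensMeasurableSpace X]
    (μ : Measure X) [IsProbabilityMeasure μ] (τ : X → ℝ≥0∞) (t : Ioi (0 : ℝ)) :
    @Measure (ProbabilityMeasure X) (borel (ProbabilityMeasure X)) :=
  @Measure.map (ℕ → X) (ProbabilityMeasure X) _ (borel (ProbabilityMeasure X))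
    (empiricalMeasure τ t) (Measure.infinitePi fun _ : ℕ ↦ μ)

/-! ### The rate functional -/

/-- `sup {c ≥ 0 : ∫_A e^{c τ} dμ < +∞}`. -/
def expRate {X : Type*} [MeasurableSpace X] (μ : Measure X) (τ : X → ℝ≥0∞) (A : Set X) : ℝ≥0∞ :=
  ⨆ (c : ℝ≥0) (_ : ∫⁻ y in A, EReal.exp (((c : ℝ≥0∞) * τ y : ℝ≥0∞) : EReal) ∂μ < ⊤), (c : ℝ≥0∞)

/-- The local exponential rate `ξ(x)`, the limit as `δ ↓ 0` (which is the supremum over `δ > 0`)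
of `sup {c ≥ 0 : ∫_{B_δ(x)} e^{c τ} dμ < +∞}`. -/
def xi {X : Type*} [MetricSpace X] [MeasurableSpace X] (μ : Measure X) (τ : X → ℝ≥0∞)
    (x : X) : ℝ≥0∞ :=
  ⨆ (δ : ℝ) (_ : 0 < δ), expRate μ τ (Metric.ball x δ)

/-- The exponential rate at infinity `ξ^∞`. -/
def xiInfty {X : Type*} [TopologicalSpace X] [MeasurableSpace X] (μ : Measure X)
    (τ : X → ℝ≥0∞) : ℝ≥0∞ :=
  ⨆ (K : Set X) (_ : IsCompact K), expRate μ τ Kᶜ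

/-- The absolutely continuous part `ν_a` of `ν` with respect to `μ`. -/
def acPart {X : Type*} [MeasurableSpace X] (μ ν : Measure X) : Measure X :=
  μ.withDensity (ν.rnDeriv μ)

/-- The integral `ν(1/τ)`, with `1/0 = +∞` and `1/∞ = 0`. -/
def invTimeIntegral {X : Type*} [MeasurableSpace X] (τ : X → ℝ≥0∞) (ν : Measure X) : ℝ≥0∞ :=
  ∫⁻ x, (τ x)⁻¹ ∂ν

/-- The normalized measure `(1/τ) ν / ν(1/τ)`. It is a probability measure when
`ν(1/τ) ∈ (0, +∞)`, and it is used only then. -/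
def barMeasure {X : Type*} [MeasurableSpace X] (τ : X → ℝ≥0∞) (ν : Measure X) : Measure X :=
  (invTimeIntegral τ ν)⁻¹ • ν.withDensity fun x ↦ (τ x)⁻¹

open Classical in
/-- The rate functional: `I(ν) = ν_a(1/τ) H(ν̄_a | μ) + ν_s(ξ)` if `ν_a(1/τ) < +∞`, and `+∞`
otherwise. The first summand is `0` when `ν_a(1/τ) = 0`, since `0 * a = 0` for all `a : ℝ≥0∞`,
`a = +∞` included. -/
def rate {X : Type*} [MetricSpace X] [MeasurableSpace X] (μ : Measure X) (τ : X → ℝ≥0∞)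
    (ν : ProbabilityMeasure X) : ℝ≥0∞ :=
  if invTimeIntegral τ (acPart μ (ν : Measure X)) < ⊤ then
    invTimeIntegral τ (acPart μ (ν : Measure X)) *
        InformationTheory.klDiv (barMeasure τ (acPart μ (ν : Measure X))) μ
      + ∫⁻ x, xi μ τ x ∂((ν : Measure X).singularPart μ)
  else ⊤

end RenewalLDP

end

/-!
Write `T` for the holding time `τ` as a real function, `S_n` for the arrival times, and `P` for
the law of the i.i.d. sequence.

**Upper bound.** Along a path, `t π_t(f)` is the sum of the `T(x_i) f(x_i)` over the completed
holding times plus a fraction of the next term. If `μ(e^{T f}) < 1`, summing over the number of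
completed holding times gives a convergent geometric series, so that
`P(π_t(f) ≥ a) ≤ const · e^{-t a}` (`measure_le_integral_empiricalMeasure_le`). With `f` large off
a compact set, which is admissible because `ξ^∞ = ∞`, this yields exponential tightness
(`exponential_tightness`). A covering argument then gives the upper bound with the rate
`J(ν) = sup {ν(f) : f ∈ C_b(X), μ(e^{T f}) < 1}` (`upper_bound_of_isClosed`).

**`I ≤ J`** (`exists_boundedContinuous_of_lt_rate`). For the absolutely continuous part one uses
`f = log h / T` with `h` the density of `ν̄_a`, suitably truncated, and for the singular part
`f = ξ`, slightly lowered and truncated. Both are glued along a `μ`-null set carrying `ν_s`. The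
result is only measurable, but `e^{f(x) T}` is `μ`-integrable near `ν`-almost every `x`, using
`ξ = ∞` `μ`-almost everywhere, and this is what is needed to replace `f` by a continuous function
(`exists_boundedContinuous_of_measurable`).

**Lower bound.** For bounded continuous functions `g_1, …, g_d`, with `g_1 = 1`, consider the sums
of the vectors `Z(x_l) = T(x_l) (g_1(x_l), …, g_d(x_l))`. The pairs `(v, h)` for which some
partial sum is close to `t v` with probability at least about `e^{-t h}` form a closed convex cone
(`Accessible`, `isClosed_accessible`, `Accessible.add`), by independence of consecutive blocks.
The cone contains the mean of `Z` under any `ρ` for which it exists, at cost `H(ρ | μ)` if this is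
finite, by a change of measure and the law of large numbers (`accessible_of_klDiv_ne_top`). It
contains `(g(y), ξ(y))` as well: as `e^{cT}` is not integrable near `y` for `c > ξ(y)`, the time
`t` can be filled with holding times of a fixed large size spent near `y`
(`accessible_of_xi_lt_top`). A closed convex cone is stable under integration, so it contains
`(ν(g), I(ν))` (`accessible_rate`). The coordinate `g_1 = 1` forces `S_n` to be close to `t`, and
then `π_t(g)` is close to `ν(g)`. No moment of `T` is needed, since `ρ = ν̄_a` satisfies
`ρ(T) = 1/ν_a(1/τ) · ν_a(X)`, which is finite.

**Goodness of `I`.** Comparing the lower bound with the exponential estimate gives `J ≤ I`, so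
`I = J` is lower semicontinuous, and comparing it with exponential tightness shows that sublevel
sets lie in compact sets. The upper bound on the whole space shows `I ≢ ∞`.
-/

open scoped BoundedContinuousFunction

open ProbabilityTheory

namespace RenewalLDP

/-! ### Time averages along a renewal path -/

/-- The holding time `τ` as a real-valued function; the null event `τ = ∞` is sent to `0`. -/
noncomputable def realTime {X : Type*} (τ : X → ℝ≥0∞) (x : X) : ℝ := (τ x).toReal

/-- The arrival times `S_n` as real numbers, computed with `realTime`. They agree with `arrivalTime`
on paths along which `τ` is finite. -/
noncomputable def realArrival {X : Type*} (τ : X → ℝ≥0∞) (x : ℕ → X) (n : ℕ) : ℝ :=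
  ∑ i ∈ Finset.range n, realTime τ (x i)

section Path

variable {X : Type*} {τ : X → ℝ≥0∞} {x : ℕ → X}

theorem realTime_nonneg (τ : X → ℝ≥0∞) (x : X) : 0 ≤ realTime τ x := ENNReal.toReal_nonneg

theorem measurable_realTime [MeasurableSpace X] (hτ : Measurable τ) : Measurable (realTime τ) :=
  hτ.ennreal_toReal

theorem realArrival_succ (τ : X → ℝ≥0∞) (x : ℕ → X) (n : ℕ) :
    realArrival τ x (n + 1) = realArrival τ x n + realTime τ (x n) :=
  Finset.sum_range_succ _ _

theorem realArrival_nonneg (τ : X → ℝ≥0∞) (x : ℕ → X) (n : ℕ) : 0 ≤ realArrival τ x n :=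
  Finset.sum_nonneg fun _ _ ↦ realTime_nonneg _ _

theorem realArrival_mono (τ : X → ℝ≥0∞) (x : ℕ → X) : Monotone (realArrival τ x) :=
  monotone_nat_of_le_succ fun n ↦ by
    rw [realArrival_succ]; linarith [realTime_nonneg τ (x n)]

theorem arrivalTime_eq_ofReal (hx : ∀ i, τ (x i) ≠ ⊤) (n : ℕ) :
    arrivalTime τ x n = ENNReal.ofReal (realArrival τ x n) := by
  rw [arrivalTime, realArrival, ENNReal.ofReal_sum_of_nonneg fun _ _ ↦ realTime_nonneg _ _]
  exact Finset.sum_congr rfl fun i _ ↦ (ENNReal.ofReal_toReal (hx i)).symm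

theorem renewalProcess_eq_of_mem_Ioc (hx : ∀ i, τ (x i) ≠ ⊤) {s : ℝ} {n : ℕ}
    (hs : s ∈ Ioc (realArrival τ x n) (realArrival τ x (n + 1))) :
    renewalProcess τ x s = x n := by
  have hmem : ∀ j, ENNReal.ofReal s ≤ arrivalTime τ x (j + 1) ↔ s ≤ realArrival τ x (j + 1) :=
    fun j ↦ by
      rw [arrivalTime_eq_ofReal hx, ENNReal.ofReal_le_ofReal_iff (realArrival_nonneg _ _ _)]
  have : renewalCount τ x s = n := by
    have hn : n ∈ {j : ℕ | ENNReal.ofReal s ≤ arrivalTime τ x (j + 1)} := (hmem n).2 hs.2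
    refine le_antisymm (Nat.sInf_le hn) ?_
    refine le_csInf ⟨n, hn⟩ fun j hj ↦ ?_
    by_contra! hlt
    exact absurd (((hmem j).1 hj).trans (realArrival_mono τ x hlt)) (not_le.2 hs.1)
  rw [renewalProcess, this]

theorem integral_renewalProcess_Ioc (hx : ∀ i, τ (x i) ≠ ⊤) (f : X → ℝ) {n : ℕ} {b : ℝ}
    (hb : b ∈ Icc (realArrival τ x n) (realArrival τ x (n + 1))) :
    ∫ s in (realArrival τ x n)..b, f (renewalProcess τ x s) =
      (b - realArrival τ x n) * f (x n) := by
  rw [intervalIntegral.integral_of_le hb.1, setIntegral_congr_fun (g := fun _ ↦ f (x n))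
    measurableSet_Ioc, ← intervalIntegral.integral_of_le hb.1, intervalIntegral.integral_const,
    smul_eq_mul]
  intro s hs
  simp only
  rw [renewalProcess_eq_of_mem_Ioc hx ⟨hs.1, hs.2.trans hb.2⟩]

variable [MeasurableSpace X] {f : X → ℝ} {M : ℝ}

theorem intervalIntegrable_comp_renewalProcess (τ : X → ℝ≥0∞) (x : ℕ → X) (hf : Measurable f)
    (hM : ∀ y, |f y| ≤ M) (a b : ℝ) :
    IntervalIntegrable (fun s ↦ f (renewalProcess τ x s)) volume a b :=
  intervalIntegrable_const (c := M) |>.mono_fun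
    ((hf.comp (measurable_renewalProcess τ x)).aestronglyMeasurable)
    (Eventually.of_forall fun s ↦ by
      simpa using (hM _).trans (le_abs_self M))

theorem integral_renewalProcess_arrival (hx : ∀ i, τ (x i) ≠ ⊤) (hf : Measurable f)
    (hM : ∀ y, |f y| ≤ M) (n : ℕ) :
    ∫ s in (0 : ℝ)..(realArrival τ x n), f (renewalProcess τ x s) =
      ∑ i ∈ Finset.range n, realTime τ (x i) * f (x i) := by
  induction n with
  | zero => simp [realArrival]
  | succ n ih =>
    rw [← intervalIntegral.integral_add_adjacent_intervals
      (intervalIntegrable_comp_renewalProcess τ x hf hM _ _)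
      (intervalIntegrable_comp_renewalProcess τ x hf hM (realArrival τ x n) _), ih,
      integral_renewalProcess_Ioc hx f ⟨realArrival_mono τ x n.le_succ, le_rfl⟩,
      Finset.sum_range_succ, realArrival_succ]
    ring

theorem integral_empiricalMeasure (τ : X → ℝ≥0∞) (x : ℕ → X) (t : Ioi (0 : ℝ))
    (hf : Measurable f) :
    ∫ y, f y ∂(empiricalMeasure τ t x : Measure X) =
      (t : ℝ)⁻¹ * ∫ s in (0 : ℝ)..t, f (renewalProcess τ x s) := by
  have ht : (0 : ℝ) < t := t.2
  change ∫ y, f y ∂((ENNReal.ofReal (t : ℝ))⁻¹ •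
      ((volume : Measure ℝ).restrict (Ico 0 (t : ℝ))).map (renewalProcess τ x)) = _
  rw [integral_smul_measure, integral_map (measurable_renewalProcess τ x).aemeasurable
    hf.aestronglyMeasurable, intervalIntegral.integral_of_le ht.le,
    integral_Ico_eq_integral_Ioc, ENNReal.toReal_inv, ENNReal.toReal_ofReal ht.le, smul_eq_mul]

/-- Replacing the horizon `t` by an arrival time costs at most the distance between the two. -/
theorem abs_mul_integral_empiricalMeasure_sub_le (hx : ∀ i, τ (x i) ≠ ⊤) (t : Ioi (0 : ℝ))
    (hf : Measurable f) (hM : ∀ y, |f y| ≤ M) (n : ℕ) :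
    |(t : ℝ) * ∫ y, f y ∂(empiricalMeasure τ t x : Measure X) -
      ∑ i ∈ Finset.range n, realTime τ (x i) * f (x i)| ≤ M * |realArrival τ x n - t| := by
  have ht : (0 : ℝ) < t := t.2
  rw [integral_empiricalMeasure τ x t hf, mul_inv_cancel_left₀ ht.ne',
    ← integral_renewalProcess_arrival hx hf hM,
    intervalIntegral.integral_interval_sub_left
      (intervalIntegrable_comp_renewalProcess τ x hf hM _ _)
      (intervalIntegrable_comp_renewalProcess τ x hf hM _ _), abs_sub_comm]
  exact intervalIntegral.norm_integral_le_of_norm_le_const fun s _ ↦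
    (Real.norm_eq_abs _).trans_le (hM _)

/-- Pointwise bound behind the exponential estimate: exactly one index `n` satisfies
`S_n < t ≤ S_{n+1}`, and for it the contribution of the incomplete last interval is at most
`1 + e^{τ f}`. -/
theorem exp_mul_integral_empiricalMeasure_le (hx : ∀ i, τ (x i) ≠ ⊤)
    (hx' : Tendsto (realArrival τ x) atTop atTop) (t : Ioi (0 : ℝ)) (hf : Measurable f)
    (hM : ∀ y, |f y| ≤ M) :
    ENNReal.ofReal (Real.exp ((t : ℝ) * ∫ y, f y ∂(empiricalMeasure τ t x : Measure X))) ≤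
      ∑' n, ((∏ i ∈ Finset.range n, ENNReal.ofReal (Real.exp (f (x i) * realTime τ (x i)))) +
        ∏ i ∈ Finset.range (n + 1), ENNReal.ofReal (Real.exp (f (x i) * realTime τ (x i)))) := by
  have ht : (0 : ℝ) < t := t.2
  obtain ⟨n, hn1, hn2⟩ : ∃ n, realArrival τ x n < t ∧ (t : ℝ) ≤ realArrival τ x (n + 1) := by
    classical
    have hex : ∃ n, (t : ℝ) ≤ realArrival τ x n := (hx'.eventually_ge_atTop _).exists
    have h0 : Nat.find hex ≠ 0 := by
      intro h
      have := Nat.find_spec hex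
      rw [h] at this
      simp [realArrival] at this
      linarith
    obtain ⟨m, hm⟩ := Nat.exists_eq_succ_of_ne_zero h0
    refine ⟨m, ?_, ?_⟩
    · have := Nat.find_min hex (m := m) (by omega)
      exact not_le.1 this
    · have := Nat.find_spec hex
      rwa [hm] at this
  refine le_trans ?_ (ENNReal.le_tsum n)
  have key : (t : ℝ) * ∫ y, f y ∂(empiricalMeasure τ t x : Measure X) =
      ∑ i ∈ Finset.range n, f (x i) * realTime τ (x i) + (t - realArrival τ x n) * f (x n) := by
    rw [integral_empiricalMeasure τ x t hf, mul_inv_cancel_left₀ ht.ne',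
      ← intervalIntegral.integral_add_adjacent_intervals
      (intervalIntegrable_comp_renewalProcess τ x hf hM _ _)
      (intervalIntegrable_comp_renewalProcess τ x hf hM (realArrival τ x n) _),
      integral_renewalProcess_Ioc hx f ⟨hn1.le, hn2⟩, integral_renewalProcess_arrival hx hf hM]
    simp_rw [mul_comm]
  have hprod : ∀ m, ∏ i ∈ Finset.range m, ENNReal.ofReal (Real.exp (f (x i) * realTime τ (x i))) =
      ENNReal.ofReal (Real.exp (∑ i ∈ Finset.range m, f (x i) * realTime τ (x i))) := fun m ↦ by
    rw [Real.exp_sum, ENNReal.ofReal_prod_of_nonneg fun _ _ ↦ (Real.exp_pos _).le]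
  rw [hprod, hprod, key, Finset.sum_range_succ,
    ← ENNReal.ofReal_add (Real.exp_pos _).le (Real.exp_pos _).le]
  refine ENNReal.ofReal_le_ofReal ?_
  rw [realArrival_succ] at hn2
  rcases le_total (f (x n)) 0 with h | h
  · refine le_trans (Real.exp_le_exp.2 ?_) (le_add_of_nonneg_right (Real.exp_pos _).le)
    nlinarith
  · refine le_trans (Real.exp_le_exp.2 ?_) (le_add_of_nonneg_left (Real.exp_pos _).le)
    nlinarith

end Path

/-! ### Independent holding times -/

theorem ae_realTime_pos {X : Type*} [MeasurableSpace X] {μ : Measure X} {τ : X → ℝ≥0∞}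
    (hA1 : μ {x | τ x = 0} = 0 ∧ μ {x | τ x = ⊤} = 0) :
    ∀ᵐ y ∂μ, τ y ≠ ⊤ ∧ 0 < realTime τ y := by
  have h0 : ∀ᵐ y ∂μ, τ y ≠ 0 := by simpa [ae_iff] using hA1.1
  have h1 : ∀ᵐ y ∂μ, τ y ≠ ⊤ := by simpa [ae_iff] using hA1.2
  filter_upwards [h0, h1] with y hy0 hy1
  exact ⟨hy1, ENNReal.toReal_pos hy0 hy1⟩

section Independent

variable {X : Type*} [MeasurableSpace X] {μ : Measure X} [IsProbabilityMeasure μ]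

theorem lintegral_prod_range_infinitePi {F : X → ℝ≥0∞} (hF : Measurable F) (n : ℕ) :
    ∫⁻ x, ∏ i ∈ Finset.range n, F (x i) ∂(Measure.infinitePi fun _ : ℕ ↦ μ) =
      (∫⁻ y, F y ∂μ) ^ n := by
  rw [lintegral_prod_eq_prod_lintegral_of_indepFun (Finset.range n)
    (fun i (x : ℕ → X) ↦ F (x i)) (iIndepFun_infinitePi (X := fun _ ↦ F) fun _ ↦ hF)
    fun i ↦ hF.comp (measurable_pi_apply i)]
  have : ∀ i, ∫⁻ x : ℕ → X, F (x i) ∂(Measure.infinitePi fun _ : ℕ ↦ μ) = ∫⁻ y, F y ∂μ := fun i ↦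
    (measurePreserving_eval_infinitePi (fun _ : ℕ ↦ μ) i).lintegral_comp hF
  simp [this]

theorem ae_infinitePi_forall {p : X → Prop} (h : ∀ᵐ y ∂μ, p y) :
    ∀ᵐ x ∂(Measure.infinitePi fun _ : ℕ ↦ μ), ∀ i, p (x i) :=
  ae_all_iff.2 fun i ↦
    (measurePreserving_eval_infinitePi (fun _ : ℕ ↦ μ) i).quasiMeasurePreserving.ae h

variable {τ : X → ℝ≥0∞}

theorem lintegral_exp_neg_mul_lt_one (hτ : Measurable τ)
    (hA1 : μ {x | τ x = 0} = 0 ∧ μ {x | τ x = ⊤} = 0) {c : ℝ} (hc : 0 < c) :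
    ∫⁻ y, ENNReal.ofReal (Real.exp (-c * realTime τ y)) ∂μ < 1 := by
  have hm : Measurable fun y ↦ ENNReal.ofReal (Real.exp (-c * realTime τ y)) :=
    ((measurable_realTime hτ).const_mul _).exp.ennreal_ofReal
  have hpt : ∀ᵐ y ∂μ, ENNReal.ofReal (Real.exp (-c * realTime τ y)) < 1 := by
    filter_upwards [ae_realTime_pos hA1] with y hy
    rw [← ENNReal.ofReal_one]
    refine (ENNReal.ofReal_lt_ofReal_iff one_pos).2 (Real.exp_lt_one_iff.2 ?_)
    nlinarith [hy.2]
  have hle : ∫⁻ y, ENNReal.ofReal (Real.exp (-c * realTime τ y)) ∂μ ≤ 1 :=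
    (lintegral_mono_ae (hpt.mono fun _ h ↦ h.le)).trans (by simp)
  calc _ < ∫⁻ _, 1 ∂μ := lintegral_strict_mono (IsProbabilityMeasure.ne_zero μ)
          aemeasurable_const (hle.trans_lt ENNReal.one_lt_top).ne hpt
    _ = 1 := by simp

theorem ae_tendsto_realArrival (hτ : Measurable τ)
    (hA1 : μ {x | τ x = 0} = 0 ∧ μ {x | τ x = ⊤} = 0) :
    ∀ᵐ x ∂(Measure.infinitePi fun _ : ℕ ↦ μ), Tendsto (realArrival τ x) atTop atTop := by
  -- `∑ₙ e^{-Sₙ}` has finite expectation, a geometric series, so its terms tend to `0`.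
  set F : X → ℝ≥0∞ := fun y ↦ ENNReal.ofReal (Real.exp (-1 * realTime τ y)) with hF
  have hFm : Measurable F := ((measurable_realTime hτ).const_mul _).exp.ennreal_ofReal
  have hq := lintegral_exp_neg_mul_lt_one hτ hA1 one_pos
  have hm : ∀ n, Measurable fun x : ℕ → X ↦ ∏ i ∈ Finset.range n, F (x i) := fun n ↦
    Finset.measurable_prod _ fun i _ ↦ hFm.comp (measurable_pi_apply i)
  have hfin : ∫⁻ x, ∑' n, ∏ i ∈ Finset.range n, F (x i)
      ∂(Measure.infinitePi fun _ : ℕ ↦ μ) ≠ ⊤ := by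
    rw [lintegral_tsum fun n ↦ (hm n).aemeasurable]
    simp_rw [lintegral_prod_range_infinitePi hFm]
    rw [ENNReal.tsum_geometric]
    exact ENNReal.inv_ne_top.2 (tsub_pos_of_lt hq).ne'
  filter_upwards [ae_lt_top (Measurable.tsum hm) hfin] with x hx
  have h0 := ENNReal.tendsto_atTop_zero_of_tsum_ne_top hx.ne
  have hprod : ∀ n, ∏ i ∈ Finset.range n, F (x i) =
      ENNReal.ofReal (Real.exp (-realArrival τ x n)) := fun n ↦ by
    rw [realArrival, ← Finset.sum_neg_distrib, Real.exp_sum,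
      ENNReal.ofReal_prod_of_nonneg fun _ _ ↦ (Real.exp_pos _).le]
    simp [hF]
  simp_rw [hprod] at h0
  have h1 : Tendsto (fun n ↦ Real.exp (-realArrival τ x n)) atTop (𝓝 0) := by
    have := (ENNReal.tendsto_toReal ENNReal.zero_ne_top).comp h0
    simpa [Function.comp_def, ENNReal.toReal_ofReal (Real.exp_pos _).le] using this
  exact tendsto_neg_atBot_iff.1 (Real.tendsto_exp_comp_nhds_zero.1 h1)

/-- Exponential Chebyshev bound. It is informative if `μ(e^{τ f}) < 1`; otherwise the right-hand
side is infinite. -/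
theorem measure_le_integral_empiricalMeasure_le (hτ : Measurable τ)
    (hA1 : μ {x | τ x = 0} = 0 ∧ μ {x | τ x = ⊤} = 0) {f : X → ℝ} {M : ℝ} (hf : Measurable f)
    (hM : ∀ y, |f y| ≤ M) (a : ℝ) (t : Ioi (0 : ℝ)) :
    (Measure.infinitePi fun _ : ℕ ↦ μ) {x | a ≤ ∫ y, f y ∂(empiricalMeasure τ t x : Measure X)} ≤
      ENNReal.ofReal (Real.exp (-(t * a))) *
        (2 * (1 - ∫⁻ y, ENNReal.ofReal (Real.exp (f y * realTime τ y)) ∂μ)⁻¹) := by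
  have ht : (0 : ℝ) < t := t.2
  set P := Measure.infinitePi fun _ : ℕ ↦ μ
  set F : X → ℝ≥0∞ := fun y ↦ ENNReal.ofReal (Real.exp (f y * realTime τ y)) with hF
  set q := ∫⁻ y, F y ∂μ
  rcases le_or_gt 1 q with hq | hq
  · rw [tsub_eq_zero_of_le hq]
    simp [ENNReal.mul_top, Real.exp_pos]
  have hFm : Measurable F := (hf.mul (measurable_realTime hτ)).exp.ennreal_ofReal
  have hm : ∀ n, Measurable fun x : ℕ → X ↦ ∏ i ∈ Finset.range n, F (x i) := fun n ↦
    Finset.measurable_prod _ fun i _ ↦ hFm.comp (measurable_pi_apply i)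
  set Φ : (ℕ → X) → ℝ≥0∞ := fun x ↦
    ∑' n, ((∏ i ∈ Finset.range n, F (x i)) + ∏ i ∈ Finset.range (n + 1), F (x i))
  have hΦm : Measurable Φ := Measurable.tsum fun n ↦ (hm n).add (hm (n + 1))
  have hΦ : ∫⁻ x, Φ x ∂P ≤ 2 * (1 - q)⁻¹ := by
    calc ∫⁻ x, Φ x ∂P
        = ∑' n, ∫⁻ x, ((∏ i ∈ Finset.range n, F (x i)) + ∏ i ∈ Finset.range (n + 1), F (x i)) ∂P :=
          lintegral_tsum fun n ↦ ((hm n).add (hm (n + 1))).aemeasurable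
      _ = ∑' n, (q ^ n + q ^ (n + 1)) := by
          congr with n
          rw [lintegral_add_left (hm n), lintegral_prod_range_infinitePi hFm,
            lintegral_prod_range_infinitePi hFm]
      _ ≤ ∑' n, 2 * q ^ n := by
          refine ENNReal.tsum_le_tsum fun n ↦ ?_
          rw [two_mul]
          exact add_le_add le_rfl (by rw [pow_succ]; exact mul_le_of_le_one_right' hq.le)
      _ = 2 * (1 - q)⁻¹ := by rw [ENNReal.tsum_mul_left, ENNReal.tsum_geometric]
  have hsub : P {x | a ≤ ∫ y, f y ∂(empiricalMeasure τ t x : Measure X)} ≤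
      P {x | ENNReal.ofReal (Real.exp (t * a)) ≤ Φ x} := by
    refine measure_mono_ae ?_
    filter_upwards [ae_infinitePi_forall (ae_realTime_pos hA1), ae_tendsto_realArrival hτ hA1]
      with x hx hx' hxa
    refine le_trans (ENNReal.ofReal_le_ofReal (Real.exp_le_exp.2 ?_))
      (exp_mul_integral_empiricalMeasure_le (fun i ↦ (hx i).1) hx' t hf hM)
    exact mul_le_mul_of_nonneg_left hxa ht.le
  have hmark := (mul_meas_ge_le_lintegral₀ (μ := P) hΦm.aemeasurable
    (ENNReal.ofReal (Real.exp (t * a)))).trans hΦ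
  refine hsub.trans ?_
  calc P {x | ENNReal.ofReal (Real.exp (t * a)) ≤ Φ x}
      = ENNReal.ofReal (Real.exp (-(t * a))) * (ENNReal.ofReal (Real.exp (t * a)) *
        P {x | ENNReal.ofReal (Real.exp (t * a)) ≤ Φ x}) := by
        rw [← mul_assoc, ← ENNReal.ofReal_mul (Real.exp_pos _).le, ← Real.exp_add]
        simp
    _ ≤ _ := by gcongr

end Independent

/-! ### The narrow topology and Borel measurability of the empirical measure -/

section Narrow

variable {X : Type*} [TopologicalSpace X] [MeasurableSpace X]

theorem isInducing_integral_probabilityMeasure [OpensMeasurableSpace X] :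
    IsInducing fun (ν : ProbabilityMeasure X) (g : X →ᵇ ℝ) ↦ ∫ y, g y ∂(ν : Measure X) := by
  refine isInducing_iff_nhds.2 fun ν ↦ le_antisymm ?_ ?_
  · refine tendsto_iff_comap.1 (tendsto_pi_nhds.2 fun g ↦ ?_)
    exact (ProbabilityMeasure.tendsto_iff_forall_integral_tendsto.1
      (tendsto_id (x := 𝓝 ν))) g
  · refine tendsto_id'.1 (ProbabilityMeasure.tendsto_iff_forall_integral_tendsto.2 fun g ↦ ?_)
    exact tendsto_pi_nhds.1 (tendsto_comap
      (f := fun (κ : ProbabilityMeasure X) (g : X →ᵇ ℝ) ↦ ∫ y, g y ∂(κ : Measure X))) g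

theorem continuous_integral_probabilityMeasure [OpensMeasurableSpace X] (g : X →ᵇ ℝ) :
    Continuous fun ν : ProbabilityMeasure X ↦ ∫ y, g y ∂(ν : Measure X) :=
  (continuous_apply g).comp isInducing_integral_probabilityMeasure.continuous

/-- Neighbourhoods in the narrow topology are determined by finitely many test functions. -/
theorem exists_finset_integral_lt_subset [OpensMeasurableSpace X] {O : Set (ProbabilityMeasure X)}
    (hO : IsOpen O) {ν : ProbabilityMeasure X} (hν : ν ∈ O) :
    ∃ (I : Finset (X →ᵇ ℝ)) (ε : ℝ), 0 < ε ∧ ∀ ν' : ProbabilityMeasure X,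
      (∀ g ∈ I, |∫ y, g y ∂(ν' : Measure X) - ∫ y, g y ∂(ν : Measure X)| < ε) → ν' ∈ O := by
  obtain ⟨U, hU, rfl⟩ := isInducing_integral_probabilityMeasure.isOpen_iff.1 hO
  obtain ⟨I, u, hu, hIu⟩ := isOpen_pi_iff.1 hU _ hν
  have h1 : ∀ g ∈ I, ∃ ε > 0, Metric.ball (∫ y, g y ∂(ν : Measure X)) ε ⊆ u g := fun g hg ↦
    Metric.isOpen_iff.1 (hu g hg).1 _ (hu g hg).2
  choose! e he hsub using h1
  obtain ⟨ε, hε, hle⟩ : ∃ ε : ℝ, 0 < ε ∧ ∀ g ∈ I, ε ≤ e g := by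
    rcases I.eq_empty_or_nonempty with rfl | hne
    · exact ⟨1, one_pos, by simp⟩
    · exact ⟨I.inf' hne e, (Finset.lt_inf'_iff hne).2 he, fun g hg ↦ Finset.inf'_le e hg⟩
  refine ⟨I, ε, hε, fun ν' h ↦ hIu fun g hg ↦ hsub g hg ?_⟩
  rw [Metric.mem_ball, Real.dist_eq]
  exact (h g hg).trans_le (hle g hg)

end Narrow

/-- The strong law of large numbers on the canonical product space. -/
theorem ae_tendsto_average_infinitePi {X : Type*} [MeasurableSpace X] {μ : Measure X}
    [IsProbabilityMeasure μ] {E : Type*} [NormedAddCommGroup E] [NormedSpace ℝ E]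
    [CompleteSpace E] [MeasurableSpace E] [BorelSpace E] {Z : X → E} (hZ : Measurable Z)
    (hZi : Integrable Z μ) :
    ∀ᵐ x ∂(Measure.infinitePi fun _ : ℕ ↦ μ),
      Tendsto (fun n : ℕ ↦ (n : ℝ)⁻¹ • ∑ i ∈ Finset.range n, Z (x i)) atTop (𝓝 (∫ y, Z y ∂μ)) := by
  have hmp := fun i ↦ measurePreserving_eval_infinitePi (fun _ : ℕ ↦ μ) i
  have hm : ∀ i, Measurable fun x : ℕ → X ↦ Z (x i) := fun i ↦ hZ.comp (measurable_pi_apply i)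
  have h := strong_law_ae (μ := Measure.infinitePi fun _ : ℕ ↦ μ) (fun i (x : ℕ → X) ↦ Z (x i))
    ((hmp 0).integrable_comp_of_integrable hZi)
    (fun i j hij ↦ (iIndepFun_infinitePi (P := fun _ : ℕ ↦ μ) (X := fun _ ↦ Z)
      fun _ ↦ hZ).indepFun hij)
    fun i ↦ ⟨(hm i).aemeasurable, (hm 0).aemeasurable, by
      have : ∀ j, (Measure.infinitePi fun _ : ℕ ↦ μ).map (fun x ↦ Z (x j)) = μ.map Z := fun j ↦
        (Measure.map_map hZ (hmp j).measurable).symm.trans (by rw [(hmp j).map_eq])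
      rw [this, this]⟩
  have hint : ∫ x, Z (x 0) ∂(Measure.infinitePi fun _ : ℕ ↦ μ) = ∫ y, Z y ∂μ := by
    refine (integral_map (hmp 0).measurable.aemeasurable ?_).symm.trans (by rw [(hmp 0).map_eq])
    rw [(hmp 0).map_eq]
    exact hZi.aestronglyMeasurable
  rw [hint] at h
  exact h

/-- With unit holding times the empirical measure at an integer time is uniform on a sample. -/
theorem integral_empiricalMeasure_one {X : Type*} [MeasurableSpace X] (n : Ioi (0 : ℝ)) {k : ℕ}
    (hk : (n : ℝ) = k) (x : ℕ → X) {f : X → ℝ} {M : ℝ} (hf : Measurable f) (hM : ∀ y, |f y| ≤ M) :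
    ∫ y, f y ∂(empiricalMeasure (fun _ ↦ 1) n x : Measure X) =
      (k : ℝ)⁻¹ * ∑ i ∈ Finset.range k, f (x i) := by
  have hk0 : (k : ℝ) ≠ 0 := hk ▸ (ne_of_gt n.2)
  have := abs_mul_integral_empiricalMeasure_sub_le (τ := fun _ : X ↦ (1 : ℝ≥0∞)) (x := x)
    (by simp) n hf hM k
  rw [hk] at this
  simp only [realArrival, realTime, ENNReal.toReal_one, Finset.sum_const, Finset.card_range,
    nsmul_eq_mul, mul_one, sub_self, abs_zero, mul_zero, one_mul] at this
  rw [eq_inv_mul_iff_mul_eq₀ hk0]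
  linarith [abs_nonpos_iff.1 this]

section Separable

variable {X : Type*} [TopologicalSpace X] [MeasurableSpace X]

theorem continuous_empiricalMeasure_one [OpensMeasurableSpace X] (n : Ioi (0 : ℝ)) {k : ℕ}
    (hk : (n : ℝ) = k) :
    Continuous fun x : ℕ → X ↦ empiricalMeasure (fun _ : X ↦ (1 : ℝ≥0∞)) n x := by
  refine isInducing_integral_probabilityMeasure.continuous_iff.2 (continuous_pi fun g ↦ ?_)
  have : (fun x : ℕ → X ↦ ∫ y, g y ∂(empiricalMeasure (fun _ ↦ 1) n x : Measure X)) =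
      fun x ↦ (k : ℝ)⁻¹ * ∑ i ∈ Finset.range k, g (x i) := by
    ext x
    exact integral_empiricalMeasure_one n hk x g.continuous.measurable fun y ↦
      g.norm_coe_le_norm y
  simp only [Function.comp_def, this]
  fun_prop

/-- By the law of large numbers, uniform measures on finite samples are dense in the narrow
topology, and they form a separable set. -/
theorem secondCountableTopology_probabilityMeasure [TopologicalSpace.PseudoMetrizableSpace X]
    [SecondCountableTopology X] [BorelSpace X] :
    SecondCountableTopology (ProbabilityMeasure X) := by
  let e : ℕ → Ioi (0 : ℝ) := fun n ↦ ⟨((n + 1 : ℕ) : ℝ), by simp; positivity⟩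
  let D : Set (ProbabilityMeasure X) :=
    ⋃ n, range fun x : ℕ → X ↦ empiricalMeasure (fun _ : X ↦ (1 : ℝ≥0∞)) (e n) x
  have hsep : TopologicalSpace.IsSeparable D := by
    refine TopologicalSpace.IsSeparable.iUnion fun n ↦ ?_
    exact TopologicalSpace.isSeparable_range (continuous_empiricalMeasure_one (e n) rfl)
  have hdense : Dense D := by
    intro ν
    refine mem_closure_iff.2 fun O hO hν ↦ ?_
    obtain ⟨I, ε, hε, hI⟩ := exists_finset_integral_lt_subset hO hν
    have hlln : ∀ᵐ x ∂(Measure.infinitePi fun _ : ℕ ↦ (ν : Measure X)), ∀ g ∈ I,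
        Tendsto (fun n : ℕ ↦ (n : ℝ)⁻¹ • ∑ i ∈ Finset.range n, g (x i)) atTop
          (𝓝 (∫ y, g y ∂(ν : Measure X))) :=
      (ae_ball_iff I.countable_toSet).2 fun g _ ↦
        ae_tendsto_average_infinitePi g.continuous.measurable (g.integrable _)
    obtain ⟨x, hx⟩ := hlln.exists
    have hev : ∀ᶠ n : ℕ in atTop, ∀ g ∈ I,
        |(n : ℝ)⁻¹ • ∑ i ∈ Finset.range n, g (x i) - ∫ y, g y ∂(ν : Measure X)| < ε :=
      (Filter.eventually_all_finset I).2 fun g hg ↦ Metric.tendsto_nhds.1 (hx g hg) ε hε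
    obtain ⟨n, hn⟩ := ((tendsto_add_atTop_nat 1).eventually hev).exists
    refine ⟨_, hI (empiricalMeasure (fun _ ↦ 1) (e n) x) fun g hg ↦ ?_, mem_iUnion.2 ⟨n, x, rfl⟩⟩
    rw [integral_empiricalMeasure_one (e n) rfl x g.continuous.measurable
      (fun y ↦ g.norm_coe_le_norm y)]
    exact hn g hg
  have : TopologicalSpace.SeparableSpace (ProbabilityMeasure X) :=
    TopologicalSpace.isSeparable_univ_iff.1 (hdense.closure_eq ▸ hsep.closure)
  let : PseudoMetricSpace (ProbabilityMeasure X) :=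
    TopologicalSpace.pseudoMetrizableSpacePseudoMetric _
  exact UniformSpace.secondCountable_of_separable _

/-- A random probability measure is Borel measurable for the narrow topology as soon as its
integrals against bounded continuous functions are. -/
theorem measurable_borel_of_forall_integral [TopologicalSpace.PseudoMetrizableSpace X]
    [SecondCountableTopology X] [BorelSpace X] {Ω : Type*} [MeasurableSpace Ω]
    {F : Ω → ProbabilityMeasure X}
    (hF : ∀ g : X →ᵇ ℝ, Measurable fun ω ↦ ∫ y, g y ∂(F ω : Measure X)) :
    @Measurable Ω (ProbabilityMeasure X) _ (borel _) F := by
  -- Second countability reduces an arbitrary open set to countably many basic neighbourhoods.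
  have := secondCountableTopology_probabilityMeasure (X := X)
  refine measurable_generateFrom fun O hO ↦ ?_
  have hV : ∀ ν ∈ O, ∃ V, IsOpen V ∧ ν ∈ V ∧ V ⊆ O ∧ MeasurableSet (F ⁻¹' V) := by
    intro ν hν
    obtain ⟨I, ε, hε, hI⟩ := exists_finset_integral_lt_subset hO hν
    refine ⟨⋂ g ∈ I, {ν' | |∫ y, g y ∂(ν' : Measure X) - ∫ y, g y ∂(ν : Measure X)| < ε},
      isOpen_biInter_finset fun g _ ↦ ?_, by simp [hε], fun ν' h ↦ hI ν' (by simpa using h), ?_⟩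
    · exact isOpen_lt ((continuous_integral_probabilityMeasure g).sub continuous_const).abs
        continuous_const
    · simp only [preimage_iInter, preimage_ofPred_eq]
      exact Finset.measurableSet_biInter I fun g _ ↦
        measurableSet_lt (((hF g).sub_const _).abs) measurable_const
  choose! V hVo hVmem hVO hVm using hV
  obtain ⟨T, hTO, hTc, hTU⟩ := TopologicalSpace.countable_cover_nhdsWithin (s := O)
    (f := V) fun ν hν ↦ mem_nhdsWithin_of_mem_nhds ((hVo ν hν).mem_nhds (hVmem ν hν))
  have : O = ⋃ ν ∈ T, V ν := hTU.antisymm (iUnion₂_subset fun ν hν ↦ hVO ν (hTO hν))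
  rw [this, preimage_iUnion₂]
  exact MeasurableSet.biUnion hTc fun ν hν ↦ hVm ν (hTO hν)

end Separable

section Measurable

variable {X : Type*} [MeasurableSpace X] {τ : X → ℝ≥0∞}

theorem measurable_renewalCount_uncurry (hτ : Measurable τ) :
    Measurable fun p : (ℕ → X) × ℝ ↦ renewalCount τ p.1 p.2 := by
  have hm : ∀ n, MeasurableSet
      {p : (ℕ → X) × ℝ | ENNReal.ofReal p.2 ≤ arrivalTime τ p.1 (n + 1)} := fun n ↦
    measurableSet_le (ENNReal.measurable_ofReal.comp measurable_snd)
      (Finset.measurable_sum _ fun i _ ↦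
        hτ.comp ((measurable_pi_apply i).comp measurable_fst))
  refine measurable_of_Iic fun k ↦ ?_
  have : (fun p : (ℕ → X) × ℝ ↦ renewalCount τ p.1 p.2) ⁻¹' Iic k =
      (⋃ j ∈ Iic k, {p | ENNReal.ofReal p.2 ≤ arrivalTime τ p.1 (j + 1)}) ∪
        ⋂ j, {p | ENNReal.ofReal p.2 ≤ arrivalTime τ p.1 (j + 1)}ᶜ := by
    ext p
    simp only [mem_preimage, mem_Iic, renewalCount, mem_union, mem_iUnion, mem_iInter,
      mem_compl_iff, mem_ofPred_eq, exists_prop]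
    set S := {n : ℕ | ENNReal.ofReal p.2 ≤ arrivalTime τ p.1 (n + 1)}
    constructor
    · intro h
      rcases S.eq_empty_or_nonempty with he | hne
      · exact Or.inr fun j hj ↦ (he ▸ (show j ∈ S from hj) : j ∈ (∅ : Set ℕ))
      · exact Or.inl ⟨_, h, Nat.sInf_mem hne⟩
    · rintro (⟨j, hj, hjS⟩ | h)
      · exact (Nat.sInf_le (show j ∈ S from hjS)).trans hj
      · have : S = ∅ := eq_empty_of_forall_notMem h
        rw [this, Nat.sInf_empty]
        exact Nat.zero_le _
  rw [this]
  exact (MeasurableSet.biUnion (to_countable _) fun j _ ↦ hm j).union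
    (MeasurableSet.iInter fun j ↦ (hm j).compl)

theorem measurable_renewalProcess_uncurry (hτ : Measurable τ) :
    Measurable fun p : (ℕ → X) × ℝ ↦ renewalProcess τ p.1 p.2 := by
  have h : Measurable fun q : ℕ × (ℕ → X) ↦ q.2 q.1 :=
    measurable_from_prod_countable_right fun n ↦ measurable_pi_apply n
  exact h.comp ((measurable_renewalCount_uncurry hτ).prodMk measurable_fst)

theorem measurable_empiricalMeasure [TopologicalSpace X]
    [TopologicalSpace.PseudoMetrizableSpace X] [SecondCountableTopology X] [BorelSpace X]
    (hτ : Measurable τ) (t : Ioi (0 : ℝ)) :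
    @Measurable (ℕ → X) (ProbabilityMeasure X) _ (borel _) (empiricalMeasure τ t) := by
  refine measurable_borel_of_forall_integral fun g ↦ ?_
  simp_rw [integral_empiricalMeasure τ _ t g.continuous.measurable]
  have ht : (0 : ℝ) ≤ t := (mem_Ioi.1 t.2).le
  simp_rw [intervalIntegral.integral_of_le ht]
  refine Measurable.const_mul ?_ _
  have h := (g.continuous.measurable.comp
    (measurable_renewalProcess_uncurry hτ)).stronglyMeasurable
  exact (StronglyMeasurable.integral_prod_right (ν := volume.restrict (Ioc 0 (t : ℝ)))
    (f := fun x s ↦ g (renewalProcess τ x s)) h).measurable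

theorem empiricalLaw_apply [TopologicalSpace X]
    [TopologicalSpace.PseudoMetrizableSpace X] [SecondCountableTopology X] [BorelSpace X]
    (μ : Measure X) [IsProbabilityMeasure μ]
    (hτ : Measurable τ) (t : Ioi (0 : ℝ)) {A : Set (ProbabilityMeasure X)}
    (hA : @MeasurableSet _ (borel (ProbabilityMeasure X)) A) :
    empiricalLaw μ τ t A =
      (Measure.infinitePi fun _ : ℕ ↦ μ) {x | empiricalMeasure τ t x ∈ A} :=
  @Measure.map_apply _ _ _ (borel _) _ _ (measurable_empiricalMeasure hτ t) _ hA

theorem isProbabilityMeasure_empiricalLaw [TopologicalSpace X]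
    [TopologicalSpace.PseudoMetrizableSpace X] [SecondCountableTopology X] [BorelSpace X]
    (μ : Measure X) [IsProbabilityMeasure μ] (hτ : Measurable τ) (t : Ioi (0 : ℝ)) :
    IsProbabilityMeasure (empiricalLaw μ τ t) :=
  ⟨by rw [empiricalLaw_apply μ hτ t (@MeasurableSet.univ _ (borel _))]; simp⟩

end Measurable

/-! ### Exponential rates of sequences of probabilities -/

section Rates

theorem tendsto_coe_Ioi_atTop : Tendsto (fun t : Ioi (0 : ℝ) ↦ (t : ℝ)) atTop atTop :=
  (map_val_Ioi_atTop (0 : ℝ)).le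

theorem limsup_log_le_of_eventually_le {Q : Ioi (0 : ℝ) → ℝ≥0∞} {a : ℝ} {K : ℝ≥0∞} (hK : K ≠ ⊤)
    (h : ∀ᶠ t : Ioi (0 : ℝ) in atTop, Q t ≤ K * ENNReal.ofReal (Real.exp (-(t * a)))) :
    limsup (fun t : Ioi (0 : ℝ) ↦ ((1 / (t : ℝ) : ℝ) : EReal) * ENNReal.log (Q t)) atTop
      ≤ ((-a : ℝ) : EReal) := by
  set k : ℝ := Real.log (K.toReal + 1) with hk
  have hpos : 0 < K.toReal + 1 := by positivity
  have hKk : K ≤ ENNReal.ofReal (Real.exp k) := by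
    rw [hk, Real.exp_log hpos]
    exact ENNReal.le_ofReal_iff_toReal_le hK hpos.le |>.2 (by linarith)
  have hle : ∀ᶠ t : Ioi (0 : ℝ) in atTop,
      ((1 / (t : ℝ) : ℝ) : EReal) * ENNReal.log (Q t) ≤ ((k * (t : ℝ)⁻¹ - a : ℝ) : EReal) := by
    filter_upwards [h] with t ht
    have ht0 : (0 : ℝ) < t := t.2
    have h1 : ENNReal.log (Q t) ≤ ((k - t * a : ℝ) : EReal) := by
      calc ENNReal.log (Q t) ≤ ENNReal.log (ENNReal.ofReal (Real.exp (k - t * a))) := by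
            refine ENNReal.log_monotone (ht.trans ?_)
            rw [sub_eq_add_neg, Real.exp_add, ENNReal.ofReal_mul (Real.exp_pos _).le]
            gcongr
        _ = _ := by rw [ENNReal.log_ofReal_of_pos (Real.exp_pos _), Real.log_exp]
    calc ((1 / (t : ℝ) : ℝ) : EReal) * ENNReal.log (Q t)
        ≤ ((1 / (t : ℝ) : ℝ) : EReal) * ((k - t * a : ℝ) : EReal) :=
          mul_le_mul_of_nonneg_left h1 (EReal.coe_nonneg.2 (by positivity))
      _ = ((k * (t : ℝ)⁻¹ - a : ℝ) : EReal) := by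
          rw [← EReal.coe_mul]
          congr 1
          field_simp
  have hlim : Tendsto (fun t : Ioi (0 : ℝ) ↦ ((k * (t : ℝ)⁻¹ - a : ℝ) : EReal)) atTop
      (𝓝 ((-a : ℝ) : EReal)) := by
    refine (continuous_coe_real_ereal.tendsto _).comp ?_
    have := ((tendsto_inv_atTop_zero.comp tendsto_coe_Ioi_atTop).const_mul k).sub_const a
    simpa using this
  exact (limsup_le_limsup hle).trans hlim.limsup_eq.le

theorem le_liminf_log_of_eventually_le {Q : Ioi (0 : ℝ) → ℝ≥0∞} {b : ℝ}
    (h : ∀ᶠ t : Ioi (0 : ℝ) in atTop, ENNReal.ofReal (Real.exp (-(t * b))) ≤ Q t) :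
    ((-b : ℝ) : EReal) ≤
      liminf (fun t : Ioi (0 : ℝ) ↦ ((1 / (t : ℝ) : ℝ) : EReal) * ENNReal.log (Q t)) atTop := by
  refine le_liminf_of_le (by isBoundedDefault) ?_
  filter_upwards [h] with t ht
  have ht0 : (0 : ℝ) < t := t.2
  calc ((-b : ℝ) : EReal) = ((1 / (t : ℝ) : ℝ) : EReal) * ((-(t * b) : ℝ) : EReal) := by
        rw [← EReal.coe_mul]
        congr 1
        field_simp
    _ ≤ ((1 / (t : ℝ) : ℝ) : EReal) * ENNReal.log (Q t) := by
        refine mul_le_mul_of_nonneg_left ?_ (EReal.coe_nonneg.2 (by positivity))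
        rw [← Real.log_exp (-(t * b)), ← ENNReal.log_ofReal_of_pos (Real.exp_pos _)]
        exact ENNReal.log_monotone ht

end Rates

/-! ### Exponential moments of the holding times -/

section ExpMoments

variable {X : Type*} [MeasurableSpace X] {μ : Measure X} {τ : X → ℝ≥0∞}

/-- The exponential moments in the definition of `expRate`, in terms of the real exponential. -/
theorem lintegral_ereal_exp_eq (hA1 : μ {x | τ x = 0} = 0 ∧ μ {x | τ x = ⊤} = 0) (c : ℝ≥0)
    (A : Set X) :
    ∫⁻ y in A, EReal.exp (((c : ℝ≥0∞) * τ y : ℝ≥0∞) : EReal) ∂μ =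
      ∫⁻ y in A, ENNReal.ofReal (Real.exp (c * realTime τ y)) ∂μ := by
  refine lintegral_congr_ae (ae_restrict_of_ae ?_)
  filter_upwards [ae_realTime_pos hA1] with y hy
  have h : (c : ℝ≥0∞) * τ y = ENNReal.ofReal (c * realTime τ y) := by
    rw [ENNReal.ofReal_mul c.coe_nonneg, ENNReal.ofReal_coe_nnreal, realTime,
      ENNReal.ofReal_toReal hy.1]
  rw [← EReal.exp_coe, h, EReal.coe_ennreal_ofReal,
    max_eq_left (mul_nonneg c.coe_nonneg (realTime_nonneg _ _))]

theorem lintegral_exp_lt_top_of_lt_expRate (hA1 : μ {x | τ x = 0} = 0 ∧ μ {x | τ x = ⊤} = 0)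
    {c : ℝ} {A : Set X} (h : ENNReal.ofReal c < expRate μ τ A) :
    ∫⁻ y in A, ENNReal.ofReal (Real.exp (c * realTime τ y)) ∂μ < ⊤ := by
  obtain ⟨c', hc'⟩ := lt_iSup_iff.1 h
  obtain ⟨hfin, hlt⟩ := lt_iSup_iff.1 hc'
  rw [lintegral_ereal_exp_eq hA1] at hfin
  refine lt_of_le_of_lt
    (lintegral_mono fun y ↦ ENNReal.ofReal_le_ofReal (Real.exp_le_exp.2 ?_)) hfin
  have : c ≤ c' := by
    by_contra! hcon
    have h2 : (c' : ℝ≥0∞) ≤ ENNReal.ofReal c := by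
      rw [← ENNReal.ofReal_coe_nnreal]
      exact ENNReal.ofReal_le_ofReal hcon.le
    exact absurd hlt (not_lt.2 h2)
  exact mul_le_mul_of_nonneg_right this (realTime_nonneg _ _)

theorem exists_ball_lintegral_exp_lt_top {X : Type*} [MetricSpace X] [MeasurableSpace X]
    {μ : Measure X} {τ : X → ℝ≥0∞} (hA1 : μ {x | τ x = 0} = 0 ∧ μ {x | τ x = ⊤} = 0)
    {c : ℝ} {x : X} (h : ENNReal.ofReal c < xi μ τ x) :
    ∃ δ > 0, ∫⁻ y in Metric.ball x δ, ENNReal.ofReal (Real.exp (c * realTime τ y)) ∂μ < ⊤ := by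
  obtain ⟨δ, hδ⟩ := lt_iSup_iff.1 h
  obtain ⟨hpos, hlt⟩ := lt_iSup_iff.1 hδ
  exact ⟨δ, hpos, lintegral_exp_lt_top_of_lt_expRate hA1 hlt⟩

theorem lintegral_exp_ball_eq_top {X : Type*} [MetricSpace X] [MeasurableSpace X]
    {μ : Measure X} {τ : X → ℝ≥0∞} (hA1 : μ {x | τ x = 0} = 0 ∧ μ {x | τ x = ⊤} = 0)
    {c : ℝ} {x : X} (h : xi μ τ x < ENNReal.ofReal c) {δ : ℝ} (hδ : 0 < δ) :
    ∫⁻ y in Metric.ball x δ, ENNReal.ofReal (Real.exp (c * realTime τ y)) ∂μ = ⊤ := by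
  by_contra hne
  have hc : 0 < c := ENNReal.ofReal_pos.1 (bot_lt_of_lt h)
  refine absurd h (not_lt.2 ?_)
  have hfin : ∫⁻ y in Metric.ball x δ,
      EReal.exp (((c.toNNReal : ℝ≥0∞) * τ y : ℝ≥0∞) : EReal) ∂μ < ⊤ := by
    rw [lintegral_ereal_exp_eq hA1, Real.coe_toNNReal c hc.le]
    exact lt_top_iff_ne_top.2 hne
  exact (le_iSup₂_of_le (f := fun (c : ℝ≥0) (_ : ∫⁻ y in Metric.ball x δ,
      EReal.exp (((c : ℝ≥0∞) * τ y : ℝ≥0∞) : EReal) ∂μ < ⊤) ↦ (c : ℝ≥0∞))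
    c.toNNReal hfin le_rfl).trans (le_iSup₂_of_le (f := fun (δ : ℝ) (_ : 0 < δ) ↦
      expRate μ τ (Metric.ball x δ)) δ hδ le_rfl)

theorem lowerSemicontinuous_xi {X : Type*} [MetricSpace X] [MeasurableSpace X]
    (μ : Measure X) (τ : X → ℝ≥0∞) : LowerSemicontinuous (xi μ τ) := by
  intro x c hc
  obtain ⟨δ, hδ⟩ := lt_iSup_iff.1 hc
  obtain ⟨hpos, hlt⟩ := lt_iSup_iff.1 hδ
  obtain ⟨r, hr⟩ := lt_iSup_iff.1 hlt
  obtain ⟨hfin, hcr⟩ := lt_iSup_iff.1 hr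
  filter_upwards [Metric.ball_mem_nhds x (half_pos hpos)] with y hy
  have hsub : Metric.ball y (δ / 2) ⊆ Metric.ball x δ :=
    Metric.ball_subset_ball' (by rw [Metric.mem_ball] at hy; linarith)
  refine hcr.trans_le ((le_iSup₂_of_le (f := fun (c : ℝ≥0) (_ : ∫⁻ z in Metric.ball y (δ / 2),
      EReal.exp (((c : ℝ≥0∞) * τ z : ℝ≥0∞) : EReal) ∂μ < ⊤) ↦ (c : ℝ≥0∞))
    r ((lintegral_mono_set hsub).trans_lt hfin) le_rfl).trans
    (le_iSup₂_of_le (f := fun (δ : ℝ) (_ : 0 < δ) ↦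
      expRate μ τ (Metric.ball y δ)) (δ / 2) (half_pos hpos) le_rfl))

/-- Since `ξ^∞ = ∞`, every exponential moment of `τ` is small off a suitable compact set. -/
theorem exists_isCompact_lintegral_exp_compl_le {X : Type*} [TopologicalSpace X] [PolishSpace X]
    [MeasurableSpace X] [BorelSpace X] {μ : Measure X}
    {τ : X → ℝ≥0∞} (hA1 : μ {x | τ x = 0} = 0 ∧ μ {x | τ x = ⊤} = 0)
    (hA3 : xiInfty μ τ = ⊤) (c : ℝ) {ε : ℝ≥0∞} (hε : 0 < ε) :
    ∃ K, IsCompact K ∧ ∫⁻ y in Kᶜ, ENNReal.ofReal (Real.exp (c * realTime τ y)) ∂μ ≤ ε := by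
  have h : ENNReal.ofReal c < xiInfty μ τ := hA3 ▸ ENNReal.ofReal_lt_top
  obtain ⟨K₀, hK₀⟩ := lt_iSup_iff.1 h
  obtain ⟨hK₀c, hlt⟩ := lt_iSup_iff.1 hK₀
  have hfin := lintegral_exp_lt_top_of_lt_expRate hA1 hlt
  set F : X → ℝ≥0∞ := fun y ↦ ENNReal.ofReal (Real.exp (c * realTime τ y))
  set κ := (μ.restrict K₀ᶜ).withDensity F
  have : IsFiniteMeasure κ :=
    ⟨by rwa [withDensity_apply _ MeasurableSet.univ, Measure.restrict_univ]⟩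
  let := TopologicalSpace.upgradeIsCompletelyMetrizable X
  obtain ⟨K₁, hK₁c, hK₁⟩ := isTightMeasureSet_iff_exists_isCompact_measure_compl_le.1
    (isTightMeasureSet_singleton (μ := κ)) ε hε
  refine ⟨K₀ ∪ K₁, hK₀c.union hK₁c, ?_⟩
  have := hK₁ κ rfl
  rwa [withDensity_apply _ hK₁c.isClosed.measurableSet.compl,
    Measure.restrict_restrict hK₁c.isClosed.measurableSet.compl, inter_comm,
    ← compl_union] at this

end ExpMoments

/-! ### Exponential tightness and the upper bound -/

section Upper

variable {X : Type*} [TopologicalSpace X] [PolishSpace X] [MeasurableSpace X] [BorelSpace X]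
  {μ : Measure X} [IsProbabilityMeasure μ] {τ : X → ℝ≥0∞}

/-- The mass that `π_t` gives to the complement of a suitable compact set exceeds `r` with
probability at most `D e^{-t b}`. The constant `D` depends neither on `r` nor on `b`, so that these
bounds can be summed over a sequence of compact sets. -/
theorem exists_isCompact_measure_lt_compl_le (hτ : Measurable τ)
    (hA1 : μ {x | τ x = 0} = 0 ∧ μ {x | τ x = ⊤} = 0) (hA3 : xiInfty μ τ = ⊤) :
    ∃ D : ℝ≥0∞, D ≠ ⊤ ∧ ∀ r : ℝ, 0 < r → ∀ b : ℝ, 0 ≤ b → ∃ K : Set X, IsCompact K ∧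
      ∀ t : Ioi (0 : ℝ), (Measure.infinitePi fun _ : ℕ ↦ μ)
        {x | ENNReal.ofReal r < (empiricalMeasure τ t x : Measure X) Kᶜ} ≤
          ENNReal.ofReal (Real.exp (-(t * b))) * D := by
  -- The test function is a large constant off `K` and `-1` on `K`.
  set q := ∫⁻ y, ENNReal.ofReal (Real.exp (-1 * realTime τ y)) ∂μ with hq
  have hq1 : q < 1 := lintegral_exp_neg_mul_lt_one hτ hA1 one_pos
  have hq0 : 1 - q ≠ 0 := (tsub_pos_of_lt hq1).ne'
  have hhalf : 0 < (1 - q) / 2 := ENNReal.half_pos hq0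
  refine ⟨2 * ((1 - q) / 2)⁻¹, ENNReal.mul_ne_top (by simp) (ENNReal.inv_ne_top.2 hhalf.ne'),
    fun r hr b hb ↦ ?_⟩
  set c : ℝ := (b + 1) / r with hc
  have hc0 : 0 < c := by positivity
  obtain ⟨K, hK, hKε⟩ := exists_isCompact_lintegral_exp_compl_le hA1 hA3 (c - 1) hhalf
  have hKm : MeasurableSet K := hK.isClosed.measurableSet
  refine ⟨K, hK, fun t ↦ ?_⟩
  set f : X → ℝ := fun y ↦ Kᶜ.indicator (fun _ ↦ c) y - 1 with hf
  have hfm : Measurable f := (measurable_const.indicator hKm.compl).sub_const 1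
  have hfM : ∀ y, |f y| ≤ c + 1 := fun y ↦ by
    by_cases hy : y ∈ K
    · simp only [hf, indicator_of_notMem (show y ∉ Kᶜ by simpa using hy)]
      rw [abs_le]; constructor <;> linarith
    · simp only [hf, indicator_of_mem (show y ∈ Kᶜ from hy)]
      rw [abs_le]; constructor <;> linarith
  have hint : ∫⁻ y, ENNReal.ofReal (Real.exp (f y * realTime τ y)) ∂μ ≤ (1 - q) / 2 + q := by
    rw [← lintegral_add_compl _ hKm, add_comm]
    refine add_le_add ?_ ?_
    · refine le_trans (le_of_eq (setLIntegral_congr_fun hKm.compl fun y hy ↦ ?_)) hKε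
      simp only [hf, indicator_of_mem hy]
    · refine le_trans (le_of_eq (setLIntegral_congr_fun hKm fun y hy ↦ ?_))
        (setLIntegral_le_lintegral K _)
      simp only [hf, indicator_of_notMem (show y ∉ Kᶜ by simpa using hy), zero_sub]
  have hgap : (1 - q) / 2 ≤ 1 - ∫⁻ y, ENNReal.ofReal (Real.exp (f y * realTime τ y)) ∂μ := by
    refine ENNReal.le_sub_of_add_le_right (ne_top_of_le_ne_top ?_ hint) ?_
    · exact ENNReal.add_ne_top.2 ⟨(ENNReal.div_lt_top (by simp) (by simp)).ne,
        (hq1.trans ENNReal.one_lt_top).ne⟩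
    · calc _ ≤ (1 - q) / 2 + ((1 - q) / 2 + q) := by gcongr
        _ = 1 := by rw [← add_assoc, ENNReal.add_halves, tsub_add_cancel_of_le hq1.le]
  refine (measure_mono fun x hx ↦ ?_).trans
    ((measure_le_integral_empiricalMeasure_le hτ hA1 hfm hfM b t).trans ?_)
  · simp only [mem_ofPred_eq] at hx ⊢
    set π := (empiricalMeasure τ t x : Measure X)
    have : ∫ y, f y ∂π = c * π.real Kᶜ - 1 := by
      simp only [hf]
      rw [integral_sub ((integrable_const _).indicator hKm.compl) (integrable_const _),
        integral_indicator hKm.compl]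
      simp [mul_comm]
    rw [this]
    have hlt : r ≤ π.real Kᶜ :=
      (ENNReal.ofReal_le_iff_le_toReal (measure_ne_top _ _)).1 hx.le
    have : c * r = b + 1 := by rw [hc]; field_simp
    nlinarith
  · gcongr

/-- The empirical measures lie in a compact set of the form `{ν | ∀ n, ν(K_nᶜ) ≤ 1/(n+1)}` off an
event of exponentially small probability, at any prescribed rate `b`. -/
theorem exponential_tightness (hτ : Measurable τ)
    (hA1 : μ {x | τ x = 0} = 0 ∧ μ {x | τ x = ⊤} = 0) (hA3 : xiInfty μ τ = ⊤) {b : ℝ}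
    (hb : 0 ≤ b) :
    ∃ 𝒦 : Set (ProbabilityMeasure X), IsCompact 𝒦 ∧ ∃ D : ℝ≥0∞, D ≠ ⊤ ∧
      ∀ t : Ioi (0 : ℝ), 1 ≤ (t : ℝ) → (Measure.infinitePi fun _ : ℕ ↦ μ)
        {x | empiricalMeasure τ t x ∉ 𝒦} ≤ D * ENNReal.ofReal (Real.exp (-(t * b))) := by
  obtain ⟨D, hD, h⟩ := exists_isCompact_measure_lt_compl_le hτ hA1 hA3
  have hr : ∀ n : ℕ, (0 : ℝ) < 1 / (n + 1 : ℝ) := fun n ↦ by positivity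
  -- The exponent `b + n` makes the error terms summable in `n`.
  choose K hK hKt using fun n : ℕ ↦ h (1 / (n + 1 : ℝ)) (hr n) (b + n) (by positivity)
  set u : ℕ → ℝ≥0 := fun n ↦ (1 / (n + 1 : ℝ)).toNNReal
  have hu : Tendsto u atTop (𝓝 0) := by
    have := (continuous_real_toNNReal.tendsto 0).comp
      (tendsto_one_div_add_atTop_nhds_zero_nat (𝕜 := ℝ))
    simpa [u, Function.comp_def] using this
  set S := ∑' n : ℕ, ENNReal.ofReal (Real.exp (-(n : ℝ))) with hS
  have hSfin : S ≠ ⊤ := by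
    have : Summable fun n : ℕ ↦ Real.exp (-(n : ℝ)) := by
      simpa using Real.summable_exp_neg_nat
    exact this.tsum_ofReal_ne_top
  let := TopologicalSpace.upgradeIsCompletelyMetrizable X
  refine ⟨_, isCompact_setOfPred_probabilityMeasure_mass_eq_compl_isCompact_le hu hK
    (Or.inl inferInstance), D * S, ENNReal.mul_ne_top hD hSfin, fun t ht ↦ ?_⟩
  set P := Measure.infinitePi fun _ : ℕ ↦ μ
  calc P {x | empiricalMeasure τ t x ∉ {ν : ProbabilityMeasure X | ∀ n, ν (K n)ᶜ ≤ u n}}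
      ≤ P (⋃ n : ℕ, {x | ENNReal.ofReal (1 / (n + 1 : ℝ)) <
          (empiricalMeasure τ t x : Measure X) (K n)ᶜ}) := by
        refine measure_mono fun x hx ↦ ?_
        simp only [mem_ofPred_eq, not_forall, not_le] at hx
        obtain ⟨n, hn⟩ := hx
        refine mem_iUnion.2 ⟨n, ?_⟩
        simp only [mem_ofPred_eq]
        rw [← ProbabilityMeasure.ennreal_coeFn_eq_coeFn_toMeasure]
        exact ENNReal.coe_lt_coe.2 hn
    _ ≤ ∑' n : ℕ, P {x | ENNReal.ofReal (1 / (n + 1 : ℝ)) <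
          (empiricalMeasure τ t x : Measure X) (K n)ᶜ} := measure_iUnion_le _
    _ ≤ ∑' n : ℕ, D * ENNReal.ofReal (Real.exp (-(t * b))) *
          ENNReal.ofReal (Real.exp (-(n : ℝ))) := by
        refine ENNReal.tsum_le_tsum fun n ↦ (hKt n t).trans ?_
        rw [mul_comm, mul_assoc, ← ENNReal.ofReal_mul (Real.exp_pos _).le, ← Real.exp_add]
        gcongr
        nlinarith [Nat.cast_nonneg (α := ℝ) n]
    _ = D * S * ENNReal.ofReal (Real.exp (-(t * b))) := by
        rw [ENNReal.tsum_mul_left]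
        ring

/-- The upper bound in terms of the test functions `f ∈ C_b(X)` with `μ(e^{τ f}) < 1`. -/
theorem upper_bound_of_isClosed (hτ : Measurable τ)
    (hA1 : μ {x | τ x = 0} = 0 ∧ μ {x | τ x = ⊤} = 0) (hA3 : xiInfty μ τ = ⊤) {a : ℝ}
    {C : Set (ProbabilityMeasure X)} (hC : IsClosed C)
    (h : ∀ ν ∈ C, ∃ f : X →ᵇ ℝ, ∫⁻ y, ENNReal.ofReal (Real.exp (f y * realTime τ y)) ∂μ < 1 ∧
      a < ∫ y, f y ∂(ν : Measure X)) :
    ∃ D : ℝ≥0∞, D ≠ ⊤ ∧ ∀ t : Ioi (0 : ℝ), 1 ≤ (t : ℝ) → (Measure.infinitePi fun _ : ℕ ↦ μ)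
      {x | empiricalMeasure τ t x ∈ C} ≤ D * ENNReal.ofReal (Real.exp (-(t * a))) := by
  set P := Measure.infinitePi fun _ : ℕ ↦ μ
  obtain ⟨𝒦, h𝒦, D₁, hD₁, htight⟩ := exponential_tightness (μ := μ) hτ hA1 hA3 (abs_nonneg a)
  obtain ⟨D₂, hD₂, hcpt⟩ : ∃ D : ℝ≥0∞, D ≠ ⊤ ∧ ∀ t : Ioi (0 : ℝ),
      P {x | empiricalMeasure τ t x ∈ 𝒦 ∩ C} ≤ D * ENNReal.ofReal (Real.exp (-(t * a))) := by
    refine (h𝒦.inter_right hC).induction_on (p := fun s ↦ ∃ D : ℝ≥0∞, D ≠ ⊤ ∧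
      ∀ t : Ioi (0 : ℝ), P {x | empiricalMeasure τ t x ∈ s} ≤
        D * ENNReal.ofReal (Real.exp (-(t * a)))) ⟨0, by simp, by simp⟩ ?_ ?_ ?_
    · rintro s s' hss' ⟨D, hD, hs'⟩
      exact ⟨D, hD, fun t ↦ le_trans (measure_mono fun x hx ↦ hss' hx) (hs' t)⟩
    · rintro s s' ⟨D, hD, hs⟩ ⟨D', hD', hs'⟩
      refine ⟨D + D', ENNReal.add_ne_top.2 ⟨hD, hD'⟩, fun t ↦ ?_⟩
      rw [add_mul]
      exact (measure_union_le _ _).trans (add_le_add (hs t) (hs' t))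
    · rintro ν ⟨-, hν⟩
      obtain ⟨f, hf1, hfa⟩ := h ν hν
      refine ⟨{ν' | a < ∫ y, f y ∂(ν' : Measure X)}, mem_nhdsWithin_of_mem_nhds
        ((isOpen_lt continuous_const (continuous_integral_probabilityMeasure f)).mem_nhds hfa),
        2 * (1 - ∫⁻ y, ENNReal.ofReal (Real.exp (f y * realTime τ y)) ∂μ)⁻¹,
        ENNReal.mul_ne_top (by simp) (ENNReal.inv_ne_top.2 (tsub_pos_of_lt hf1).ne'), fun t ↦ ?_⟩
      rw [mul_comm]
      exact le_trans (measure_mono fun x (hx : a < _) ↦ hx.le)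
        (measure_le_integral_empiricalMeasure_le hτ hA1 f.continuous.measurable
          (fun y ↦ f.norm_coe_le_norm y) a t)
  refine ⟨D₁ + D₂, ENNReal.add_ne_top.2 ⟨hD₁, hD₂⟩, fun t ht ↦ ?_⟩
  have ht0 : (0 : ℝ) < t := t.2
  calc P {x | empiricalMeasure τ t x ∈ C}
      ≤ P ({x | empiricalMeasure τ t x ∉ 𝒦} ∪ {x | empiricalMeasure τ t x ∈ 𝒦 ∩ C}) := by
        refine measure_mono fun x hx ↦ ?_
        by_cases hxK : empiricalMeasure τ t x ∈ 𝒦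
        · exact Or.inr ⟨hxK, hx⟩
        · exact Or.inl hxK
    _ ≤ _ := measure_union_le _ _
    _ ≤ D₁ * ENNReal.ofReal (Real.exp (-(t * |a|))) +
          D₂ * ENNReal.ofReal (Real.exp (-(t * a))) := add_le_add (htight t ht) (hcpt t)
    _ ≤ (D₁ + D₂) * ENNReal.ofReal (Real.exp (-(t * a))) := by
        rw [add_mul]
        gcongr
        exact le_abs_self a

end Upper

/-! ### Passing from measurable to continuous test functions -/

section Continuous

variable {X : Type*} [MetricSpace X] [PolishSpace X] [MeasurableSpace X] [BorelSpace X]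
  {μ : Measure X} {τ : X → ℝ≥0∞}

/-- Local integrability of `e^{cτ}` along a compact set gives integrability on a neighbourhood of
it, and then outer regularity of the measure `e^{cτ} μ` applies. -/
theorem exists_isOpen_lintegral_exp_le {K : Set X} (hK : IsCompact K) (c : ℝ)
    (hloc : ∀ x ∈ K, ∃ δ > 0,
      ∫⁻ y in Metric.ball x δ, ENNReal.ofReal (Real.exp (c * realTime τ y)) ∂μ < ⊤)
    {ε : ℝ≥0∞} (hε : ε ≠ 0) :
    ∃ U, IsOpen U ∧ K ⊆ U ∧ ∫⁻ y in U, ENNReal.ofReal (Real.exp (c * realTime τ y)) ∂μ ≤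
      ∫⁻ y in K, ENNReal.ofReal (Real.exp (c * realTime τ y)) ∂μ + ε := by
  set F : X → ℝ≥0∞ := fun y ↦ ENNReal.ofReal (Real.exp (c * realTime τ y))
  obtain ⟨V, hVo, hKV, hV⟩ : ∃ V, IsOpen V ∧ K ⊆ V ∧ ∫⁻ y in V, F y ∂μ < ⊤ := by
    refine hK.induction_on (p := fun s ↦ ∃ V, IsOpen V ∧ s ⊆ V ∧ ∫⁻ y in V, F y ∂μ < ⊤)
      ⟨∅, isOpen_empty, le_rfl, by simp⟩ ?_ ?_ ?_
    · rintro s s' hs ⟨V, hVo, hsV, hV⟩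
      exact ⟨V, hVo, hs.trans hsV, hV⟩
    · rintro s s' ⟨V, hVo, hsV, hV⟩ ⟨V', hVo', hsV', hV'⟩
      exact ⟨V ∪ V', hVo.union hVo', union_subset_union hsV hsV',
        (lintegral_union_le _ _ _).trans_lt (ENNReal.add_lt_top.2 ⟨hV, hV'⟩)⟩
    · intro x hx
      obtain ⟨δ, hδ, hfin⟩ := hloc x hx
      exact ⟨Metric.ball x δ, mem_nhdsWithin_of_mem_nhds (Metric.ball_mem_nhds x hδ),
        Metric.ball x δ, Metric.isOpen_ball, le_rfl, hfin⟩
  set κ := (μ.restrict V).withDensity F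
  have : IsFiniteMeasure κ :=
    ⟨by rwa [withDensity_apply _ MeasurableSet.univ, Measure.restrict_univ]⟩
  obtain ⟨U, hKU, hUo, hU⟩ := K.exists_isOpen_le_add κ hε
  refine ⟨U ∩ V, hUo.inter hVo, subset_inter hKU hKV, ?_⟩
  rw [withDensity_apply _ hUo.measurableSet, withDensity_apply _ hK.isClosed.measurableSet,
    Measure.restrict_restrict hUo.measurableSet,
    Measure.restrict_restrict hK.isClosed.measurableSet, inter_eq_left.2 hKV] at hU
  exact hU

/-- A bounded measurable test function lying locally below the exponential rate may be replaced
by a continuous one. On compact pieces `K_j` of its (rounded down) level sets, with values `c_j`,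
one takes small neighbourhoods `U_j` and puts `-L + max_j (c_j + L) φ_j` with `φ_j` a bump
function equal to `1` on `K_j` and to `0` off `U_j`. The maximum makes it unnecessary to separate
the `U_j`, since its exponential is at most the sum of the `e^{c_j τ}` over the `U_j`. -/
theorem exists_boundedContinuous_of_measurable (hτ : Measurable τ) {ν : Measure X}
    [IsProbabilityMeasure ν] {g : X → ℝ} (hg : Measurable g) {L : ℕ} (hL : ∀ x, |g x| ≤ L)
    (hloc : ∀ᵐ x ∂ν, ∃ δ > 0,
      ∫⁻ y in Metric.ball x δ, ENNReal.ofReal (Real.exp (g x * realTime τ y)) ∂μ < ⊤)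
    (hlt : ∫⁻ y, ENNReal.ofReal (Real.exp (g y * realTime τ y)) ∂μ < 1) {a : ℝ}
    (ha : a < ∫ y, g y ∂ν) :
    ∃ f : X →ᵇ ℝ, ∫⁻ y, ENNReal.ofReal (Real.exp (f y * realTime τ y)) ∂μ < 1 ∧
      a < ∫ y, f y ∂ν := by
  set q := ∫⁻ y, ENNReal.ofReal (Real.exp (g y * realTime τ y)) ∂μ with hq
  set r := ∫ y, g y ∂ν - a with hr
  have hr0 : 0 < r := sub_pos.2 ha
  obtain ⟨k₀, hk₀⟩ := exists_nat_one_div_lt (half_pos hr0)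
  set k : ℕ := k₀ + 1 with hk
  have hkpos : (0 : ℝ) < k := by positivity
  have hkr : 1 / (k : ℝ) < r / 2 := by simpa [hk] using hk₀
  set B : Set X := {x | ¬ ∃ δ > 0,
      ∫⁻ y in Metric.ball x δ, ENNReal.ofReal (Real.exp (g x * realTime τ y)) ∂μ < ⊤} with hB
  set G : Set X := (toMeasurable ν B)ᶜ with hG
  have hGm : MeasurableSet G := (measurableSet_toMeasurable ν B).compl
  have hGnull : ν Gᶜ = 0 := by rw [hG, compl_compl, measure_toMeasurable]; exact hloc
  have hGloc : ∀ x ∈ G, ∃ δ > 0,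
      ∫⁻ y in Metric.ball x δ, ENNReal.ofReal (Real.exp (g x * realTime τ y)) ∂μ < ⊤ := by
    intro x hx
    by_contra hcon
    exact hx (subset_toMeasurable ν B hcon)
  set J : Finset ℤ := Finset.Icc (-(L * k : ℤ)) (L * k) with hJ
  have hJne : J.Nonempty := ⟨0, by simp [hJ]; positivity⟩
  have hJpos : (0 : ℝ) < J.card := by exact_mod_cast hJne.card_pos
  set c : ℤ → ℝ := fun j ↦ j / k with hc
  have hcL : ∀ j ∈ J, 0 ≤ c j + L ∧ c j + L ≤ 2 * L := fun j hj ↦ by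
    rw [hJ, Finset.mem_Icc] at hj
    have h1 : (-(L * k) : ℝ) ≤ j := by exact_mod_cast hj.1
    have h2 : (j : ℝ) ≤ L * k := by exact_mod_cast hj.2
    constructor
    · have : -(L : ℝ) ≤ c j := by rw [hc]; simp only; rw [le_div_iff₀ hkpos]; linarith
      linarith
    · have : c j ≤ L := by rw [hc]; simp only; rw [div_le_iff₀ hkpos]; linarith
      linarith
  have hmemJ : ∀ x, ⌊k * g x⌋ ∈ J := fun x ↦ by
    have := abs_le.1 (hL x)
    rw [hJ, Finset.mem_Icc]
    constructor
    · rw [Int.le_floor]; push_cast; nlinarith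
    · rw [← Int.cast_le (R := ℝ)]
      refine (Int.floor_le _).trans ?_
      push_cast; nlinarith
  have hcg : ∀ x, c ⌊k * g x⌋ ≤ g x ∧ g x ≤ c ⌊k * g x⌋ + 1 / k := fun x ↦ by
    simp only [hc]
    constructor
    · rw [div_le_iff₀ hkpos]; linarith [Int.floor_le (k * g x)]
    · rw [← add_div, le_div_iff₀ hkpos]; linarith [Int.lt_floor_add_one (k * g x)]
  set A : ℤ → Set X := fun j ↦ G ∩ {x | ⌊k * g x⌋ = j} with hA
  have hAm : ∀ j, MeasurableSet (A j) := fun j ↦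
    hGm.inter ((Int.measurable_floor.comp (hg.const_mul _)) (measurableSet_singleton j))
  -- Inner approximation of the level sets by compact sets.
  set e₁ : ℝ := r / (4 * (2 * L + 1) * J.card) with he₁
  have he₁pos : 0 < e₁ := by positivity
  choose! K hKA hKc hKε using fun j : ℤ ↦ (hAm j).exists_isCompact_sdiff_lt (measure_ne_top ν _)
    (ENNReal.ofReal_pos.2 he₁pos).ne'
  have hKcg : ∀ j, ∀ x ∈ K j, c j ≤ g x ∧ g x ≤ c j + 1 / k := fun j x hx ↦ by
    have hj : ⌊k * g x⌋ = j := (hKA j hx).2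
    have := hcg x
    rwa [hj] at this
  have hKlt : ν (⋃ j ∈ J, K j)ᶜ ≤ J.card * ENNReal.ofReal e₁ := by
    calc ν (⋃ j ∈ J, K j)ᶜ ≤ ν (Gᶜ ∪ ⋃ j ∈ J, A j \ K j) := by
          refine measure_mono fun x hx ↦ ?_
          by_cases hxG : x ∈ G
          · refine Or.inr (mem_iUnion₂.2 ⟨⌊k * g x⌋, hmemJ x, ⟨hxG, rfl⟩, fun hxK ↦ hx ?_⟩)
            exact mem_iUnion₂.2 ⟨_, hmemJ x, hxK⟩
          · exact Or.inl hxG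
      _ ≤ ν Gᶜ + ∑ j ∈ J, ν (A j \ K j) :=
          (measure_union_le _ _).trans (add_le_add le_rfl (measure_biUnion_finset_le _ _))
      _ ≤ 0 + ∑ j ∈ J, ENNReal.ofReal e₁ := by
          rw [hGnull]
          exact add_le_add le_rfl (Finset.sum_le_sum fun j _ ↦ (hKε j).le)
      _ = _ := by simp
  -- Outer approximation of the compact sets by open sets.
  have hgap : 0 < (1 - q) / 2 := ENNReal.half_pos (tsub_pos_of_lt hlt).ne'
  have he₂ : (1 - q) / 2 / J.card ≠ 0 :=
    (ENNReal.div_pos hgap.ne' (ENNReal.natCast_ne_top _)).ne'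
  have hUex : ∀ j : ℤ, ∃ U, IsOpen U ∧ K j ⊆ U ∧
      ∫⁻ y in U, ENNReal.ofReal (Real.exp (c j * realTime τ y)) ∂μ ≤
        ∫⁻ y in K j, ENNReal.ofReal (Real.exp (c j * realTime τ y)) ∂μ + (1 - q) / 2 / J.card := by
    refine fun j ↦ exists_isOpen_lintegral_exp_le (hKc j) (c j) (fun x hx ↦ ?_) he₂
    obtain ⟨δ, hδ, hfin⟩ := hGloc x (hKA j hx).1
    refine ⟨δ, hδ, lt_of_le_of_lt (lintegral_mono fun y ↦ ?_) hfin⟩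
    exact ENNReal.ofReal_le_ofReal (Real.exp_le_exp.2
      (mul_le_mul_of_nonneg_right (hKcg j x hx).1 (realTime_nonneg _ _)))
  choose U hUo hKU hUε using hUex
  choose φ hφ0 hφ1 hφ using fun j : ℤ ↦ exists_bounded_zero_one_of_closed (hUo j).isClosed_compl
    (hKc j).isClosed (disjoint_compl_left_iff_subset.2 (hKU j))
  set h : X → ℝ := fun x ↦ -L + J.sup' hJne fun j ↦ (c j + L) * φ j x with hh
  have hsup : ∀ x, ∃ j ∈ J, h x = -L + (c j + L) * φ j x := fun x ↦ by
    obtain ⟨j, hj, hjx⟩ := Finset.exists_mem_eq_sup' hJne fun j ↦ (c j + L) * φ j x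
    exact ⟨j, hj, by rw [← hjx]⟩
  have hle : ∀ x, ∀ j ∈ J, -L + (c j + L) * φ j x ≤ h x := fun x j hj ↦
    add_le_add le_rfl (Finset.le_sup' (fun j ↦ (c j + L) * φ j x) hj)
  have hhge : ∀ x, -L ≤ h x := fun x ↦ by
    obtain ⟨j, hj⟩ := hJne
    nlinarith [hle x j hj, mul_nonneg (hcL j hj).1 (hφ j x).1]
  have hhbd : ∀ x, ‖h x‖ ≤ L := fun x ↦ by
    rw [Real.norm_eq_abs, abs_le]
    refine ⟨hhge x, ?_⟩
    obtain ⟨j, hj, hjx⟩ := hsup x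
    rw [hjx]
    nlinarith [(hφ j x).1, (hφ j x).2, hcL j hj]
  have hhc : Continuous h := continuous_const.add
    (Continuous.finset_sup'_apply hJne fun j _ ↦ continuous_const.mul (φ j).continuous)
  refine ⟨BoundedContinuousFunction.ofNormedAddCommGroup h hhc L hhbd, ?_, ?_⟩
  · have hKm : ∀ j, MeasurableSet (K j) := fun j ↦ (hKc j).isClosed.measurableSet
    have hdisj : (J : Set ℤ).PairwiseDisjoint K := by
      intro i _ j _ hij
      refine disjoint_left.2 fun x hxi hxj ↦ hij ?_
      rw [← show ⌊k * g x⌋ = i from (hKA i hxi).2, ← show ⌊k * g x⌋ = j from (hKA j hxj).2]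
    set W : Set X := ⋃ j ∈ J, K j with hW
    have hWm : MeasurableSet W := J.measurableSet_biUnion fun j _ ↦ hKm j
    have hmexp : ∀ c : ℝ, Measurable fun y ↦ ENNReal.ofReal (Real.exp (c * realTime τ y)) :=
      fun c ↦ ((measurable_realTime hτ).const_mul _).exp.ennreal_ofReal
    have hpt : ∀ y, ENNReal.ofReal (Real.exp (h y * realTime τ y)) ≤
        Wᶜ.indicator (fun y ↦ ENNReal.ofReal (Real.exp (-L * realTime τ y))) y +
          ∑ j ∈ J, (U j).indicator (fun y ↦ ENNReal.ofReal (Real.exp (c j * realTime τ y))) y := by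
      intro y
      have hsingle : ∀ j ∈ J, y ∈ U j → h y ≤ c j →
          ENNReal.ofReal (Real.exp (h y * realTime τ y)) ≤ ∑ j ∈ J, (U j).indicator
            (fun y ↦ ENNReal.ofReal (Real.exp (c j * realTime τ y))) y := by
        intro j hj hyU hhc
        refine le_trans ?_ (Finset.single_le_sum (f := fun j ↦ (U j).indicator
          (fun y ↦ ENNReal.ofReal (Real.exp (c j * realTime τ y))) y) (fun _ _ ↦ zero_le) hj)
        simp only [indicator_of_mem hyU]
        exact ENNReal.ofReal_le_ofReal (Real.exp_le_exp.2
          (mul_le_mul_of_nonneg_right hhc (realTime_nonneg _ _)))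
      obtain ⟨j, hj, hjy⟩ := hsup y
      by_cases hyU : y ∈ U j
      · refine (hsingle j hj hyU ?_).trans le_add_self
        rw [hjy]
        nlinarith [(hφ j y).1, (hφ j y).2, hcL j hj]
      · have h0 : h y = -L := by rw [hjy, hφ0 j hyU]; simp
        by_cases hyW : y ∈ W
        · obtain ⟨i, hi, hyK⟩ := mem_iUnion₂.1 hyW
          refine (hsingle i hi (hKU i hyK) ?_).trans le_add_self
          rw [h0]
          linarith [(hcL i hi).1]
        · refine le_trans ?_ le_self_add
          rw [indicator_of_mem (show y ∈ Wᶜ from hyW), h0]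
    have hgle : ∫⁻ y in Wᶜ, ENNReal.ofReal (Real.exp (-L * realTime τ y)) ∂μ +
        ∑ j ∈ J, ∫⁻ y in K j, ENNReal.ofReal (Real.exp (c j * realTime τ y)) ∂μ ≤ q := by
      have hsplit := lintegral_add_compl (μ := μ)
        (fun y ↦ ENNReal.ofReal (Real.exp (g y * realTime τ y))) hWm
      rw [hq, ← hsplit, add_comm, lintegral_biUnion_finset hdisj fun j _ ↦ hKm j]
      refine add_le_add (Finset.sum_le_sum fun j _ ↦ ?_) (lintegral_mono fun y ↦ ?_)
      · refine setLIntegral_mono' (hKm j) fun y hy ↦ ?_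
        exact ENNReal.ofReal_le_ofReal (Real.exp_le_exp.2
          (mul_le_mul_of_nonneg_right (hKcg j y hy).1 (realTime_nonneg _ _)))
      · exact ENNReal.ofReal_le_ofReal (Real.exp_le_exp.2
          (mul_le_mul_of_nonneg_right (abs_le.1 (hL y)).1 (realTime_nonneg _ _)))
    calc ∫⁻ y, ENNReal.ofReal (Real.exp (h y * realTime τ y)) ∂μ
        ≤ ∫⁻ y, (Wᶜ.indicator (fun y ↦ ENNReal.ofReal (Real.exp (-L * realTime τ y))) y +
          ∑ j ∈ J, (U j).indicator (fun y ↦ ENNReal.ofReal (Real.exp (c j * realTime τ y))) y) ∂μ :=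
          lintegral_mono hpt
      _ = ∫⁻ y in Wᶜ, ENNReal.ofReal (Real.exp (-L * realTime τ y)) ∂μ +
          ∑ j ∈ J, ∫⁻ y in U j, ENNReal.ofReal (Real.exp (c j * realTime τ y)) ∂μ := by
          rw [lintegral_add_left ((hmexp _).indicator hWm.compl), lintegral_indicator hWm.compl,
            lintegral_finsetSum _ fun j _ ↦ (hmexp _).indicator (hUo j).measurableSet]
          congr 1
          exact Finset.sum_congr rfl fun j _ ↦ lintegral_indicator (hUo j).measurableSet _
      _ ≤ ∫⁻ y in Wᶜ, ENNReal.ofReal (Real.exp (-L * realTime τ y)) ∂μ +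
          ∑ j ∈ J, (∫⁻ y in K j, ENNReal.ofReal (Real.exp (c j * realTime τ y)) ∂μ +
            (1 - q) / 2 / J.card) := add_le_add le_rfl (Finset.sum_le_sum fun j _ ↦ hUε j)
      _ ≤ q + (1 - q) / 2 := by
          rw [Finset.sum_add_distrib, ← add_assoc]
          refine add_le_add hgle ?_
          rw [Finset.sum_const, nsmul_eq_mul]
          exact ENNReal.mul_div_le
      _ < q + (1 - q) := by
          refine ENNReal.add_lt_add_left (hlt.trans ENNReal.one_lt_top).ne ?_
          exact ENNReal.half_lt_self (tsub_pos_of_lt hlt).ne'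
            (ne_top_of_le_ne_top ENNReal.one_ne_top tsub_le_self)
      _ = 1 := add_tsub_cancel_of_le hlt.le
  · set W : Set X := ⋃ j ∈ J, K j with hW
    have hWm : MeasurableSet W := J.measurableSet_biUnion fun j _ ↦ (hKc j).isClosed.measurableSet
    have hpt : ∀ y, g y - (1 / k + Wᶜ.indicator (fun _ ↦ 2 * (L : ℝ)) y) ≤ h y := fun y ↦ by
      by_cases hyW : y ∈ W
      · obtain ⟨j, hj, hyK⟩ := mem_iUnion₂.1 hyW
        rw [indicator_of_notMem (by simpa using hyW)]
        have h1 := hle y j hj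
        rw [hφ1 j hyK] at h1
        have h2 := (hKcg j y hyK).2
        simp at h1
        linarith
      · rw [indicator_of_mem (show y ∈ Wᶜ from hyW)]
        have : 0 < 1 / (k : ℝ) := by positivity
        linarith [hhge y, (abs_le.1 (hL y)).2]
    have hgi : Integrable g ν := Integrable.of_bound hg.aestronglyMeasurable L
      (Eventually.of_forall hL)
    have hhi : Integrable h ν := Integrable.of_bound hhc.measurable.aestronglyMeasurable L
      (Eventually.of_forall hhbd)
    have hii : Integrable (Wᶜ.indicator fun _ ↦ 2 * (L : ℝ)) ν :=
      (integrable_const _).indicator hWm.compl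
    have hsum : Integrable (fun y ↦ 1 / (k : ℝ) + Wᶜ.indicator (fun _ ↦ 2 * (L : ℝ)) y) ν :=
      (integrable_const _).add hii
    have hint : ∫ y, (g y - (1 / k + Wᶜ.indicator (fun _ ↦ 2 * (L : ℝ)) y)) ∂ν ≤ ∫ y, h y ∂ν :=
      integral_mono (hgi.sub hsum) hhi hpt
    rw [integral_sub hgi hsum, integral_add (integrable_const _) hii,
      integral_indicator hWm.compl] at hint
    simp only [integral_const, probReal_univ, smul_eq_mul,
      measureReal_restrict_apply_univ] at hint
    have hWr : ν.real Wᶜ ≤ J.card * e₁ := by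
      refine ENNReal.toReal_le_of_le_ofReal (by positivity) ?_
      rwa [ENNReal.ofReal_mul (Nat.cast_nonneg _), ENNReal.ofReal_natCast]
    have hsmall : ν.real Wᶜ * (2 * L) < r / 2 := by
      calc ν.real Wᶜ * (2 * L) ≤ J.card * e₁ * (2 * L + 1) := by
            refine mul_le_mul hWr (by linarith) (by positivity) (by positivity)
        _ = r / 4 := by rw [he₁]; field_simp
        _ < r / 2 := by linarith
    change a < ∫ y, h y ∂ν
    linarith

end Continuous

/-! ### Integration against the normalized measure `ν̄` -/

theorem toReal_inv_time {X : Type*} (τ : X → ℝ≥0∞) (y : X) : (τ y)⁻¹.toReal = (realTime τ y)⁻¹ :=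
  ENNReal.toReal_inv _

section Bar

variable {X : Type*} [MeasurableSpace X] {μ : Measure X} {τ : X → ℝ≥0∞} {ν : Measure X}

theorem isProbabilityMeasure_barMeasure (h0 : invTimeIntegral τ ν ≠ 0)
    (h1 : invTimeIntegral τ ν ≠ ⊤) : IsProbabilityMeasure (barMeasure τ ν) :=
  ⟨by
    rw [barMeasure, Measure.smul_apply, withDensity_apply _ MeasurableSet.univ,
      Measure.restrict_univ, smul_eq_mul]
    exact ENNReal.inv_mul_cancel h0 h1⟩

theorem barMeasure_absolutelyContinuous (hν : ν ≪ μ) : barMeasure τ ν ≪ μ :=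
  (Measure.smul_absolutelyContinuous.trans (withDensity_absolutelyContinuous _ _)).trans hν

theorem ae_inv_time_lt_top (hν0 : ∀ᵐ y ∂ν, 0 < realTime τ y) : ∀ᵐ y ∂ν, (τ y)⁻¹ < ⊤ := by
  filter_upwards [hν0] with y hy
  refine ENNReal.inv_lt_top.2 (pos_iff_ne_zero.2 fun h ↦ ?_)
  simp [realTime, h] at hy

/-- Integrals against `ν/τ` in terms of the normalized measure. Where `φ` is not integrable, both
sides vanish by convention. -/
theorem integral_inv_realTime_smul {E : Type*} [NormedAddCommGroup E] [NormedSpace ℝ E]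
    (hτ : Measurable τ) (hν0 : ∀ᵐ y ∂ν, 0 < realTime τ y)
    (h0 : invTimeIntegral τ ν ≠ 0) (h1 : invTimeIntegral τ ν ≠ ⊤) (φ : X → E) :
    ∫ y, (realTime τ y)⁻¹ • φ y ∂ν =
      (invTimeIntegral τ ν).toReal • ∫ y, φ y ∂(barMeasure τ ν) := by
  rw [barMeasure, integral_smul_measure, integral_withDensity_eq_integral_toReal_smul
    (f := fun y ↦ (τ y)⁻¹) hτ.inv (ae_inv_time_lt_top hν0),
    ENNReal.toReal_inv, smul_smul,
    mul_inv_cancel₀ (ENNReal.toReal_ne_zero.2 ⟨h0, h1⟩), one_smul]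
  congr with y
  rw [toReal_inv_time]

theorem integrable_realTime_smul_barMeasure {E : Type*} [NormedAddCommGroup E] [NormedSpace ℝ E]
    (hτ : Measurable τ) (hν0 : ∀ᵐ y ∂ν, 0 < realTime τ y)
    (h0 : invTimeIntegral τ ν ≠ 0) {φ : X → E} (hφ : Integrable φ ν) :
    Integrable (fun y ↦ realTime τ y • φ y) (barMeasure τ ν) := by
  refine Integrable.smul_measure ?_ (ENNReal.inv_ne_top.2 h0)
  refine (integrable_withDensity_iff_integrable_smul' (f := fun y ↦ (τ y)⁻¹) hτ.inv
    (ae_inv_time_lt_top hν0)).2 (hφ.congr ?_)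
  filter_upwards [hν0] with y hy
  rw [toReal_inv_time, smul_smul, inv_mul_cancel₀ hy.ne', one_smul]

theorem withDensity_inv_time_apply {A : Set X} (hA : MeasurableSet A)
    (hpos : ∀ y ∈ A, 0 < realTime τ y) :
    ν.withDensity (fun y ↦ (τ y)⁻¹) A = ∫⁻ y in A, ENNReal.ofReal (realTime τ y)⁻¹ ∂ν := by
  rw [withDensity_apply _ hA]
  refine setLIntegral_congr_fun hA fun y hy ↦ ?_
  have h := ENNReal.toReal_pos_iff.1 (hpos y hy)
  rw [← toReal_inv_time, ENNReal.ofReal_toReal (ENNReal.inv_ne_top.2 h.1.ne')]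

end Bar

/-! ### Test functions approaching the rate functional -/

section TestFunctions

variable {X : Type*} [MeasurableSpace X] {μ : Measure X} [IsProbabilityMeasure μ]
  {τ : X → ℝ≥0∞}

/-- If `ν_a(1/τ) = ∞`, the test function `1/τ` on `{η ≤ τ < s}` and `-1` on `{τ ≥ s}` is
admissible for small `s`, and its integral is unbounded as `η ↓ 0`. -/
theorem exists_testFunction_of_invTimeIntegral_eq_top (hτ : Measurable τ)
    (hA1 : μ {x | τ x = 0} = 0 ∧ μ {x | τ x = ⊤} = 0) {ν : Measure X} [IsFiniteMeasure ν]
    (hν1 : ν univ ≤ 1) (hν : ν ≪ μ) (htop : invTimeIntegral τ ν = ⊤) (b : ℝ) :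
    ∃ g : X → ℝ, Measurable g ∧ (∃ L : ℝ, ∀ x, |g x| ≤ L) ∧
      ∫⁻ y, ENNReal.ofReal (Real.exp (g y * realTime τ y)) ∂μ < 1 ∧ b ≤ ∫ y, g y ∂ν := by
  have hT := measurable_realTime hτ
  set q := ∫⁻ y, ENNReal.ofReal (Real.exp (-1 * realTime τ y)) ∂μ
  have hq : q < 1 := lintegral_exp_neg_mul_lt_one hτ hA1 one_pos
  -- The choice of `s`.
  obtain ⟨s, hs, hsmall⟩ : ∃ s : ℝ, 0 < s ∧
      ENNReal.ofReal (Real.exp 1) * μ {y | realTime τ y < s} + q < 1 := by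
    set A : ℕ → Set X := fun n ↦ {y | realTime τ y < 1 / (n + 1 : ℝ)} with hA
    have hAlim : Tendsto (μ ∘ A) atTop (𝓝 (μ (⋂ n, A n))) := by
      refine tendsto_measure_iInter_atTop
        (fun n ↦ (measurableSet_lt hT measurable_const).nullMeasurableSet) ?_
        ⟨0, measure_ne_top _ _⟩
      intro m n hmn y hy
      have hy' : realTime τ y < 1 / (n + 1 : ℝ) := hy
      have hle : 1 / (n + 1 : ℝ) ≤ 1 / (m + 1 : ℝ) :=
        one_div_le_one_div_of_le (by positivity) (by gcongr)
      exact hy'.trans_le hle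
    have hA0 : μ (⋂ n, A n) = 0 := by
      refine measure_mono_null (fun y hy ↦ ?_) (ae_iff.1 (ae_realTime_pos hA1))
      simp only [mem_ofPred_eq, not_and, not_lt]
      intro _
      by_contra! hpos
      obtain ⟨n, hn⟩ := exists_nat_one_div_lt hpos
      exact absurd (mem_iInter.1 hy n) (not_lt.2 hn.le)
    rw [hA0] at hAlim
    have hlim := (ENNReal.Tendsto.const_mul hAlim
      (Or.inr (ENNReal.ofReal_ne_top (r := Real.exp 1)))).add_const q
    rw [mul_zero, zero_add] at hlim
    obtain ⟨n, hn⟩ := (hlim.eventually (gt_mem_nhds hq)).exists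
    exact ⟨1 / (n + 1 : ℝ), by positivity, hn⟩
  have hT0 : ∀ᵐ y ∂ν, 0 < realTime τ y :=
    ((ae_realTime_pos hA1).mono fun _ h ↦ h.2).filter_mono hν.ae_le
  -- The choice of `η = 1 / (n + 1)`.
  set κ := ν.withDensity fun y ↦ (τ y)⁻¹ with hκ
  set E : ℕ → Set X := fun n ↦ {y | 1 / (n + 1 : ℝ) ≤ realTime τ y} ∩ {y | realTime τ y < s}
    with hE
  have hEm : ∀ n, MeasurableSet (E n) := fun n ↦
    (measurableSet_le measurable_const hT).inter (measurableSet_lt hT measurable_const)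
  have hEpos : ∀ n, ∀ y ∈ E n, 0 < realTime τ y := fun n y hy ↦
    lt_of_lt_of_le (by positivity) hy.1
  have hκE : ∀ n, κ (E n) = ∫⁻ y in E n, ENNReal.ofReal (realTime τ y)⁻¹ ∂ν := fun n ↦
    withDensity_inv_time_apply (hEm n) (hEpos n)
  have hκfin : ∀ n, κ (E n) ≤ ENNReal.ofReal (n + 1) := fun n ↦ by
    rw [hκE]
    calc ∫⁻ y in E n, ENNReal.ofReal (realTime τ y)⁻¹ ∂ν
        ≤ ∫⁻ y in E n, ENNReal.ofReal (n + 1) ∂ν := by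
          refine setLIntegral_mono' (hEm n) fun y hy ↦ ENNReal.ofReal_le_ofReal ?_
          rw [inv_le_comm₀ (hEpos n y hy) (by positivity), ← one_div]
          exact hy.1
      _ ≤ ENNReal.ofReal (n + 1) * 1 := by
          rw [setLIntegral_const]
          gcongr
          exact (measure_mono (subset_univ _)).trans hν1
      _ = _ := mul_one _
  have hκtop : κ (⋃ n, E n) = ⊤ := by
    have huniv : κ univ = ⊤ := by
      rw [hκ, withDensity_apply _ MeasurableSet.univ, Measure.restrict_univ]
      exact htop
    have hlarge : κ {y | s ≤ realTime τ y} < ⊤ := by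
      rw [hκ, withDensity_inv_time_apply (measurableSet_le measurable_const hT)
        fun y hy ↦ lt_of_lt_of_le hs hy]
      calc ∫⁻ y in {y | s ≤ realTime τ y}, ENNReal.ofReal (realTime τ y)⁻¹ ∂ν
          ≤ ∫⁻ y in {y | s ≤ realTime τ y}, ENNReal.ofReal s⁻¹ ∂ν := by
            refine setLIntegral_mono' (measurableSet_le measurable_const hT)
              fun y hy ↦ ENNReal.ofReal_le_ofReal ?_
            exact inv_anti₀ hs hy
        _ < ⊤ := by
            rw [setLIntegral_const]
            exact ENNReal.mul_lt_top ENNReal.ofReal_lt_top (measure_lt_top _ _)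
    have hzero : κ {y | realTime τ y ≤ 0} = 0 := by
      refine withDensity_absolutelyContinuous _ _ ?_
      simpa [ae_iff] using hT0
    by_contra hne
    have hcover : (univ : Set X) ⊆
        (⋃ n, E n) ∪ ({y | s ≤ realTime τ y} ∪ {y | realTime τ y ≤ 0}) := by
      intro y _
      rcases le_or_gt (realTime τ y) 0 with h | h
      · exact Or.inr (Or.inr h)
      rcases le_or_gt s (realTime τ y) with h' | h'
      · exact Or.inr (Or.inl h')
      obtain ⟨n, hn⟩ := exists_nat_one_div_lt h
      exact Or.inl (mem_iUnion.2 ⟨n, hn.le, h'⟩)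
    have := (measure_mono (μ := κ) hcover).trans ((measure_union_le _ _).trans
      (add_le_add le_rfl (measure_union_le _ _)))
    rw [huniv, hzero, add_zero, top_le_iff] at this
    exact ENNReal.add_ne_top.2 ⟨hne, hlarge.ne⟩ this
  have hElim : Tendsto (κ ∘ E) atTop (𝓝 ⊤) := by
    rw [← hκtop]
    refine tendsto_measure_iUnion_atTop fun m n hmn y hy ↦ ⟨?_, hy.2⟩
    have hy' : 1 / (m + 1 : ℝ) ≤ realTime τ y := hy.1
    exact (one_div_le_one_div_of_le (by positivity) (by gcongr)).trans hy'
  obtain ⟨n, hn⟩ := (hElim.eventually (lt_mem_nhds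
    (ENNReal.ofReal_lt_top (r := b + 1)))).exists
  have hn' : b + 1 ≤ (κ (E n)).toReal :=
    (ENNReal.ofReal_le_iff_le_toReal (ne_top_of_le_ne_top ENNReal.ofReal_ne_top (hκfin n))).1 hn.le
  set S : Set X := {y | s ≤ realTime τ y} with hS
  have hSm : MeasurableSet S := measurableSet_le measurable_const hT
  set g : X → ℝ := fun y ↦ (E n).indicator (fun y ↦ (realTime τ y)⁻¹) y -
    S.indicator (fun _ ↦ 1) y with hg
  have hg₁b : ∀ y, |(E n).indicator (fun y ↦ (realTime τ y)⁻¹) y| ≤ n + 1 := fun y ↦ by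
    by_cases hy : y ∈ E n
    · rw [indicator_of_mem hy, abs_of_pos (inv_pos.2 (hEpos n y hy)),
        inv_le_comm₀ (hEpos n y hy) (by positivity), ← one_div]
      exact hy.1
    · rw [indicator_of_notMem hy, abs_zero]; positivity
  have hg₂b : ∀ y, |S.indicator (fun _ ↦ (1 : ℝ)) y| ≤ 1 := fun y ↦ by
    by_cases hy : y ∈ S
    · simp [hy]
    · simp [hy]
  have hg₁m : Measurable ((E n).indicator fun y ↦ (realTime τ y)⁻¹) := hT.inv.indicator (hEm n)
  have hg₂m : Measurable (S.indicator fun _ ↦ (1 : ℝ)) := measurable_const.indicator hSm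
  refine ⟨g, hg₁m.sub hg₂m, ⟨n + 1 + 1, fun y ↦ ?_⟩, ?_, ?_⟩
  · exact (abs_sub _ _).trans (add_le_add (hg₁b y) (hg₂b y))
  · refine lt_of_le_of_lt ?_ hsmall
    have hmm : MeasurableSet {y | realTime τ y < s} := measurableSet_lt hT measurable_const
    calc ∫⁻ y, ENNReal.ofReal (Real.exp (g y * realTime τ y)) ∂μ
        ≤ ∫⁻ y, ({y | realTime τ y < s}.indicator (fun _ ↦ ENNReal.ofReal (Real.exp 1)) y +
            ENNReal.ofReal (Real.exp (-1 * realTime τ y))) ∂μ := by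
          refine lintegral_mono fun y ↦ ?_
          by_cases hy : realTime τ y < s
          · rw [indicator_of_mem (show y ∈ {y | realTime τ y < s} from hy)]
            refine le_add_right (ENNReal.ofReal_le_ofReal (Real.exp_le_exp.2 ?_))
            have h1 : y ∉ S := not_le.2 hy
            simp only [hg, indicator_of_notMem h1, sub_zero]
            by_cases hyE : y ∈ E n
            · rw [indicator_of_mem hyE, inv_mul_cancel₀ (hEpos n y hyE).ne']
            · rw [indicator_of_notMem hyE, zero_mul]; exact zero_le_one
          · refine le_add_left (ENNReal.ofReal_le_ofReal (Real.exp_le_exp.2 ?_))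
            have h1 : y ∈ S := not_lt.1 hy
            have h2 : y ∉ E n := fun h ↦ hy h.2
            simp [hg, indicator_of_mem h1, indicator_of_notMem h2]
      _ = _ := by
          rw [lintegral_add_left (measurable_const.indicator hmm),
            lintegral_indicator_const hmm]
  · rw [integral_sub
      (Integrable.of_bound hg₁m.aestronglyMeasurable (n + 1) (Eventually.of_forall hg₁b))
      (Integrable.of_bound hg₂m.aestronglyMeasurable 1 (Eventually.of_forall hg₂b)),
      integral_indicator (hEm n), integral_indicator hSm]
    have h1 : ∫ y in E n, (realTime τ y)⁻¹ ∂ν = (κ (E n)).toReal := by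
      rw [hκE, integral_eq_lintegral_of_nonneg_ae
        (Eventually.of_forall fun y ↦ inv_nonneg.2 (realTime_nonneg τ y))
        hT.inv.aestronglyMeasurable]
    have h2 : ∫ _ in S, (1 : ℝ) ∂ν ≤ 1 := by
      simp only [integral_const, smul_eq_mul, mul_one, measureReal_restrict_apply_univ]
      exact ENNReal.toReal_le_of_le_ofReal zero_le_one
        (by simpa using (measure_mono (subset_univ S)).trans hν1)
    rw [h1]
    linarith

/-- If `0 < m = ν_a(1/τ) < ∞` and `h` is the density of `ν̄_a`, the test function
`(log (h ∨ δ) - η) / τ`, cut off where `τ` is small or `h` is large, has integral close to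
`m H(ν̄_a | μ)`. -/
theorem exists_testFunction_of_invTimeIntegral_ne_top (hτ : Measurable τ)
    (hA1 : μ {x | τ x = 0} = 0 ∧ μ {x | τ x = ⊤} = 0) {ν : Measure X} (hν : ν ≪ μ)
    (h0 : invTimeIntegral τ ν ≠ 0) (h1 : invTimeIntegral τ ν ≠ ⊤) {b : ℝ≥0}
    (hb : (b : ℝ≥0∞) ≤ invTimeIntegral τ ν * InformationTheory.klDiv (barMeasure τ ν) μ)
    {ε : ℝ} (hε : 0 < ε) :
    ∃ g : X → ℝ, Measurable g ∧ (∃ L : ℝ, ∀ x, |g x| ≤ L) ∧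
      ∫⁻ y, ENNReal.ofReal (Real.exp (g y * realTime τ y)) ∂μ < 1 ∧ b - ε ≤ ∫ y, g y ∂ν := by
  have hT := measurable_realTime hτ
  set m := invTimeIntegral τ ν with hm
  set M := m.toReal with hM
  have hM0 : 0 < M := ENNReal.toReal_pos h0 h1
  set ρ := barMeasure τ ν with hρ
  have hρp : IsProbabilityMeasure ρ := isProbabilityMeasure_barMeasure h0 h1
  have hρμ : ρ ≪ μ := barMeasure_absolutelyContinuous hν
  have hT0μ : ∀ᵐ y ∂μ, 0 < realTime τ y := (ae_realTime_pos hA1).mono fun _ h ↦ h.2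
  set h : X → ℝ := fun y ↦ (ρ.rnDeriv μ y).toReal with hh
  have hhm : Measurable h := (Measure.measurable_rnDeriv ρ μ).ennreal_toReal
  have hh0 : ∀ y, 0 ≤ h y := fun y ↦ ENNReal.toReal_nonneg
  have hhi : Integrable h μ := Measure.integrable_toReal_rnDeriv
  set B : ℕ → Set X := fun n ↦ {y | 1 / (n + 1 : ℝ) ≤ realTime τ y} ∩ {y | h y ≤ n + 1} with hB
  have hBm : ∀ n, MeasurableSet (B n) := fun n ↦
    (measurableSet_le measurable_const hT).inter (measurableSet_le hhm measurable_const)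
  have hBmono : Monotone B := fun i j hij y hy ↦ by
    have hy₁ : 1 / (i + 1 : ℝ) ≤ realTime τ y := hy.1
    have hy₂ : h y ≤ i + 1 := hy.2
    have hij' : (i : ℝ) ≤ j := by exact_mod_cast hij
    exact ⟨(one_div_le_one_div_of_le (by positivity) (by gcongr)).trans hy₁,
      hy₂.trans (by linarith)⟩
  have hBU : {y | 0 < realTime τ y} ⊆ ⋃ n, B n := fun y (hy : 0 < realTime τ y) ↦ by
    obtain ⟨n, hn⟩ := exists_nat_one_div_lt hy
    obtain ⟨k, hk⟩ := exists_nat_ge (h y)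
    refine mem_iUnion.2 ⟨max n k, le_trans ?_ hn.le, hk.trans ?_⟩
    · exact one_div_le_one_div_of_le (by positivity) (by gcongr; exact le_max_left _ _)
    · have : (k : ℝ) ≤ (max n k : ℕ) := by exact_mod_cast le_max_right n k
      linarith
  have hlim : ∀ κ : Measure X, κ ≪ μ → Tendsto (κ ∘ B) atTop (𝓝 (κ univ)) := fun κ hκ ↦ by
    have : κ (⋃ n, B n) = κ univ := by
      refine measure_congr (eventuallyEq_univ.2 ?_)
      exact (hT0μ.filter_mono hκ.ae_le).mono fun y hy ↦ hBU hy
    rw [← this]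
    exact tendsto_measure_iUnion_atTop hBmono
  set F : X → ℝ≥0∞ := fun y ↦ ENNReal.ofReal (InformationTheory.klFun (h y)) with hF
  have hFm : Measurable F := (InformationTheory.measurable_klFun.comp hhm).ennreal_ofReal
  have hHuniv : μ.withDensity F univ = InformationTheory.klDiv ρ μ := by
    rw [InformationTheory.klDiv_eq_lintegral_klFun_of_ac hρμ,
      withDensity_apply _ MeasurableSet.univ, Measure.restrict_univ]
  -- The choice of `η`, `δ` and of the cut-off level `n`.
  set η : ℝ := ε / (3 * M) with hη
  have hη0 : 0 < η := by positivity
  have hMη : M * η = ε / 3 := by rw [hη]; field_simp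
  set δ : ℝ := (Real.exp η - 1) / 2 with hδ
  have hexp : 1 < Real.exp η := Real.one_lt_exp_iff.2 hη0
  have hδ0 : 0 < δ := by rw [hδ]; linarith
  set θ : ℝ := Real.exp (-η) * (1 + δ) with hθ
  have hθ1 : θ < 1 := by
    have h2 : Real.exp (-η) * Real.exp η = 1 := by rw [← Real.exp_add]; simp
    have h3 : Real.exp (-η) < 1 := Real.exp_lt_one_iff.2 (by linarith)
    rw [hθ, hδ]
    nlinarith
  have hθ0 : 0 ≤ θ := by positivity
  have hμc : Tendsto (fun n ↦ ENNReal.ofReal θ + μ (B n)ᶜ) atTop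
      (𝓝 (ENNReal.ofReal θ + 0)) := by
    refine Tendsto.const_add _ ?_
    have h2 := hlim μ Measure.AbsolutelyContinuous.rfl
    have h3 : ∀ n, μ (B n)ᶜ = 1 - μ (B n) := fun n ↦ prob_compl_eq_one_sub (hBm n)
    simp_rw [h3]
    have h4 := ENNReal.Tendsto.sub (tendsto_const_nhds (x := (1 : ℝ≥0∞)) (f := atTop (α := ℕ))) h2
      (Or.inl ENNReal.one_ne_top)
    simpa using h4
  have hev₁ : ∀ᶠ n in atTop, ENNReal.ofReal θ + μ (B n)ᶜ < 1 := by
    refine hμc.eventually (gt_mem_nhds ?_)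
    rw [add_zero, ← ENNReal.ofReal_one]
    exact (ENNReal.ofReal_lt_ofReal_iff one_pos).2 hθ1
  have hev₂ : ∀ᶠ n in atTop, ENNReal.ofReal (1 - η) < ρ (B n) := by
    refine (hlim ρ hρμ).eventually (lt_mem_nhds ?_)
    rw [measure_univ, ← ENNReal.ofReal_one]
    exact (ENNReal.ofReal_lt_ofReal_iff one_pos).2 (by linarith)
  have hev₃ : ∀ᶠ n in atTop, ENNReal.ofReal (b - ε / 3) ≤ m * μ.withDensity F (B n) := by
    rcases le_or_gt ((b : ℝ) - ε / 3) 0 with hneg | hpos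
    · exact Eventually.of_forall fun n ↦ by rw [ENNReal.ofReal_of_nonpos hneg]; exact zero_le
    · have h2 := ENNReal.Tendsto.const_mul (hlim _ (withDensity_absolutelyContinuous μ F))
        (a := m) (Or.inr h1)
      refine (h2.eventually (lt_mem_nhds ?_)).mono fun n hn ↦ le_of_lt hn
      rw [hHuniv]
      refine lt_of_lt_of_le ?_ hb
      rw [← ENNReal.ofReal_coe_nnreal]
      exact (ENNReal.ofReal_lt_ofReal_iff (by linarith)).2 (by linarith)
  obtain ⟨n, hn₁, hn₂, hn₃⟩ := (hev₁.and (hev₂.and hev₃)).exists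
  set R : ℝ := n + 1 with hR
  have hR1 : 1 ≤ R := by rw [hR]; linarith [Nat.cast_nonneg (α := ℝ) n]
  set ψ : X → ℝ := fun y ↦ Real.log (max (h y) δ) with hψ
  have hψm : Measurable ψ := (hhm.max measurable_const).log
  set b₀ : ℝ := max |Real.log δ| |Real.log (R + δ)| with hb₀
  have hψb : ∀ y ∈ B n, |ψ y| ≤ b₀ := fun y hy ↦ by
    have h2 : δ ≤ max (h y) δ := le_max_right _ _
    have h3 : max (h y) δ ≤ R + δ := max_le (hy.2.trans (by linarith)) (by linarith)
    exact abs_le_max_abs_abs (Real.log_le_log hδ0 h2) (Real.log_le_log (hδ0.trans_le h2) h3)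
  set φ : X → ℝ := (B n).indicator fun y ↦ ψ y - η with hφ
  have hφm : Measurable φ := (hψm.sub_const η).indicator (hBm n)
  have hBpos : ∀ y ∈ B n, 0 < realTime τ y := fun y hy ↦ lt_of_lt_of_le (by positivity) hy.1
  refine ⟨fun y ↦ φ y / realTime τ y, hφm.div hT, ⟨(b₀ + η) * R, fun y ↦ ?_⟩, ?_, ?_⟩
  · by_cases hy : y ∈ B n
    · simp only [hφ, indicator_of_mem hy]
      rw [abs_div, abs_of_pos (hBpos y hy), div_le_iff₀ (hBpos y hy)]
      have h2 : |ψ y - η| ≤ b₀ + η :=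
        (abs_sub _ _).trans (add_le_add (hψb y hy) (abs_of_pos hη0).le)
      have h3 : 1 ≤ R * realTime τ y := by
        have := hy.1
        simp only [mem_ofPred_eq] at this
        rwa [div_le_iff₀ (by positivity), mul_comm] at this
      have h4 : 0 ≤ b₀ + η := (abs_nonneg _).trans h2
      nlinarith
    · simp only [hφ, indicator_of_notMem hy, zero_div, abs_zero]
      positivity
  · refine lt_of_le_of_lt ?_ hn₁
    calc ∫⁻ y, ENNReal.ofReal (Real.exp (φ y / realTime τ y * realTime τ y)) ∂μ
        ≤ ∫⁻ y, (ENNReal.ofReal (Real.exp (-η)) * (ρ.rnDeriv μ y + ENNReal.ofReal δ) +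
            (B n)ᶜ.indicator (fun _ ↦ 1) y) ∂μ := by
          refine lintegral_mono fun y ↦ ?_
          by_cases hy : y ∈ B n
          · refine le_add_right ?_
            rw [div_mul_cancel₀ _ (hBpos y hy).ne', hφ, indicator_of_mem hy, sub_eq_add_neg,
              add_comm, Real.exp_add, ENNReal.ofReal_mul (Real.exp_pos _).le, hψ]
            simp only
            rw [Real.exp_log (hδ0.trans_le (le_max_right _ _))]
            gcongr
            calc ENNReal.ofReal (max (h y) δ) ≤ ENNReal.ofReal (h y + δ) :=
                  ENNReal.ofReal_le_ofReal (max_le (by linarith) (by linarith [hh0 y]))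
              _ = ENNReal.ofReal (h y) + ENNReal.ofReal δ := ENNReal.ofReal_add (hh0 y) hδ0.le
              _ ≤ _ := by gcongr; exact ENNReal.ofReal_toReal_le
          · refine le_add_left ?_
            rw [hφ, indicator_of_notMem hy, indicator_of_mem (show y ∈ (B n)ᶜ from hy)]
            simp
      _ ≤ ENNReal.ofReal θ + μ (B n)ᶜ := by
          rw [lintegral_add_right _ (measurable_const.indicator (hBm n).compl),
            lintegral_indicator_const (hBm n).compl, one_mul,
            lintegral_const_mul _ ((Measure.measurable_rnDeriv ρ μ).add_const _),
            lintegral_add_right _ measurable_const, Measure.lintegral_rnDeriv hρμ]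
          simp only [measure_univ, lintegral_const, mul_one]
          rw [hθ, ENNReal.ofReal_mul (Real.exp_pos _).le, ENNReal.ofReal_add zero_le_one hδ0.le,
            ENNReal.ofReal_one]
  · have hint := integral_inv_realTime_smul hτ (hT0μ.filter_mono hν.ae_le) h0 h1 φ
    simp_rw [smul_eq_mul, ← div_eq_inv_mul] at hint
    rw [hint, hφ, integral_indicator (hBm n)]
    have hψi : IntegrableOn ψ (B n) ρ :=
      Measure.integrableOn_of_bounded (measure_ne_top _ _) hψm.aestronglyMeasurable
        (M := b₀) ((ae_restrict_iff' (hBm n)).2 (Eventually.of_forall hψb))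
    have hkl : ∀ y ∈ B n, |InformationTheory.klFun (h y)| ≤ R * Real.log R + 1 := fun y hy ↦ by
      have h2 : 0 ≤ InformationTheory.klFun (h y) := InformationTheory.klFun_nonneg (hh0 y)
      rw [abs_of_nonneg h2, InformationTheory.klFun]
      have hlogR : 0 ≤ Real.log R := Real.log_nonneg hR1
      have h3 : h y * Real.log (h y) ≤ R * Real.log R := by
        rcases (hh0 y).eq_or_lt with h4 | h4
        · rw [← h4, zero_mul]; positivity
        · calc h y * Real.log (h y) ≤ h y * Real.log R :=
                mul_le_mul_of_nonneg_left (Real.log_le_log h4 hy.2) (hh0 y)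
            _ ≤ R * Real.log R := mul_le_mul_of_nonneg_right hy.2 hlogR
      linarith [hh0 y]
    have hkm : Measurable fun y ↦ InformationTheory.klFun (h y) :=
      InformationTheory.measurable_klFun.comp hhm
    have hkli : IntegrableOn (fun y ↦ InformationTheory.klFun (h y)) (B n) μ :=
      Measure.integrableOn_of_bounded (measure_ne_top _ _) hkm.aestronglyMeasurable
        (M := R * Real.log R + 1) ((ae_restrict_iff' (hBm n)).2 (Eventually.of_forall hkl))
    have hkint : ∫ y in B n, InformationTheory.klFun (h y) ∂μ =
        (μ.withDensity F (B n)).toReal := by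
      rw [withDensity_apply _ (hBm n), integral_eq_lintegral_of_nonneg_ae
        (Eventually.of_forall fun y ↦ InformationTheory.klFun_nonneg (hh0 y))
        hkm.aestronglyMeasurable]
    have hhint : ∫ y in B n, h y ∂μ = ρ.real (B n) := Measure.setIntegral_toReal_rnDeriv hρμ _
    have hψlow : (μ.withDensity F (B n)).toReal + ρ.real (B n) - 1 ≤ ∫ y in B n, ψ y ∂ρ := by
      have hsm := setIntegral_rnDeriv_smul (f := ψ) hρμ (hBm n)
      have hi : IntegrableOn (fun y ↦ (ρ.rnDeriv μ y).toReal • ψ y) (B n) μ :=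
        Measure.integrableOn_of_bounded (measure_ne_top _ _)
          (hhm.mul hψm).aestronglyMeasurable (M := R * b₀)
          ((ae_restrict_iff' (hBm n)).2 (Eventually.of_forall fun y hy ↦ by
            rw [smul_eq_mul, norm_mul, Real.norm_eq_abs, Real.norm_eq_abs,
              abs_of_nonneg (hh0 y)]
            exact mul_le_mul hy.2 (hψb y hy) (abs_nonneg _) (by linarith)))
      rw [← hsm, ← hkint, ← hhint]
      have hone : ∫ _ in B n, (1 : ℝ) ∂μ ≤ 1 := by
        simp only [integral_const, smul_eq_mul, mul_one, measureReal_restrict_apply_univ]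
        exact measureReal_le_one
      have hkh : IntegrableOn (fun y ↦ InformationTheory.klFun (h y) + h y) (B n) μ :=
        hkli.add hhi.integrableOn
      calc (∫ y in B n, InformationTheory.klFun (h y) ∂μ) + (∫ y in B n, h y ∂μ) - 1
          ≤ (∫ y in B n, InformationTheory.klFun (h y) ∂μ) + (∫ y in B n, h y ∂μ) -
            ∫ _ in B n, (1 : ℝ) ∂μ := by linarith
        _ = ∫ y in B n, (InformationTheory.klFun (h y) + h y - 1) ∂μ := by
            rw [← integral_add hkli hhi.integrableOn, integral_sub hkh (integrable_const _)]
        _ ≤ _ := by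
            refine setIntegral_mono_on (hkh.sub (integrable_const _)) hi
              (hBm n) fun y hy ↦ ?_
            have h3 : h y * Real.log (h y) ≤ h y * ψ y := by
              rcases (hh0 y).eq_or_lt with h4 | h4
              · rw [← h4, zero_mul, zero_mul]
              · exact mul_le_mul_of_nonneg_left (Real.log_le_log h4 (le_max_left _ _)) (hh0 y)
            rw [InformationTheory.klFun, smul_eq_mul]
            change _ ≤ h y * ψ y
            linarith
    have hηle : ∫ _ in B n, η ∂ρ ≤ η := by
      simp only [integral_const, smul_eq_mul, measureReal_restrict_apply_univ]
      nlinarith [measureReal_le_one (μ := ρ) (s := B n)]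
    rw [integral_sub hψi (integrable_const _)]
    have hρB : 1 - η ≤ ρ.real (B n) :=
      (ENNReal.ofReal_le_iff_le_toReal (measure_ne_top _ _)).1 hn₂.le
    have hfin : μ.withDensity F (B n) ≠ ⊤ := by
      rw [withDensity_apply _ (hBm n)]
      exact hkli.lintegral_lt_top.ne
    have hb₃ : b - ε / 3 ≤ M * (μ.withDensity F (B n)).toReal := by
      rw [hM, ← ENNReal.toReal_mul]
      exact (ENNReal.ofReal_le_iff_le_toReal (ENNReal.mul_ne_top h1 hfin)).1 hn₃
    calc (b : ℝ) - ε = (b - ε / 3) - M * η - M * η := by rw [hMη]; ring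
      _ ≤ M * ((μ.withDensity F (B n)).toReal + ρ.real (B n) - 1 - η) := by nlinarith
      _ ≤ M * ((∫ y in B n, ψ y ∂ρ) - ∫ _ in B n, η ∂ρ) :=
          mul_le_mul_of_nonneg_left (by linarith) hM0.le

end TestFunctions

/-! ### The rate is at most the supremum over test functions -/

section Duality

theorem exists_testFunction_absolutelyContinuous {X : Type*} [MeasurableSpace X] {μ : Measure X}
    [IsProbabilityMeasure μ] {τ : X → ℝ≥0∞} (hτ : Measurable τ)
    (hA1 : μ {x | τ x = 0} = 0 ∧ μ {x | τ x = ⊤} = 0) {ν : Measure X} [IsFiniteMeasure ν]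
    (hν1 : ν univ ≤ 1) (hν : ν ≪ μ) {b : ℝ≥0}
    (hb : invTimeIntegral τ ν < ⊤ →
      (b : ℝ≥0∞) ≤ invTimeIntegral τ ν * InformationTheory.klDiv (barMeasure τ ν) μ)
    {ε : ℝ} (hε : 0 < ε) :
    ∃ g : X → ℝ, Measurable g ∧ (∃ L : ℝ, ∀ x, |g x| ≤ L) ∧
      ∫⁻ y, ENNReal.ofReal (Real.exp (g y * realTime τ y)) ∂μ < 1 ∧ b - ε ≤ ∫ y, g y ∂ν := by
  by_cases htop : invTimeIntegral τ ν = ⊤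
  · exact exists_testFunction_of_invTimeIntegral_eq_top hτ hA1 hν1 hν htop _
  by_cases h0 : invTimeIntegral τ ν = 0
  · -- Here `ν = 0` because `τ` is finite almost everywhere.
    have hb0 : (b : ℝ≥0∞) ≤ 0 := by simpa [h0] using hb (lt_top_iff_ne_top.2 htop)
    have hb0' : b = 0 := by simpa using hb0
    refine ⟨fun _ ↦ -1, measurable_const, ⟨1, fun _ ↦ by simp⟩,
      lintegral_exp_neg_mul_lt_one hτ hA1 one_pos, ?_⟩
    have hν0 : ν = 0 := by
      have h1 : ∀ᵐ y ∂ν, (τ y)⁻¹ = 0 := (lintegral_eq_zero_iff hτ.inv).1 h0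
      have h2 : ∀ᵐ y ∂ν, τ y ≠ ⊤ :=
        ((ae_realTime_pos hA1).mono fun _ h ↦ h.1).filter_mono hν.ae_le
      rw [← ae_eq_bot, ← Filter.eventually_false_iff_eq_bot]
      filter_upwards [h1, h2] with y hy1 hy2
      exact hy2 (ENNReal.inv_eq_zero.1 hy1)
    simp [hν0, hb0', hε.le]
  · exact exists_testFunction_of_invTimeIntegral_ne_top hτ hA1 hν h0 htop
      (hb (lt_top_iff_ne_top.2 htop)) hε

variable {X : Type*} [MetricSpace X] [MeasurableSpace X] {μ : Measure X} {τ : X → ℝ≥0∞}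

/-- The test function for the singular part is `min ξ n - ε/2`. The strict inequality `g < ξ` where
`g ≥ 0` makes `e^{g(x) τ}` integrable near `x`. -/
theorem exists_testFunction_singular [BorelSpace X] {ν : Measure X} [IsFiniteMeasure ν]
    (hν1 : ν univ ≤ 1) {b : ℝ≥0} (hb : (b : ℝ≥0∞) ≤ ∫⁻ x, xi μ τ x ∂ν) {ε : ℝ} (hε : 0 < ε) :
    ∃ g : X → ℝ, Measurable g ∧ (∃ L : ℝ, ∀ x, |g x| ≤ L) ∧
      (∀ x, g x < 0 ∨ ENNReal.ofReal (g x) < xi μ τ x) ∧ b - ε ≤ ∫ y, g y ∂ν := by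
  have hξ : Measurable (xi μ τ) := (lowerSemicontinuous_xi μ τ).measurable
  have hmin : ∀ n : ℕ, Measurable fun x ↦ min (xi μ τ x) n := fun n ↦ hξ.min measurable_const
  obtain ⟨n, hn⟩ : ∃ n : ℕ, ENNReal.ofReal (b - ε / 2) ≤ ∫⁻ x, min (xi μ τ x) n ∂ν := by
    rcases le_or_gt ((b : ℝ) - ε / 2) 0 with h | h
    · exact ⟨0, by rw [ENNReal.ofReal_of_nonpos h]; exact zero_le⟩
    have hsup : ∫⁻ x, xi μ τ x ∂ν = ⨆ n : ℕ, ∫⁻ x, min (xi μ τ x) n ∂ν := by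
      rw [← lintegral_iSup hmin fun i j hij x ↦ min_le_min le_rfl (by exact_mod_cast hij)]
      congr with x
      have h : xi μ τ x ⊓ ⨆ n : ℕ, (n : ℝ≥0∞) = xi μ τ x := by
        rw [ENNReal.iSup_natCast, inf_top_eq]
      exact h.symm.trans (inf_iSup_eq _ _)
    have hlt : ENNReal.ofReal (b - ε / 2) < ∫⁻ x, xi μ τ x ∂ν := by
      refine lt_of_lt_of_le ?_ hb
      rw [← ENNReal.ofReal_coe_nnreal]
      exact (ENNReal.ofReal_lt_ofReal_iff (by linarith)).2 (by linarith)
    rw [hsup] at hlt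
    obtain ⟨n, hn⟩ := lt_iSup_iff.1 hlt
    exact ⟨n, hn.le⟩
  have hfin : ∀ x, min (xi μ τ x) n ≠ ⊤ := fun x ↦
    ne_top_of_le_ne_top (ENNReal.natCast_ne_top n) (min_le_right _ _)
  have hbd : ∀ x, (min (xi μ τ x) n).toReal ≤ n := fun x ↦ by
    simpa using ENNReal.toReal_mono (ENNReal.natCast_ne_top n) (min_le_right (xi μ τ x) n)
  refine ⟨fun x ↦ (min (xi μ τ x) n).toReal - ε / 2, (hmin n).ennreal_toReal.sub_const _,
    ⟨n + ε / 2, fun x ↦ ?_⟩, fun x ↦ ?_, ?_⟩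
  · have h1 := hbd x
    have h2 : 0 ≤ (min (xi μ τ x) n).toReal := ENNReal.toReal_nonneg
    rw [abs_le]
    constructor <;> linarith [Nat.cast_nonneg (α := ℝ) n]
  · rcases lt_or_ge ((min (xi μ τ x) n).toReal - ε / 2) 0 with h | h
    · exact Or.inl h
    · refine Or.inr (lt_of_lt_of_le ?_ (min_le_left _ (n : ℝ≥0∞)))
      rw [ENNReal.ofReal_lt_iff_lt_toReal h (hfin x)]
      linarith
  · have hi : Integrable (fun x ↦ (min (xi μ τ x) n).toReal) ν :=
      Integrable.of_bound (hmin n).ennreal_toReal.aestronglyMeasurable n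
        (Eventually.of_forall fun x ↦ by
          rw [Real.norm_eq_abs, abs_of_nonneg ENNReal.toReal_nonneg]; exact hbd x)
    rw [integral_sub hi (integrable_const _), integral_toReal (hmin n).aemeasurable
      (Eventually.of_forall fun x ↦ lt_top_iff_ne_top.2 (hfin x))]
    have hν1' : ν.real univ ≤ 1 := ENNReal.toReal_le_of_le_ofReal zero_le_one (by simpa using hν1)
    have h1 : ∫ _, ε / 2 ∂ν ≤ ε / 2 := by
      rw [integral_const, smul_eq_mul]
      nlinarith
    have hne : ∫⁻ x, min (xi μ τ x) n ∂ν ≠ ⊤ := by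
      have := hi.lintegral_lt_top.ne
      simpa only [ENNReal.ofReal_toReal (hfin _)] using this
    have := (ENNReal.ofReal_le_iff_le_toReal hne).1 hn
    linarith

/-- The lower half of the variational formula: the rate functional is at most the supremum of
`ν(f)` over `f ∈ C_b(X)` with `μ(e^{τ f}) < 1`. -/
theorem exists_boundedContinuous_of_lt_rate [PolishSpace X] [BorelSpace X]
    [IsProbabilityMeasure μ] (hτ : Measurable τ)
    (hA1 : μ {x | τ x = 0} = 0 ∧ μ {x | τ x = ⊤} = 0) (hA2 : μ {x | xi μ τ x < ⊤} = 0)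
    (ν : ProbabilityMeasure X) {a : ℝ} (ha : (a : EReal) < (rate μ τ ν : ℝ≥0∞)) :
    ∃ f : X →ᵇ ℝ, ∫⁻ y, ENNReal.ofReal (Real.exp (f y * realTime τ y)) ∂μ < 1 ∧
      a < ∫ y, f y ∂(ν : Measure X) := by
  set lam := acPart μ (ν : Measure X) with hlam
  set σ := (ν : Measure X).singularPart μ with hσ
  have hdecomp : (ν : Measure X) = σ + lam := (ν : Measure X).haveLebesgueDecomposition_add μ
  have hlam1 : lam univ ≤ 1 := by
    rw [← measure_univ (μ := (ν : Measure X)), hdecomp]; exact Measure.le_add_left le_rfl univ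
  have hσ1 : σ univ ≤ 1 := by
    rw [← measure_univ (μ := (ν : Measure X)), hdecomp]; exact Measure.le_add_right le_rfl univ
  have : IsFiniteMeasure lam := ⟨hlam1.trans_lt ENNReal.one_lt_top⟩
  have : IsFiniteMeasure σ := ⟨hσ1.trans_lt ENNReal.one_lt_top⟩
  have hlamμ : lam ≪ μ := withDensity_absolutelyContinuous _ _
  -- Split the level `a` between the absolutely continuous and the singular part.
  obtain ⟨b₁, b₂, hb₁, hb₂, hab⟩ : ∃ b₁ b₂ : ℝ≥0,
      (invTimeIntegral τ lam < ⊤ → (b₁ : ℝ≥0∞) ≤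
        invTimeIntegral τ lam * InformationTheory.klDiv (barMeasure τ lam) μ) ∧
      (b₂ : ℝ≥0∞) ≤ ∫⁻ x, xi μ τ x ∂σ ∧ a < b₁ + b₂ := by
    have hself : a < a.toNNReal + 1 := (Real.le_coe_toNNReal a).trans_lt (lt_add_one _)
    by_cases hm : invTimeIntegral τ lam < ⊤
    · rw [rate, if_pos hm] at ha
      set u := invTimeIntegral τ lam * InformationTheory.klDiv (barMeasure τ lam) μ
      set v := ∫⁻ x, xi μ τ x ∂σ
      by_cases hu : u = ⊤
      · exact ⟨a.toNNReal + 1, 0, fun _ ↦ by rw [hu]; exact le_top, by simp, by simpa using hself⟩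
      by_cases hv : v = ⊤
      · exact ⟨0, a.toNNReal + 1, fun _ ↦ by simp, by rw [hv]; exact le_top, by simpa using hself⟩
      refine ⟨u.toNNReal, v.toNNReal, fun _ ↦ (ENNReal.coe_toNNReal hu).le,
        (ENNReal.coe_toNNReal hv).le, ?_⟩
      rw [← ENNReal.coe_toNNReal hu, ← ENNReal.coe_toNNReal hv, ← ENNReal.coe_add,
        EReal.coe_nnreal_eq_coe_real] at ha
      exact_mod_cast EReal.coe_lt_coe_iff.1 ha
    · exact ⟨a.toNNReal + 1, 0, fun h ↦ absurd h hm, by simp, by simpa using hself⟩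
  set ε : ℝ := (b₁ + b₂ - a) / 3 with hε
  have hε0 : 0 < ε := by rw [hε]; linarith
  obtain ⟨g₁, hg₁m, ⟨L₁, hL₁⟩, hg₁, hg₁int⟩ :=
    exists_testFunction_absolutelyContinuous hτ hA1 hlam1 hlamμ hb₁ hε0
  obtain ⟨g₂, hg₂m, ⟨L₂, hL₂⟩, hg₂, hg₂int⟩ :=
    exists_testFunction_singular (μ := μ) (τ := τ) hσ1 hb₂ hε0
  -- Glue the two along a `μ`-null set carrying the singular part.
  obtain ⟨s, hsm, hσs, hμs⟩ := (ν : Measure X).mutuallySingular_singularPart μ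
  classical
  set g : X → ℝ := s.piecewise g₁ g₂ with hg
  have hgm : Measurable g := hg₁m.piecewise hsm hg₂m
  have hsμ : ∀ᵐ y ∂μ, y ∈ s := hμs
  have hsσ : ∀ᵐ y ∂σ, y ∉ s := by rw [ae_iff]; simpa using hσs
  have hgμ : g =ᵐ[μ] g₁ := hsμ.mono fun y hy ↦ piecewise_eq_of_mem _ _ _ hy
  have hglam : g =ᵐ[lam] g₁ := hgμ.filter_mono hlamμ.ae_le
  have hgσ : g =ᵐ[σ] g₂ := hsσ.mono fun y hy ↦ piecewise_eq_of_notMem _ _ _ hy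
  obtain ⟨L, hL⟩ := exists_nat_ge (max L₁ L₂)
  have hgL : ∀ x, |g x| ≤ L := fun x ↦ by
    by_cases hx : x ∈ s
    · rw [hg, piecewise_eq_of_mem _ _ _ hx]; exact (hL₁ x).trans ((le_max_left _ _).trans hL)
    · rw [hg, piecewise_eq_of_notMem _ _ _ hx]; exact (hL₂ x).trans ((le_max_right _ _).trans hL)
  have hgi : ∀ κ : Measure X, IsFiniteMeasure κ → Integrable g κ := fun κ _ ↦
    Integrable.of_bound hgm.aestronglyMeasurable L (Eventually.of_forall hgL)
  refine exists_boundedContinuous_of_measurable hτ hgm hgL ?_ ?_ ?_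
  · rw [hdecomp, ae_add_measure_iff]
    constructor
    · filter_upwards [hsσ] with x hx
      rw [hg, piecewise_eq_of_notMem _ _ _ hx]
      rcases hg₂ x with h | h
      · refine ⟨1, one_pos, lt_of_le_of_lt (lintegral_mono (g := fun _ ↦ 1) fun y ↦ ?_) ?_⟩
        · rw [← ENNReal.ofReal_one]
          refine ENNReal.ofReal_le_ofReal (Real.exp_le_one_iff.2 ?_)
          exact mul_nonpos_of_nonpos_of_nonneg h.le (realTime_nonneg _ _)
        · simp
      · exact exists_ball_lintegral_exp_lt_top hA1 h
    · have hξ : ∀ᵐ x ∂μ, xi μ τ x = ⊤ := by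
        rw [ae_iff]
        simpa [lt_top_iff_ne_top] using hA2
      filter_upwards [hξ.filter_mono hlamμ.ae_le] with x hx
      exact exists_ball_lintegral_exp_lt_top hA1 (hx ▸ ENNReal.ofReal_lt_top)
  · rw [lintegral_congr_ae (hgμ.mono fun y hy ↦ by simp only [hy]) (g := fun y ↦
      ENNReal.ofReal (Real.exp (g₁ y * realTime τ y)))]
    exact hg₁
  · rw [hdecomp, integral_add_measure (hgi σ inferInstance) (hgi lam inferInstance),
      integral_congr_ae hgσ, integral_congr_ae hglam]
    linarith

end Duality

/-! ### The cone of accessible pairs of sums and costs -/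

section Sums

variable {X : Type*} [MeasurableSpace X] {E : Type*} [NormedAddCommGroup E] [MeasurableSpace E]
  [BorelSpace E] [SecondCountableTopology E] {Z : X → E}

theorem measurable_sum_range (hZ : Measurable Z) (n : ℕ) :
    Measurable fun x : ℕ → X ↦ ∑ l ∈ Finset.range n, Z (x l) :=
  Finset.measurable_sum _ fun l _ ↦ hZ.comp (measurable_pi_apply l)

/-- Two consecutive blocks of the sequence are independent, and the second one is distributed
like an initial block. -/
theorem measure_inter_sum_shift {μ : Measure X} [IsProbabilityMeasure μ] (hZ : Measurable Z)
    (m n : ℕ) {A B : Set E} (hA : MeasurableSet A)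
    (hB : MeasurableSet B) :
    (Measure.infinitePi fun _ : ℕ ↦ μ) {x | ∑ l ∈ Finset.range m, Z (x l) ∈ A ∧
        ∑ l ∈ Finset.range n, Z (x (m + l)) ∈ B} =
      (Measure.infinitePi fun _ : ℕ ↦ μ) {x | ∑ l ∈ Finset.range m, Z (x l) ∈ A} *
      (Measure.infinitePi fun _ : ℕ ↦ μ) {x | ∑ l ∈ Finset.range n, Z (x l) ∈ B} := by
  set P := Measure.infinitePi fun _ : ℕ ↦ μ
  set S := Finset.range m
  set T := (Finset.range n).map (addLeftEmbedding m)
  have hdisj : Disjoint S T := by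
    refine Finset.disjoint_left.2 fun i hi hi' ↦ ?_
    obtain ⟨l, -, rfl⟩ := Finset.mem_map.1 hi'
    exact absurd (Finset.mem_range.1 hi) (by simp)
  have hind := (iIndepFun_infinitePi (P := fun _ : ℕ ↦ μ) (X := fun _ ↦ Z)
    fun _ ↦ hZ).indepFun_finset S T hdisj fun i ↦ hZ.comp (measurable_pi_apply i)
  have hsum : ∀ U : Finset ℕ, Measurable fun w : U → E ↦ ∑ i, w i := fun U ↦
    Finset.measurable_sum _ fun i _ ↦ measurable_pi_apply i
  have hind' := hind.comp (hsum S) (hsum T)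
  have h := hind'.measure_inter_preimage_eq_mul A B hA hB
  have hSsum : ∀ x : ℕ → X, ∑ i : S, Z (x i) = ∑ l ∈ Finset.range m, Z (x l) := fun x ↦
    Finset.sum_coe_sort S fun i ↦ Z (x i)
  have hTsum : ∀ x : ℕ → X, ∑ i : T, Z (x i) = ∑ l ∈ Finset.range n, Z (x (m + l)) := fun x ↦ by
    rw [Finset.sum_coe_sort T fun i ↦ Z (x i), Finset.sum_map]
    rfl
  have hshift : P {x | ∑ l ∈ Finset.range n, Z (x (m + l)) ∈ B} =
      P {x | ∑ l ∈ Finset.range n, Z (x l) ∈ B} := by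
    have hmap := Measure.map_infinitePi_infinitePi_of_inj (P := fun _ : ℕ ↦ μ)
      (f := fun l : ℕ ↦ m + l) (add_right_injective m)
    conv_rhs => rw [show P = Measure.map (fun ω i ↦ ω (m + i)) P from hmap.symm]
    rw [Measure.map_apply (measurable_pi_lambda _ fun i ↦ measurable_pi_apply (m + i))
      (measurable_sum_range hZ n hB)]
    rfl
  simp only [Function.comp_def, preimage, hSsum, hTsum] at h
  rw [← hshift]
  exact h

end Sums

section Accessible

variable {X : Type*} [MeasurableSpace X] {μ : Measure X} [IsProbabilityMeasure μ]
  {E : Type*} [NormedAddCommGroup E] [NormedSpace ℝ E]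

/-- A pair `(v, h)` is accessible if for large `t` some partial sum of the i.i.d. sequence `Z(x_l)`
is close to `t v`, to first order in `t`, with probability at least `e^{-t h}`, to first order in
the exponent. The number of summands is left free. -/
def Accessible (μ : Measure X) [IsProbabilityMeasure μ] (Z : X → E) (p : E × ℝ) : Prop :=
  ∀ ε > 0, ∀ᶠ t : ℝ in atTop, ∃ n : ℕ, ENNReal.ofReal (Real.exp (-(t * (p.2 + ε)))) ≤
    (Measure.infinitePi fun _ : ℕ ↦ μ)
      {x | ‖∑ l ∈ Finset.range n, Z (x l) - t • p.1‖ ≤ ε * t}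

variable {Z : X → E}

theorem accessible_zero : Accessible μ Z (0 : E × ℝ) := by
  intro ε hε
  filter_upwards [eventually_ge_atTop 0] with t ht
  refine ⟨0, ?_⟩
  have : {x : ℕ → X | ‖∑ l ∈ Finset.range 0, Z (x l) - t • (0 : E × ℝ).1‖ ≤ ε * t} = univ := by
    ext x; simp [mul_nonneg hε.le ht]
  rw [this, measure_univ, ← ENNReal.ofReal_one]
  refine ENNReal.ofReal_le_ofReal (Real.exp_le_one_iff.2 ?_)
  simp only [Prod.snd_zero, zero_add]
  nlinarith

theorem Accessible.smul {p : E × ℝ} (hp : Accessible μ Z p) {c : ℝ} (hc : 0 ≤ c) :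
    Accessible μ Z (c • p) := by
  rcases hc.eq_or_lt with rfl | hc
  · rw [zero_smul]; exact accessible_zero
  intro ε hε
  have := (tendsto_id.const_mul_atTop hc).eventually (hp (ε / c) (by positivity))
  filter_upwards [this] with t ⟨n, hn⟩
  refine ⟨n, ?_⟩
  have h1 : c * t * (p.2 + ε / c) = t * ((c • p).2 + ε) := by
    simp only [Prod.smul_snd, smul_eq_mul]; field_simp
  have h2 : ε / c * (c * t) = ε * t := by field_simp
  have h3 : (c * t) • p.1 = t • (c • p).1 := by rw [Prod.smul_fst, smul_smul, mul_comm]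
  simpa only [id, h1, h2, h3] using hn

theorem isClosed_accessible : IsClosed {p : E × ℝ | Accessible μ Z p} := by
  refine isClosed_of_closure_subset fun p hp ε hε ↦ ?_
  obtain ⟨q, hq, hpq⟩ := Metric.mem_closure_iff.1 hp (ε / 2) (by positivity)
  have h1 : ‖p.1 - q.1‖ ≤ ε / 2 := by
    rw [← dist_eq_norm]; exact (le_max_left _ _).trans hpq.le
  have h2 : |p.2 - q.2| ≤ ε / 2 := by
    rw [← Real.dist_eq]; exact (le_max_right _ _).trans hpq.le
  filter_upwards [hq (ε / 2) (by positivity), eventually_ge_atTop 0] with t ⟨n, hn⟩ ht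
  refine ⟨n, le_trans (ENNReal.ofReal_le_ofReal (Real.exp_le_exp.2 ?_))
    (hn.trans (measure_mono fun x hx ↦ ?_))⟩
  · rw [neg_le_neg_iff]
    exact mul_le_mul_of_nonneg_left (by linarith [abs_le.1 h2]) ht
  · have h3 : ‖t • p.1 - t • q.1‖ ≤ t * (ε / 2) := by
      rw [← smul_sub, norm_smul, Real.norm_eq_abs, abs_of_nonneg ht]
      exact mul_le_mul_of_nonneg_left h1 ht
    have h4 : ‖∑ l ∈ Finset.range n, Z (x l) - t • q.1‖ ≤ ε / 2 * t := hx
    calc ‖∑ l ∈ Finset.range n, Z (x l) - t • p.1‖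
        = ‖(∑ l ∈ Finset.range n, Z (x l) - t • q.1) - (t • p.1 - t • q.1)‖ := by congr 1; abel
      _ ≤ _ := norm_sub_le _ _
      _ ≤ ε * t := by linarith

variable [MeasurableSpace E] [BorelSpace E] [SecondCountableTopology E]

theorem Accessible.add (hZ : Measurable Z) {p q : E × ℝ} (hp : Accessible μ Z p)
    (hq : Accessible μ Z q) : Accessible μ Z (p + q) := by
  intro ε hε
  filter_upwards [hp (ε / 2) (by positivity), hq (ε / 2) (by positivity)] with t ⟨m, hm⟩ ⟨n, hn⟩
  refine ⟨m + n, ?_⟩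
  have hcl : ∀ v : E, MeasurableSet {w : E | ‖w - t • v‖ ≤ ε / 2 * t} := fun v ↦
    (isClosed_le (continuous_id.sub continuous_const).norm continuous_const).measurableSet
  have hprod := measure_inter_sum_shift (μ := μ) hZ m n (hcl p.1) (hcl q.1)
  calc ENNReal.ofReal (Real.exp (-(t * ((p + q).2 + ε))))
      = ENNReal.ofReal (Real.exp (-(t * (p.2 + ε / 2)))) *
          ENNReal.ofReal (Real.exp (-(t * (q.2 + ε / 2)))) := by
        rw [← ENNReal.ofReal_mul (Real.exp_pos _).le, ← Real.exp_add, Prod.snd_add]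
        congr 2; ring
    _ ≤ _ := mul_le_mul' hm hn
    _ = _ := hprod.symm
    _ ≤ _ := by
        refine measure_mono fun x hx ↦ ?_
        have h1 : ‖∑ l ∈ Finset.range m, Z (x l) - t • p.1‖ ≤ ε / 2 * t := hx.1
        have h2 : ‖∑ l ∈ Finset.range n, Z (x (m + l)) - t • q.1‖ ≤ ε / 2 * t := hx.2
        simp only [mem_ofPred_eq, Finset.sum_range_add, Prod.fst_add, smul_add]
        calc _ = ‖(∑ l ∈ Finset.range m, Z (x l) - t • p.1) +
              (∑ l ∈ Finset.range n, Z (x (m + l)) - t • q.1)‖ := by congr 1; abel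
          _ ≤ _ := norm_add_le _ _
          _ ≤ ε * t := by linarith

theorem convex_accessible (hZ : Measurable Z) : Convex ℝ {p : E × ℝ | Accessible μ Z p} :=
  fun _ hp _ hq _ _ ha hb _ ↦ (hp.smul ha).add hZ (hq.smul hb)

/-- Integrals of accessible pairs are accessible, the accessible pairs forming a closed convex
cone. -/
theorem accessible_integral [CompleteSpace E] (hZ : Measurable Z) {Y : Type*} [MeasurableSpace Y]
    {κ : Measure Y}
    [IsFiniteMeasure κ] {f : Y → E × ℝ} (hf : Integrable f κ)
    (h : ∀ᵐ y ∂κ, Accessible μ Z (f y)) : Accessible μ Z (∫ y, f y ∂κ) := by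
  rcases eq_zero_or_neZero κ with rfl | hκ
  · rw [integral_zero_measure]; exact accessible_zero
  have h1 : Accessible μ Z (⨍ y, f y ∂κ) :=
    (convex_accessible hZ).average_mem isClosed_accessible h hf
  have h2 := h1.smul (c := κ.real univ) measureReal_nonneg
  rwa [measure_smul_average] at h2

/-! ### Tilting by a measure of finite relative entropy -/

theorem pi_withDensity {D : X → ℝ≥0∞} (hD : Measurable D)
    [IsProbabilityMeasure (μ.withDensity D)] (n : ℕ) :
    Measure.pi (fun _ : Fin n ↦ μ.withDensity D) =
      (Measure.pi fun _ : Fin n ↦ μ).withDensity fun y ↦ ∏ i, D (y i) := by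
  refine Measure.pi_eq fun s hs ↦ ?_
  rw [withDensity_apply _ (MeasurableSet.univ_pi hs),
    ← lintegral_indicator (MeasurableSet.univ_pi hs)]
  have hind : ∀ y : Fin n → X, (univ.pi s).indicator (fun y ↦ ∏ i, D (y i)) y =
      ∏ i, (s i).indicator D (y i) := fun y ↦ by
    by_cases hy : y ∈ univ.pi s
    · rw [indicator_of_mem hy]
      exact Finset.prod_congr rfl fun i _ ↦ (indicator_of_mem (hy i (mem_univ i)) D).symm
    · rw [indicator_of_notMem hy]
      simp only [mem_univ_pi, not_forall] at hy
      obtain ⟨i, hi⟩ := hy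
      exact (Finset.prod_eq_zero (Finset.mem_univ i) (indicator_of_notMem hi D)).symm
  simp_rw [hind]
  have hm : ∀ i, Measurable ((s i).indicator D) := fun i ↦ hD.indicator (hs i)
  rw [lintegral_prod_eq_prod_lintegral_of_indepFun Finset.univ
    (fun i (y : Fin n → X) ↦ (s i).indicator D (y i))
    (iIndepFun_pi fun i ↦ (hm i).aemeasurable) fun i ↦ (hm i).comp (measurable_pi_apply i)]
  refine Finset.prod_congr rfl fun i _ ↦ ?_
  rw [withDensity_apply _ (hs i), ← lintegral_indicator (hs i)]
  exact (measurePreserving_eval (fun _ : Fin n ↦ μ) i).lintegral_comp (hm i)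

theorem infinitePi_initial_segment (n : ℕ) {s : Set (Fin n → X)} (hs : MeasurableSet s) :
    (Measure.infinitePi fun _ : ℕ ↦ μ) {x | (fun i : Fin n ↦ x i) ∈ s} =
      Measure.pi (fun _ : Fin n ↦ μ) s := by
  rw [← Measure.infinitePi_eq_pi, ← Measure.map_infinitePi_infinitePi_of_inj
    (P := fun _ : ℕ ↦ μ) (f := fun i : Fin n ↦ (i : ℕ)) Fin.val_injective]
  exact (Measure.map_apply (f := fun (ω : ℕ → X) (i : Fin n) ↦ ω i)
    (measurable_pi_lambda _ fun i ↦ measurable_pi_apply (i : ℕ)) hs).symm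

/-- Change of measure on the event that the log-likelihood ratio is at most `c`. -/
theorem infinitePi_le_exp_mul {ρ : Measure X} [IsProbabilityMeasure ρ] (hρ : ρ ≪ μ) {n : ℕ}
    {s : Set (Fin n → X)} (hs : MeasurableSet s) {c : ℝ}
    (hc : ∀ y ∈ s, ∑ i, llr ρ μ (y i) ≤ c) :
    (Measure.infinitePi fun _ : ℕ ↦ ρ) {x | (fun i : Fin n ↦ x i) ∈ s} ≤
      ENNReal.ofReal (Real.exp c) *
        (Measure.infinitePi fun _ : ℕ ↦ μ) {x | (fun i : Fin n ↦ x i) ∈ s} := by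
  rw [infinitePi_initial_segment n hs, infinitePi_initial_segment n hs]
  set D : X → ℝ≥0∞ := fun y ↦ ENNReal.ofReal (ρ.rnDeriv μ y).toReal
  have hD : Measurable D := (Measure.measurable_rnDeriv ρ μ).ennreal_toReal.ennreal_ofReal
  have hρD : μ.withDensity D = ρ := by
    rw [← Measure.withDensity_rnDeriv_eq ρ μ hρ]
    refine withDensity_congr_ae ?_
    filter_upwards [Measure.rnDeriv_lt_top ρ μ] with y hy
    simp only [D, ENNReal.ofReal_toReal hy.ne]
  have : IsProbabilityMeasure (μ.withDensity D) := by rw [hρD]; infer_instance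
  have hpi : Measure.pi (fun _ : Fin n ↦ ρ) =
      (Measure.pi fun _ : Fin n ↦ μ).withDensity fun y ↦ ∏ i, D (y i) := by
    rw [← pi_withDensity hD, hρD]
  rw [hpi, withDensity_apply _ hs]
  calc ∫⁻ y in s, ∏ i, D (y i) ∂(Measure.pi fun _ : Fin n ↦ μ)
      ≤ ∫⁻ _ in s, ENNReal.ofReal (Real.exp c) ∂(Measure.pi fun _ : Fin n ↦ μ) := by
        refine setLIntegral_mono' hs fun y hy ↦ ?_
        calc ∏ i, D (y i) ≤ ∏ i, ENNReal.ofReal (Real.exp (llr ρ μ (y i))) :=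
              Finset.prod_le_prod' fun i _ ↦ ENNReal.ofReal_le_ofReal (Real.le_exp_log _)
          _ = ENNReal.ofReal (Real.exp (∑ i, llr ρ μ (y i))) := by
              rw [Real.exp_sum, ENNReal.ofReal_prod_of_nonneg fun _ _ ↦ (Real.exp_pos _).le]
          _ ≤ _ := ENNReal.ofReal_le_ofReal (Real.exp_le_exp.2 (hc y hy))
    _ = _ := setLIntegral_const _ _

/-- By the law of large numbers under the tilted law `ρ`, the mean of `Z` under `ρ` is accessible
at the cost `H(ρ | μ)`. -/
theorem accessible_of_klDiv_ne_top [CompleteSpace E] (hZ : Measurable Z) {ρ : Measure X}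
    [IsProbabilityMeasure ρ] (hZρ : Integrable Z ρ) (hkl : InformationTheory.klDiv ρ μ ≠ ⊤) :
    Accessible μ Z (∫ y, Z y ∂ρ, (InformationTheory.klDiv ρ μ).toReal) := by
  obtain ⟨hρμ, hllr⟩ := InformationTheory.klDiv_ne_top_iff.1 hkl
  set v := ∫ y, Z y ∂ρ
  set H := (InformationTheory.klDiv ρ μ).toReal with hHdef
  have hH : H = ∫ y, llr ρ μ y ∂ρ :=
    InformationTheory.toReal_klDiv_of_measure_eq hρμ (by simp)
  have hH0 : 0 ≤ H := ENNReal.toReal_nonneg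
  intro ε hε
  set P := Measure.infinitePi fun _ : ℕ ↦ μ
  set Pρ := Measure.infinitePi fun _ : ℕ ↦ ρ
  set W : X → E × ℝ := fun y ↦ (Z y, llr ρ μ y)
  have hW : Measurable W := hZ.prodMk (measurable_llr ρ μ)
  have hWi : Integrable W ρ := hZρ.prodMk hllr
  have hWint : ∫ y, W y ∂ρ = (v, H) := by rw [hH]; exact integral_pair hZρ hllr
  have hlln := ae_tendsto_average_infinitePi hW hWi
  rw [hWint] at hlln
  have hmeas := tendstoInMeasure_of_tendsto_ae (μ := Pρ) (g := fun _ ↦ (v, H)) (fun n ↦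
    ((measurable_sum_range hW n).const_smul (n : ℝ)⁻¹).aestronglyMeasurable) hlln
  have hev : ∀ᶠ n : ℕ in atTop, Pρ {x | ENNReal.ofReal (ε / 2) ≤
      edist ((n : ℝ)⁻¹ • ∑ i ∈ Finset.range n, W (x i)) (v, H)} < 1 / 2 :=
    (hmeas _ (ENNReal.ofReal_pos.2 (half_pos hε))).eventually (gt_mem_nhds (by simp))
  have hfloor := (tendsto_nat_floor_atTop (α := ℝ)).eventually (hev.and (eventually_gt_atTop 0))
  filter_upwards [hfloor, eventually_ge_atTop 0, eventually_ge_atTop (2 * ‖v‖ / ε),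
    eventually_ge_atTop (2 * Real.log 2 / ε)] with t ⟨hn, hn0⟩ ht0 htv htl
  set n := ⌊t⌋₊
  refine ⟨n, ?_⟩
  have hn0' : (0 : ℝ) < n := by exact_mod_cast hn0
  have hnt : (n : ℝ) ≤ t := Nat.floor_le ht0
  have htn : t - n ≤ 1 := by linarith [Nat.lt_floor_add_one t]
  set s : Set (Fin n → X) :=
    {y | ‖(n : ℝ)⁻¹ • ∑ i, Z (y i) - v‖ ≤ ε / 2 ∧ ∑ i, llr ρ μ (y i) ≤ n * (H + ε / 2)}
  have hs : MeasurableSet s := by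
    have h1 : Measurable fun y : Fin n → X ↦ ‖(n : ℝ)⁻¹ • ∑ i, Z (y i) - v‖ :=
      (((Finset.measurable_sum _ fun i _ ↦
        hZ.comp (measurable_pi_apply i)).const_smul (n : ℝ)⁻¹).sub_const v).norm
    have h2 : Measurable fun y : Fin n → X ↦ ∑ i, llr ρ μ (y i) :=
      Finset.measurable_sum _ fun i _ ↦ (measurable_llr ρ μ).comp (measurable_pi_apply i)
    exact (measurableSet_le h1 measurable_const).inter (measurableSet_le h2 measurable_const)
  have hhalf : 1 / 2 ≤ Pρ {x | (fun i : Fin n ↦ x i) ∈ s} := by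
    have hcompl : {x : ℕ → X | (fun i : Fin n ↦ x i) ∈ s}ᶜ ⊆ {x | ENNReal.ofReal (ε / 2) ≤
        edist ((n : ℝ)⁻¹ • ∑ i ∈ Finset.range n, W (x i)) (v, H)} := by
      intro x hx
      by_contra hlt
      refine hx ?_
      simp only [mem_ofPred_eq, not_le] at hlt
      rw [edist_dist, ENNReal.ofReal_lt_ofReal_iff (half_pos hε), Prod.dist_eq, max_lt_iff] at hlt
      have h1 := hlt.1
      have h2 := hlt.2
      rw [dist_eq_norm, Prod.smul_fst, Prod.fst_sum] at h1
      rw [Real.dist_eq, Prod.smul_snd, Prod.snd_sum, smul_eq_mul] at h2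
      refine ⟨?_, ?_⟩
      · rw [Fin.sum_univ_eq_sum_range (fun i ↦ Z (x i)) n]
        exact h1.le
      · rw [Fin.sum_univ_eq_sum_range (fun i ↦ llr ρ μ (x i)) n]
        have h3 := (abs_lt.1 h2).2
        have h4 : (n : ℝ)⁻¹ * ∑ i ∈ Finset.range n, llr ρ μ (x i) ≤ H + ε / 2 := by
          change (n : ℝ)⁻¹ * ∑ i ∈ Finset.range n, (W (x i)).2 ≤ H + ε / 2
          linarith
        rwa [inv_mul_le_iff₀ hn0'] at h4
    have hsm : MeasurableSet {x : ℕ → X | (fun i : Fin n ↦ x i) ∈ s} :=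
      (measurable_pi_lambda _ fun i : Fin n ↦ measurable_pi_apply (i : ℕ)) hs
    have h1 : Pρ {x | (fun i : Fin n ↦ x i) ∈ s}ᶜ ≤ 1 / 2 := (measure_mono hcompl).trans hn.le
    by_contra! hlt
    have h2 : Pρ {x | (fun i : Fin n ↦ x i) ∈ s} + Pρ {x | (fun i : Fin n ↦ x i) ∈ s}ᶜ <
        1 / 2 + 1 / 2 := ENNReal.add_lt_add_of_lt_of_le (by simp) hlt h1
    rw [measure_add_measure_compl hsm, measure_univ, ENNReal.add_halves] at h2
    exact lt_irrefl _ h2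
  have hchange := hhalf.trans (infinitePi_le_exp_mul hρμ hs fun y hy ↦ hy.2)
  calc ENNReal.ofReal (Real.exp (-(t * (H + ε))))
      ≤ ENNReal.ofReal (Real.exp (-(n * (H + ε / 2)))) * (1 / 2) := by
        have h2 : (1 / 2 : ℝ≥0∞) = ENNReal.ofReal (Real.exp (-Real.log 2)) := by
          rw [Real.exp_neg, Real.exp_log two_pos, ENNReal.ofReal_inv_of_pos two_pos]
          simp
        rw [h2, ← ENNReal.ofReal_mul (Real.exp_pos _).le, ← Real.exp_add]
        refine ENNReal.ofReal_le_ofReal (Real.exp_le_exp.2 ?_)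
        rw [div_le_iff₀ hε] at htl
        nlinarith
    _ ≤ ENNReal.ofReal (Real.exp (-(n * (H + ε / 2)))) *
          (ENNReal.ofReal (Real.exp (n * (H + ε / 2))) *
            P {x | (fun i : Fin n ↦ x i) ∈ s}) := by gcongr
    _ = P {x | (fun i : Fin n ↦ x i) ∈ s} := by
        rw [← mul_assoc, ← ENNReal.ofReal_mul (Real.exp_pos _).le, ← Real.exp_add]
        simp
    _ ≤ _ := by
        refine measure_mono fun x hx ↦ ?_
        have h1 : ‖(n : ℝ)⁻¹ • ∑ i : Fin n, Z (x i) - v‖ ≤ ε / 2 := hx.1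
        rw [Fin.sum_univ_eq_sum_range (fun i ↦ Z (x i)) n] at h1
        set S := ∑ i ∈ Finset.range n, Z (x i)
        have h2 : S - t • v = (n : ℝ) • ((n : ℝ)⁻¹ • S - v) - (t - n) • v := by
          rw [smul_sub, smul_inv_smul₀ hn0'.ne', sub_smul]; abel
        change ‖S - t • v‖ ≤ ε * t
        rw [h2]
        refine (norm_sub_le _ _).trans ?_
        rw [norm_smul, norm_smul, Real.norm_eq_abs, Real.norm_eq_abs, abs_of_pos hn0',
          abs_of_nonneg (sub_nonneg.2 hnt)]
        rw [div_le_iff₀ hε] at htv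
        have h3 : (t - n) * ‖v‖ ≤ 1 * ‖v‖ := mul_le_mul_of_nonneg_right htn (norm_nonneg _)
        have h4 : (n : ℝ) * ‖(n : ℝ)⁻¹ • S - v‖ ≤ t * (ε / 2) :=
          mul_le_mul hnt h1 (norm_nonneg _) ht0
        linarith

end Accessible

/-! ### Concentrating the renewal time on rare long jumps -/

section Jumps

variable {X : Type*} [MeasurableSpace X] {μ : Measure X} {τ : X → ℝ≥0∞}

/-- If `e^{cT}` is not integrable on `B`, then for every `c' > c` infinitely many of the slabs
`{k < T ≤ k + 1}` carry a mass of at least `e^{-c'k}`: otherwise the integral would be bounded by a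
geometric series. -/
theorem exists_exp_neg_mul_le_measure_slab [IsProbabilityMeasure μ] (hτ : Measurable τ) {B : Set X}
    (hB : MeasurableSet B)
    {c c' : ℝ} (hc : 0 ≤ c) (hcc' : c < c')
    (h : ∫⁻ y in B, ENNReal.ofReal (Real.exp (c * realTime τ y)) ∂μ = ⊤) (k₀ : ℕ) :
    ∃ k : ℕ, k₀ ≤ k ∧ ENNReal.ofReal (Real.exp (-(c' * k))) ≤
      μ (B ∩ {y | (k : ℝ) < realTime τ y ∧ realTime τ y ≤ k + 1}) := by
  by_contra! hlt
  set s : ℕ → Set X := fun k ↦ B ∩ {y | (k : ℝ) < realTime τ y ∧ realTime τ y ≤ k + 1} with hs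
  have hsm : ∀ k, MeasurableSet (s k) := fun k ↦ hB.inter <|
    (measurableSet_lt measurable_const (measurable_realTime hτ)).inter
      (measurableSet_le (measurable_realTime hτ) measurable_const)
  set F : ℕ → X → ℝ≥0∞ := fun j ↦ (s (k₀ + j)).indicator fun _ ↦
    ENNReal.ofReal (Real.exp (c * ((k₀ + j : ℕ) + 1)))
  have hpt : ∀ y ∈ B, ENNReal.ofReal (Real.exp (c * realTime τ y)) ≤
      ENNReal.ofReal (Real.exp (c * k₀)) + ∑' j, F j y := by
    intro y hy
    rcases le_or_gt (realTime τ y) k₀ with hT | hT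
    · exact le_add_right (ENNReal.ofReal_le_ofReal
        (Real.exp_le_exp.2 (mul_le_mul_of_nonneg_left hT hc)))
    · obtain ⟨j, hj⟩ : ∃ j, ⌈realTime τ y⌉₊ = k₀ + j + 1 := by
        have := Nat.lt_ceil.2 hT
        exact ⟨⌈realTime τ y⌉₊ - k₀ - 1, by omega⟩
      have h1 : realTime τ y ≤ (k₀ + j : ℕ) + 1 := by
        have := Nat.le_ceil (realTime τ y)
        rw [hj] at this
        exact_mod_cast this
      have h2 : ((k₀ + j : ℕ) : ℝ) < realTime τ y := Nat.lt_ceil.1 (by omega)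
      refine le_add_left (le_trans ?_ (ENNReal.le_tsum j))
      have hmem : y ∈ s (k₀ + j) := ⟨hy, h2, h1⟩
      simp only [F, indicator_of_mem hmem]
      exact ENNReal.ofReal_le_ofReal (Real.exp_le_exp.2 (mul_le_mul_of_nonneg_left h1 hc))
  set q : ℝ≥0∞ := ENNReal.ofReal (Real.exp (-(c' - c)))
  have hq : q < 1 := by
    rw [← ENNReal.ofReal_one]
    exact (ENNReal.ofReal_lt_ofReal_iff one_pos).2 (Real.exp_lt_one_iff.2 (by linarith))
  have hF : ∀ j, ∫⁻ y in B, F j y ∂μ ≤ ENNReal.ofReal (Real.exp c) * q ^ j := fun j ↦ by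
    rw [lintegral_indicator_const (hsm _)]
    calc _ ≤ ENNReal.ofReal (Real.exp (c * ((k₀ + j : ℕ) + 1))) *
          ENNReal.ofReal (Real.exp (-(c' * (k₀ + j : ℕ)))) := by
          gcongr
          exact (Measure.restrict_apply_le _ _).trans (hlt (k₀ + j) (by omega)).le
      _ ≤ _ := by
          rw [← ENNReal.ofReal_mul (Real.exp_pos _).le, ← Real.exp_add,
            ← ENNReal.ofReal_pow (Real.exp_pos _).le, ← Real.exp_nat_mul,
            ← ENNReal.ofReal_mul (Real.exp_pos _).le, ← Real.exp_add]
          refine ENNReal.ofReal_le_ofReal (Real.exp_le_exp.2 ?_)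
          push_cast
          nlinarith [mul_nonneg (sub_nonneg.2 hcc'.le) (Nat.cast_nonneg (α := ℝ) k₀)]
  refine absurd h (ne_of_lt ?_)
  calc ∫⁻ y in B, ENNReal.ofReal (Real.exp (c * realTime τ y)) ∂μ
      ≤ ∫⁻ y in B, (ENNReal.ofReal (Real.exp (c * k₀)) + ∑' j, F j y) ∂μ :=
        setLIntegral_mono' hB hpt
    _ = ENNReal.ofReal (Real.exp (c * k₀)) * μ B + ∑' j, ∫⁻ y in B, F j y ∂μ := by
        rw [lintegral_add_left measurable_const, setLIntegral_const,
          lintegral_tsum fun j ↦ (measurable_const.indicator (hsm _)).aemeasurable]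
    _ ≤ ENNReal.ofReal (Real.exp (c * k₀)) * μ B +
          ∑' j, ENNReal.ofReal (Real.exp c) * q ^ j := by
        gcongr with j; exact hF j
    _ < ⊤ := by
        rw [ENNReal.tsum_mul_left, ENNReal.tsum_geometric]
        refine ENNReal.add_lt_top.2 ⟨ENNReal.mul_lt_top ENNReal.ofReal_lt_top (measure_lt_top μ B),
          ENNReal.mul_lt_top ENNReal.ofReal_lt_top (ENNReal.inv_lt_top.2 (tsub_pos_of_lt hq))⟩

end Jumps

/-- Spending the whole time in jumps of a large fixed size `k` near `y` costs `ξ(y)` per unit of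
time. -/
theorem accessible_of_xi_lt_top {X : Type*} [MetricSpace X] [MeasurableSpace X]
    [OpensMeasurableSpace X] {μ : Measure X} [IsProbabilityMeasure μ] {τ : X → ℝ≥0∞}
    (hτ : Measurable τ) (hA1 : μ {x | τ x = 0} = 0 ∧ μ {x | τ x = ⊤} = 0) {E : Type*}
    [NormedAddCommGroup E] [NormedSpace ℝ E] {G : X → E} {y : X} (hG : ContinuousAt G y)
    (hy : xi μ τ y < ⊤) :
    Accessible μ (fun x ↦ realTime τ x • G x) (G y, (xi μ τ y).toReal) := by
  intro ε hε
  set ξ := (xi μ τ y).toReal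
  have hξ0 : 0 ≤ ξ := ENNReal.toReal_nonneg
  obtain ⟨δ, hδ, hball⟩ := Metric.continuousAt_iff.1 hG (ε / 6) (by positivity)
  have htop := lintegral_exp_ball_eq_top hA1 (c := ξ + ε / 2) (x := y)
    ((ENNReal.lt_ofReal_iff_toReal_lt hy.ne).2 (by linarith)) hδ
  obtain ⟨k₀, hk₀⟩ := exists_nat_ge (3 * ‖G y‖ / ε)
  -- With `k ≥ 3 ‖G y‖ / ε` the spread of the jump sizes over `(k, k + 1]` is harmless, since only
  -- about `t / k` jumps are made.
  obtain ⟨k, hk, hmass⟩ := exists_exp_neg_mul_le_measure_slab hτ measurableSet_ball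
    (c' := ξ + ε) (by positivity) (by linarith) htop (k₀ + 1)
  set s := Metric.ball y δ ∩ {z | (k : ℝ) < realTime τ z ∧ realTime τ z ≤ k + 1}
  have hsm : MeasurableSet s := measurableSet_ball.inter <|
    (measurableSet_lt measurable_const (measurable_realTime hτ)).inter
      (measurableSet_le (measurable_realTime hτ) measurable_const)
  have hk1 : (k₀ : ℝ) + 1 ≤ k := by exact_mod_cast hk
  have hk1' : (1 : ℝ) ≤ k := by linarith [Nat.cast_nonneg (α := ℝ) k₀]
  have hkpos : (0 : ℝ) < k := by linarith
  have hkG : 3 * ‖G y‖ ≤ k * ε := by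
    rw [div_le_iff₀ hε] at hk₀
    nlinarith
  filter_upwards [eventually_ge_atTop 0, eventually_ge_atTop (3 * k * ‖G y‖ / ε)] with t ht0 ht
  rw [div_le_iff₀ hε] at ht
  set n := ⌊t / k⌋₊
  have hn1 : (n : ℝ) ≤ t / k := Nat.floor_le (by positivity)
  have hnk : n * k ≤ t := (le_div_iff₀ hkpos).1 hn1
  have hnk' : t < n * k + k := by
    have := (div_lt_iff₀ hkpos).1 (Nat.lt_floor_add_one (t / k))
    linarith
  have hnt : (n : ℝ) ≤ n * k := le_mul_of_one_le_right (Nat.cast_nonneg n) hk1'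
  refine ⟨n, ?_⟩
  calc ENNReal.ofReal (Real.exp (-(t * (ξ + ε))))
      ≤ ENNReal.ofReal (Real.exp (-((ξ + ε) * k))) ^ n := by
        rw [← ENNReal.ofReal_pow (Real.exp_pos _).le, ← Real.exp_nat_mul]
        refine ENNReal.ofReal_le_ofReal (Real.exp_le_exp.2 ?_)
        nlinarith
    _ ≤ μ s ^ n := by gcongr
    _ = (Measure.infinitePi fun _ : ℕ ↦ μ) (Set.pi (Finset.range n) fun _ ↦ s) := by
        rw [Measure.infinitePi_pi _ fun _ _ ↦ hsm, Finset.prod_const, Finset.card_range]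
    _ ≤ _ := by
        refine measure_mono fun x hx ↦ ?_
        have hx' : ∀ l ∈ Finset.range n, x l ∈ s := fun l hl ↦ hx l (by simpa using hl)
        set S := ∑ l ∈ Finset.range n, realTime τ (x l)
        have hS1 : n * k ≤ S := by
          have := Finset.card_nsmul_le_sum (Finset.range n) (fun l ↦ realTime τ (x l)) (k : ℝ)
            fun l hl ↦ (hx' l hl).2.1.le
          simpa using this
        have hS2 : S ≤ n * (k + 1) := by
          have := Finset.sum_le_card_nsmul (Finset.range n) (fun l ↦ realTime τ (x l)) (k + 1 : ℝ)
            fun l hl ↦ (hx' l hl).2.2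
          simpa [S, mul_add] using this
        have hdec : ∑ l ∈ Finset.range n, realTime τ (x l) • G (x l) - t • G y =
            ∑ l ∈ Finset.range n, realTime τ (x l) • (G (x l) - G y) + (S - t) • G y := by
          simp only [smul_sub, Finset.sum_sub_distrib, S, sub_smul, Finset.sum_smul]
          abel
        have h1 : ‖∑ l ∈ Finset.range n, realTime τ (x l) • (G (x l) - G y)‖ ≤ S * (ε / 6) := by
          rw [Finset.sum_mul]
          refine norm_sum_le_of_le _ fun l hl ↦ ?_
          rw [norm_smul, Real.norm_eq_abs, abs_of_nonneg (realTime_nonneg τ _), ← dist_eq_norm]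
          exact mul_le_mul_of_nonneg_left (hball (hx' l hl).1).le (realTime_nonneg τ _)
        have h2 : |S - t| ≤ t / k + k := abs_le.2 ⟨by linarith [div_nonneg ht0 hkpos.le],
          by linarith⟩
        have h3 : t / k * ‖G y‖ ≤ ε / 3 * t := by
          rw [div_mul_eq_mul_div, div_le_iff₀ hkpos]
          nlinarith
        change ‖∑ l ∈ Finset.range n, realTime τ (x l) • G (x l) - t • G y‖ ≤ ε * t
        rw [hdec]
        refine (norm_add_le _ _).trans ?_
        rw [norm_smul, Real.norm_eq_abs]
        have h4 := mul_le_mul_of_nonneg_right h2 (norm_nonneg (G y))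
        have h5 : S * (ε / 6) ≤ 2 * t * (ε / 6) :=
          mul_le_mul_of_nonneg_right (by linarith) (by positivity)
        nlinarith

/-! ### The lower bound -/

section LowerBound

variable {X : Type*} [MetricSpace X] [MeasurableSpace X] [BorelSpace X] {μ : Measure X}
  [IsProbabilityMeasure μ] {τ : X → ℝ≥0∞}

/-- Integrating a bounded continuous function against `ν` costs at most the rate at `ν`: the
absolutely continuous part is reached by tilting the law of the `x_i` to the normalized measure, the
singular part as a superposition of long jumps. -/
theorem accessible_rate (hτ : Measurable τ) (hA1 : μ {x | τ x = 0} = 0 ∧ μ {x | τ x = ⊤} = 0)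
    {E : Type*} [NormedAddCommGroup E] [NormedSpace ℝ E] [CompleteSpace E] [MeasurableSpace E]
    [BorelSpace E] [SecondCountableTopology E] (G : X →ᵇ E) (ν : ProbabilityMeasure X)
    (hν : rate μ τ ν ≠ ⊤) :
    Accessible μ (fun x ↦ realTime τ x • G x)
      (∫ y, G y ∂(ν : Measure X), (rate μ τ ν).toReal) := by
  set lam := acPart μ (ν : Measure X) with hlam
  set σ := (ν : Measure X).singularPart μ with hσ
  set Z : X → E := fun x ↦ realTime τ x • G x
  have hG : Measurable G := G.continuous.measurable
  have hZ : Measurable Z := (measurable_realTime hτ).smul hG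
  have hsum : (ν : Measure X) = σ + lam := Measure.haveLebesgueDecomposition_add (ν : Measure X) μ
  have hlamμ : lam ≪ μ := withDensity_absolutelyContinuous _ _
  have hGν : Integrable G (ν : Measure X) := G.integrable _
  have hGlam : Integrable G lam := hGν.mono_measure (by rw [hsum]; exact Measure.le_add_left le_rfl)
  have hGσ : Integrable G σ := hGν.mono_measure (by rw [hsum]; exact Measure.le_add_right le_rfl)
  have hm : invTimeIntegral τ lam < ⊤ := by
    by_contra hm
    exact hν (if_neg hm)
  have hrate : rate μ τ ν = invTimeIntegral τ lam * InformationTheory.klDiv (barMeasure τ lam) μ +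
      ∫⁻ x, xi μ τ x ∂σ := if_pos hm
  rw [hrate, ENNReal.add_ne_top] at hν
  have hξ : ∀ᵐ y ∂σ, xi μ τ y < ⊤ :=
    ae_lt_top (lowerSemicontinuous_xi μ τ).measurable hν.2
  have hsing : Accessible μ Z (∫ y, G y ∂σ, (∫⁻ x, xi μ τ x ∂σ).toReal) := by
    have hint : Integrable (fun y ↦ (xi μ τ y).toReal) σ :=
      integrable_toReal_of_lintegral_ne_top (lowerSemicontinuous_xi μ τ).measurable.aemeasurable
        hν.2
    have h := accessible_integral (μ := μ) hZ (hGσ.prodMk hint)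
      (hξ.mono fun y hy ↦ accessible_of_xi_lt_top hτ hA1 G.continuous.continuousAt hy)
    rwa [integral_pair hGσ hint,
      integral_toReal (lowerSemicontinuous_xi μ τ).measurable.aemeasurable hξ] at h
  have hac : Accessible μ Z (∫ y, G y ∂lam,
      (invTimeIntegral τ lam * InformationTheory.klDiv (barMeasure τ lam) μ).toReal) := by
    have hpos : ∀ᵐ y ∂lam, τ y ≠ ⊤ ∧ 0 < realTime τ y := hlamμ.ae_le (ae_realTime_pos hA1)
    rcases eq_or_ne (invTimeIntegral τ lam) 0 with h0 | h0
    · -- Here `ν_a = 0` because `τ` is finite almost everywhere.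
      have hzero : lam = 0 := by
        have h1 := (lintegral_eq_zero_iff (f := fun y ↦ (τ y)⁻¹) hτ.inv).1 h0
        refine ae_eq_bot.1 (eventually_false_iff_eq_bot.1 ?_)
        filter_upwards [h1, hpos] with y hy hy'
        exact hy'.1 (ENNReal.inv_eq_zero.1 hy)
      rw [h0, hzero, integral_zero_measure, zero_mul]
      exact accessible_zero
    · have hpos' := hpos.mono fun y hy ↦ hy.2
      have := isProbabilityMeasure_barMeasure h0 hm.ne
      have hkl : InformationTheory.klDiv (barMeasure τ lam) μ ≠ ⊤ := fun h ↦
        hν.1 (by rw [h, ENNReal.mul_top h0])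
      have h := (accessible_of_klDiv_ne_top (μ := μ) hZ
        (integrable_realTime_smul_barMeasure hτ hpos' h0 hGlam) hkl).smul
        (c := (invTimeIntegral τ lam).toReal) ENNReal.toReal_nonneg
      rw [Prod.smul_mk, ← integral_inv_realTime_smul hτ hpos' h0 hm.ne, smul_eq_mul,
        ← ENNReal.toReal_mul] at h
      rwa [integral_congr_ae (hpos'.mono fun y hy ↦ ?_)] at h
      exact inv_smul_smul₀ hy.ne' _
  have h := hac.add hZ hsing
  rwa [Prod.mk_add_mk, ← ENNReal.toReal_add hν.1 hν.2, ← hrate, add_comm (∫ y, G y ∂lam),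
    ← integral_add_measure hGσ hGlam, ← hsum] at h

/-- The local form of the lower bound. The constant function `1` is added to the test functions
that define a neighbourhood of `ν`, so that the partial sums which are close to their target stop
at a time close to `t`, where they compare with the empirical measure. -/
theorem eventually_exp_le_measure_empiricalMeasure_mem (hτ : Measurable τ)
    (hA1 : μ {x | τ x = 0} = 0 ∧ μ {x | τ x = ⊤} = 0) {O : Set (ProbabilityMeasure X)}
    (hO : IsOpen O) {ν : ProbabilityMeasure X} (hνO : ν ∈ O) (hν : rate μ τ ν ≠ ⊤) {ε : ℝ}
    (hε : 0 < ε) :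
    ∀ᶠ t : Ioi (0 : ℝ) in atTop, ENNReal.ofReal (Real.exp (-(t * ((rate μ τ ν).toReal + ε)))) ≤
      (Measure.infinitePi fun _ : ℕ ↦ μ) {x | empiricalMeasure τ t x ∈ O} := by
  classical
  obtain ⟨I, ε₀, hε₀, hI⟩ := exists_finset_integral_lt_subset hO hνO
  set I' : Finset (X →ᵇ ℝ) := insert (BoundedContinuousFunction.const X 1) I
  obtain ⟨M, hM0, hM⟩ : ∃ M : ℝ, 0 ≤ M ∧ ∀ g ∈ I', ‖g‖ ≤ M :=
    ⟨∑ g ∈ I', ‖g‖, Finset.sum_nonneg fun _ _ ↦ norm_nonneg _, fun g hg ↦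
      Finset.single_le_sum (f := fun g : X →ᵇ ℝ ↦ ‖g‖) (fun _ _ ↦ norm_nonneg _) hg⟩
  have hGc : Continuous fun y (g : I') ↦ (g : X →ᵇ ℝ) y :=
    continuous_pi fun g ↦ g.1.continuous
  set G : X →ᵇ (I' → ℝ) := BoundedContinuousFunction.ofNormedAddCommGroup _ hGc M fun y ↦
    (pi_norm_le_iff_of_nonneg hM0).2 fun g ↦ (g.1.norm_coe_le_norm y).trans (hM g.1 g.2)
  obtain ⟨ε₁, hε₁, hε₁ε, hε₁M⟩ : ∃ ε₁ : ℝ, 0 < ε₁ ∧ ε₁ ≤ ε ∧ ε₁ * (M + 1) < ε₀ := by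
    refine ⟨min ε (ε₀ / (2 * (M + 1))), by positivity, min_le_left _ _, ?_⟩
    calc _ ≤ ε₀ / (2 * (M + 1)) * (M + 1) := by gcongr; exact min_le_right _ _
      _ = ε₀ / 2 := by field_simp
      _ < ε₀ := by linarith
  have hacc := tendsto_coe_Ioi_atTop.eventually (accessible_rate hτ hA1 G ν hν ε₁ hε₁)
  filter_upwards [hacc] with t ⟨n, hn⟩
  have ht : (0 : ℝ) < t := t.2
  refine le_trans (ENNReal.ofReal_le_ofReal (Real.exp_le_exp.2 ?_)) (hn.trans ?_)
  · rw [neg_le_neg_iff]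
    exact mul_le_mul_of_nonneg_left (by simpa using hε₁ε) ht.le
  refine measure_mono_ae ?_
  filter_upwards [ae_infinitePi_forall (ae_realTime_pos hA1)] with x hxpos hx
  have hcoord : ∀ g ∈ I', |∑ l ∈ Finset.range n, realTime τ (x l) * g (x l) -
      t * ∫ y, g y ∂(ν : Measure X)| ≤ ε₁ * t := fun g hg ↦ by
    have h := (norm_le_pi_norm _ (⟨g, hg⟩ : I')).trans hx
    have hint : (∫ y, G y ∂(ν : Measure X)) ⟨g, hg⟩ = ∫ y, g y ∂(ν : Measure X) :=
      eval_integral (f := fun y (g : I') ↦ (g : X →ᵇ ℝ) y) (fun g ↦ g.1.integrable _) ⟨g, hg⟩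
    simp only [Pi.sub_apply, Finset.sum_apply, Pi.smul_apply, smul_eq_mul, hint,
      Real.norm_eq_abs] at h
    exact h
  have htime : |realArrival τ x n - t| ≤ ε₁ * t := by
    have h := hcoord _ (Finset.mem_insert_self _ _)
    simpa [realArrival] using h
  refine hI _ fun g hg ↦ ?_
  have hg' : g ∈ I' := Finset.mem_insert_of_mem hg
  have h1 := abs_mul_integral_empiricalMeasure_sub_le (fun i ↦ (hxpos i).1) t
    g.continuous.measurable (fun y ↦ (g.norm_coe_le_norm y).trans (hM g hg')) n
  have h2 := hcoord g hg'
  have h3 : M * |realArrival τ x n - t| ≤ M * (ε₁ * t) := mul_le_mul_of_nonneg_left htime hM0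
  have h4 : |t * (∫ y, g y ∂(empiricalMeasure τ t x : Measure X) - ∫ y, g y ∂(ν : Measure X))| ≤
      t * (ε₁ * (M + 1)) := by
    have := abs_add_le
      (t * ∫ y, g y ∂(empiricalMeasure τ t x : Measure X) -
        ∑ l ∈ Finset.range n, realTime τ (x l) * g (x l))
      (∑ l ∈ Finset.range n, realTime τ (x l) * g (x l) - t * ∫ y, g y ∂(ν : Measure X))
    rw [sub_add_sub_cancel, ← mul_sub] at this
    linarith
  rw [abs_mul, abs_of_pos ht] at h4
  exact (le_of_mul_le_mul_left h4 ht).trans_lt hε₁M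

end LowerBound

/-! ### The rate function and the large deviations principle -/

section LDP

variable {X : Type*} [MetricSpace X] [MeasurableSpace X] [BorelSpace X] {μ : Measure X}
  [IsProbabilityMeasure μ] {τ : X → ℝ≥0∞}

/-- The lower bound turns an exponential upper bound on an open set into a lower bound for the
rate on this set. -/
theorem le_toReal_rate_of_eventually_le (hτ : Measurable τ)
    (hA1 : μ {x | τ x = 0} = 0 ∧ μ {x | τ x = ⊤} = 0) {O : Set (ProbabilityMeasure X)}
    (hO : IsOpen O) {ν : ProbabilityMeasure X} (hνO : ν ∈ O) (hν : rate μ τ ν ≠ ⊤) {b : ℝ}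
    {K : ℝ≥0∞} (hK : K ≠ ⊤)
    (h : ∀ᶠ t : Ioi (0 : ℝ) in atTop, (Measure.infinitePi fun _ : ℕ ↦ μ)
      {x | empiricalMeasure τ t x ∈ O} ≤ K * ENNReal.ofReal (Real.exp (-(t * b)))) :
    b ≤ (rate μ τ ν).toReal := by
  refine le_of_forall_pos_le_add fun ε hε ↦ ?_
  have h1 := limsup_log_le_of_eventually_le hK h
  have h2 := le_liminf_log_of_eventually_le
    (eventually_exp_le_measure_empiricalMeasure_mem hτ hA1 hO hνO hν hε)
  exact neg_le_neg_iff.1 (EReal.coe_le_coe_iff.1 ((h2.trans liminf_le_limsup).trans h1))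

/-- The rate at `ν` is at least the supremum of the integrals `∫ f dν` over the bounded continuous
`f` with `∫ e^{f τ} dμ < 1`. -/
theorem integral_le_toReal_rate (hτ : Measurable τ)
    (hA1 : μ {x | τ x = 0} = 0 ∧ μ {x | τ x = ⊤} = 0) {f : X →ᵇ ℝ}
    (hf : ∫⁻ y, ENNReal.ofReal (Real.exp (f y * realTime τ y)) ∂μ < 1)
    {ν : ProbabilityMeasure X} (hν : rate μ τ ν ≠ ⊤) :
    ∫ y, f y ∂(ν : Measure X) ≤ (rate μ τ ν).toReal := by
  refine le_of_forall_lt fun a ha ↦ ?_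
  obtain ⟨b, hab, hb⟩ := exists_between ha
  refine hab.trans_le (le_toReal_rate_of_eventually_le hτ hA1
    (isOpen_lt continuous_const (continuous_integral_probabilityMeasure f)) hb hν
    (K := 2 * (1 - ∫⁻ y, ENNReal.ofReal (Real.exp (f y * realTime τ y)) ∂μ)⁻¹)
    (ENNReal.mul_ne_top (by simp) (ENNReal.inv_ne_top.2 (tsub_pos_of_lt hf).ne'))
    (Eventually.of_forall fun t ↦ ?_))
  rw [mul_comm]
  refine le_trans (measure_mono fun x hx ↦ ?_) (measure_le_integral_empiricalMeasure_le hτ hA1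
    f.continuous.measurable f.norm_coe_le_norm b t)
  have hlt : b < ∫ y, f y ∂(empiricalMeasure τ t x : Measure X) := hx
  exact hlt.le

variable [PolishSpace X]

theorem isClosed_rate_le (hτ : Measurable τ) (hA1 : μ {x | τ x = 0} = 0 ∧ μ {x | τ x = ⊤} = 0)
    (hA2 : μ {x | xi μ τ x < ⊤} = 0) (M : ℝ≥0) :
    IsClosed {ν : ProbabilityMeasure X | rate μ τ ν ≤ M} := by
  rw [← isOpen_compl_iff, isOpen_iff_mem_nhds]
  intro ν hν
  have hν' : ((M : ℝ) : EReal) < (rate μ τ ν : ℝ≥0∞) := by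
    have : ((M : ℝ≥0∞) : EReal) < (rate μ τ ν : ℝ≥0∞) :=
      EReal.coe_ennreal_lt_coe_ennreal_iff.2 (not_le.1 hν)
    exact this
  obtain ⟨f, hf, hfν⟩ := exists_boundedContinuous_of_lt_rate hτ hA1 hA2 ν hν'
  refine mem_of_superset ((isOpen_lt continuous_const
    (continuous_integral_probabilityMeasure f)).mem_nhds hfν) fun ν' hlt hle ↦ ?_
  have h1 := integral_le_toReal_rate hτ hA1 hf (ne_top_of_le_ne_top ENNReal.coe_ne_top hle)
  have h2 : (rate μ τ ν').toReal ≤ M := ENNReal.toReal_mono ENNReal.coe_ne_top hle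
  exact absurd (h1.trans h2) (not_le.2 hlt)

/-- The closed sublevel set at height `M` lies in a compact set outside of which the empirical
measures have probability `e^{-t(M+1)}`. -/
theorem isCompact_rate_le (hτ : Measurable τ) (hA1 : μ {x | τ x = 0} = 0 ∧ μ {x | τ x = ⊤} = 0)
    (hA2 : μ {x | xi μ τ x < ⊤} = 0) (hA3 : xiInfty μ τ = ⊤) (M : ℝ≥0) :
    IsCompact {ν : ProbabilityMeasure X | rate μ τ ν ≤ M} := by
  obtain ⟨𝒦, h𝒦, D, hD, hle⟩ := exponential_tightness hτ hA1 hA3 (b := M + 1) (by positivity)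
  refine h𝒦.of_isClosed_subset (isClosed_rate_le hτ hA1 hA2 M) fun ν hν ↦ ?_
  by_contra hν𝒦
  have h1 := le_toReal_rate_of_eventually_le hτ hA1 h𝒦.isClosed.isOpen_compl hν𝒦
    (ne_top_of_le_ne_top ENNReal.coe_ne_top hν) hD
    ((tendsto_coe_Ioi_atTop.eventually_ge_atTop 1).mono hle)
  have h2 : (rate μ τ ν).toReal ≤ M := ENNReal.toReal_mono ENNReal.coe_ne_top hν
  linarith

theorem measurableSet_borel_of_isOpen {Y : Type*} [TopologicalSpace Y] {O : Set Y}
    (hO : IsOpen O) : @MeasurableSet Y (borel Y) O :=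
  MeasurableSpace.measurableSet_generateFrom hO

theorem limsup_empiricalLaw_le (hτ : Measurable τ)
    (hA1 : μ {x | τ x = 0} = 0 ∧ μ {x | τ x = ⊤} = 0) (hA2 : μ {x | xi μ τ x < ⊤} = 0)
    (hA3 : xiInfty μ τ = ⊤) {C : Set (ProbabilityMeasure X)} (hC : IsClosed C) :
    limsup (fun t : Ioi (0 : ℝ) ↦
        ((1 / (t : ℝ) : ℝ) : EReal) * ENNReal.log (empiricalLaw μ τ t C)) atTop
      ≤ -((⨅ u ∈ C, rate μ τ u : ℝ≥0∞) : EReal) := by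
  by_contra! hlt
  obtain ⟨a, ha1, ha2⟩ := EReal.lt_iff_exists_real_btwn.1 hlt
  have ha : ((-a : ℝ) : EReal) < (⨅ u ∈ C, rate μ τ u : ℝ≥0∞) := by
    rw [EReal.coe_neg]; exact EReal.neg_lt_comm.1 ha1
  obtain ⟨D, hD, hle⟩ := upper_bound_of_isClosed hτ hA1 hA3 hC (a := -a) fun ν hν ↦
    exists_boundedContinuous_of_lt_rate hτ hA1 hA2 ν
      (ha.trans_le (EReal.coe_ennreal_le_coe_ennreal_iff.2 (iInf₂_le ν hν)))
  have hCm : @MeasurableSet _ (borel (ProbabilityMeasure X)) C :=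
    (@MeasurableSet.compl_iff _ C (borel _)).1 (measurableSet_borel_of_isOpen hC.isOpen_compl)
  have h := limsup_log_le_of_eventually_le (Q := fun t ↦ empiricalLaw μ τ t C) (a := -a) hD <| by
    filter_upwards [tendsto_coe_Ioi_atTop.eventually_ge_atTop 1] with t ht
    rw [empiricalLaw_apply μ hτ t hCm]
    exact hle t ht
  rw [neg_neg] at h
  exact absurd ha2 (not_lt.2 h)

theorem le_liminf_empiricalLaw (hτ : Measurable τ)
    (hA1 : μ {x | τ x = 0} = 0 ∧ μ {x | τ x = ⊤} = 0) {O : Set (ProbabilityMeasure X)}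
    (hO : IsOpen O) :
    -((⨅ u ∈ O, rate μ τ u : ℝ≥0∞) : EReal) ≤ liminf (fun t : Ioi (0 : ℝ) ↦
      ((1 / (t : ℝ) : ℝ) : EReal) * ENNReal.log (empiricalLaw μ τ t O)) atTop := by
  by_contra! hlt
  obtain ⟨a, ha1, ha2⟩ := EReal.lt_iff_exists_real_btwn.1 hlt
  have ha : ((⨅ u ∈ O, rate μ τ u : ℝ≥0∞) : EReal) < ((-a : ℝ) : EReal) := by
    rw [EReal.coe_neg]; exact EReal.lt_neg_comm.1 ha2
  have ha0 : 0 ≤ -a := EReal.coe_nonneg.1 ((EReal.coe_ennreal_nonneg _).trans ha.le)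
  rw [← max_eq_left ha0, ← EReal.coe_ennreal_ofReal,
    EReal.coe_ennreal_lt_coe_ennreal_iff] at ha
  simp only [iInf_lt_iff] at ha
  obtain ⟨ν, hν, hlt⟩ := ha
  have hr : (rate μ τ ν).toReal < -a := (ENNReal.lt_ofReal_iff_toReal_lt hlt.ne_top).1 hlt
  have h := le_liminf_log_of_eventually_le (Q := fun t ↦ empiricalLaw μ τ t O) (b := -a) <| by
    filter_upwards [eventually_exp_le_measure_empiricalMeasure_mem hτ hA1 hO hν hlt.ne_top
      (sub_pos.2 hr)] with t ht
    rw [empiricalLaw_apply μ hτ t (measurableSet_borel_of_isOpen hO)]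
    simpa using ht
  rw [neg_neg] at h
  exact absurd ha1 (not_lt.2 h)

/-- If the rate were identically infinite, then the upper bound on the whole space would contradict
`P_t(𝒫(X)) = 1`. -/
theorem exists_rate_ne_top (hτ : Measurable τ) (hA1 : μ {x | τ x = 0} = 0 ∧ μ {x | τ x = ⊤} = 0)
    (hA2 : μ {x | xi μ τ x < ⊤} = 0) (hA3 : xiInfty μ τ = ⊤) :
    ∃ ν : ProbabilityMeasure X, rate μ τ ν ≠ ⊤ := by
  by_contra! htop
  have h1 := limsup_empiricalLaw_le hτ hA1 hA2 hA3 isClosed_univ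
  have h2 := le_liminf_log_of_eventually_le (Q := fun t ↦ empiricalLaw μ τ t univ) (b := 0) <|
    Eventually.of_forall fun t ↦ by
      have := isProbabilityMeasure_empiricalLaw μ hτ t
      simp
  have h3 := (h2.trans liminf_le_limsup).trans h1
  simp [htop] at h3

end LDP

end RenewalLDP

theorem theorem1p3 {X : Type*} [MetricSpace X] [PolishSpace X] [MeasurableSpace X] [BorelSpace X]
    (μ : Measure X) [IsProbabilityMeasure μ] (τ : X → ℝ≥0∞) (hτ : Measurable τ)
    (hA1 : μ {x | τ x = 0} = 0 ∧ μ {x | τ x = ⊤} = 0)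
    (hA2 : μ {x | RenewalLDP.xi μ τ x < ⊤} = 0)
    (hA3 : RenewalLDP.xiInfty μ τ = ⊤) :
    RenewalLDP.GoodLDP (RenewalLDP.empiricalLaw μ τ) (RenewalLDP.rate μ τ) where
  isProbabilityMeasure := RenewalLDP.isProbabilityMeasure_empiricalLaw μ hτ
  isGoodRate := ⟨fun M _ ↦ RenewalLDP.isCompact_rate_le hτ hA1 hA2 hA3 M,
    RenewalLDP.exists_rate_ne_top hτ hA1 hA2 hA3⟩
  upper_bound _ hC := RenewalLDP.limsup_empiricalLaw_le hτ hA1 hA2 hA3 hC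
  lower_bound _ hO := RenewalLDP.le_liminf_empiricalLaw hτ hA1 hO
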